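/- **($N$-soliton formula.)** Let $\alpha>0$, $u_0>0$, $u_\pm\in\mathbb C$ with $|u_\pm|=u_0$, and let $u=u(x,t)$ be a $C^2$ solution on $\mathbb R\times\mathbb R$ of the modified NLS equation $$iu_t+u_{xx}+4i\alpha u_x+\tfrac{i}{\alpha}(|u|^2u)_x=0,\qquad \lim_{x\to\pm\infty}u(x,t)=u_\pm ,$$ (equivalently, $q=u\,e^{-4i\alpha^2t+2i\alpha x}$ solves $iq_t+q_{xx}+2|q|^2q+\frac i\alpha(|q|^2q)_x=0$ with $q\sim u_\pm e^{-4i\alpha^2t+2i\alpha x}$), where $u\to u_\pm$ and $u_x\to0$ as $x\to\pm\infty$ locally uniformly in $t$ and, for every $t$, $(1+|x|)(u-u_\pm)\in L^1(\mathbb R^\pm)$ and $u_x\in L^1(\mathbb R)$. Put $k(z)=\frac1{2\alpha}(z-\frac{u_0^2}z)$, $\lambda(z)=\frac12(z+\frac{u_0^2}z)$, $\gamma=1+\frac{u_0^2}{z^2}$, $\theta(x,t,z)=-k\lambda\,[x+(2\alpha k^2-4\alpha-\frac{u_0^2}\alpha)t]$, $D^\pm=\{\mp\,\mathrm{Re}\,z\,\mathrm{Im}\,z>0\}$,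 $\Sigma=(\mathbb R\cup i\mathbb R)\setminus\{0,\pm iu_0\}$, $Q=\begin{pmatrix}0&u\\u^*&0\end{pmatrix}$, $Q_\pm=\begin{pmatrix}0&u_\pm\\u_\pm^*&0\end{pmatrix}$, $\sigma_3=\mathrm{diag}(1,-1)$. Let $\phi_\pm=(\phi_{\pm,1},\phi_{\pm,2})$ be the Jost solutions, i.e. the solutions of the Lax pair $\phi_x=X\phi$, $\phi_t=T\phi$, $$X=-i\alpha k^2\sigma_3+ikQ,\quad T=(-2i\alpha^2k^4+4i\alpha^2k^2+ik^2|u|^2)\sigma_3+2i\alpha k(k^2-2)Q-\tfrac i\alpha kQ^3-k\sigma_3Q_x,$$ with $\phi_\pm e^{-i\theta\sigma_3}\to I+\frac1z\sigma_3Q_\pm$ as $x\to\pm\infty$; the columns $\phi_{+,1},\phi_{-,2}$ are taken for $z\in D^+\cup\Sigma$ and $\phi_{-,1},\phi_{+,2}$ for $z\in D^-\cup\Sigma$. Let $s_{11}=\det(\phi_{+,1},\phi_{-,2})/\gamma$, $s_{21}=\det(\phi_{-,1},\phi_{+,1})/\gamma$ and $\rho=s_{21}/s_{11}$. Assume that $u$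 is reflectionless ($s_{11}\ne0$ and $\rho=0$ on $\Sigma$), and that the discrete spectrum is simple and equal to $\{\pm\zeta_n,\pm\zeta_n^*\}_{n=1}^{2N_1+N_2}$: the zeros of $s_{11}$ in $D^+$ are simple and are exactly the points $\pm\zeta_n$, where $\zeta_n=z_n$ and $\zeta_{N_1+n}=-u_0^2/z_n^*$ for $n\le N_1$, with distinct $z_n\in D^+$, $\mathrm{Im}\,z_n>0$, $|z_n|>u_0$, and $\zeta_{2N_1+m}=w_m$ for $m\le N_2$, with distinct $w_m\in\{u_0e^{i\varphi}:\frac\pi2<\varphi<\pi\}$. Let $b_n$ be the constants with $\phi_{+,1}(x,t,\zeta_n)=b_n\phi_{-,2}(x,t,\zeta_n)$, and let $C_n=b_n/s_{11}'(\zeta_n)$ be the norming constants. Define, for $n,k=1,\dots,2N_1+N_2$, $$c_j(x,t,z)=\frac{C_j}{z^2-\zeta_j^2}e^{-2i\theta(x,t,\zeta_j)},\qquad A_{nk}=4\sum_{j}\zeta_j^2\,c_j(x,t,\zeta_n^*)\,\big(c_k(x,t,\zeta_j^*)\big)^*,$$ $$B_n=1+2u_-\sum_jc_j(x,t,\zeta_n^*),\quad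 Y_n=C_n^*e^{2i\theta(x,t,\zeta_n^*)},\quad M=I+A,\quad M^{\rm aug}=\begin{pmatrix}0&Y\\B&M\end{pmatrix}.$$ Then $\det M\neq0$ for all $(x,t)$, and $$u(x,t)=e^{2i\nu_-}u_-+2e^{2i\nu_-}\frac{\det M^{\rm aug}}{\det M},\qquad \nu_-(x,t)=\frac1{2\alpha}\int_{-\infty}^x(u_0^2-|u(y,t)|^2)\,dy .$$ -/

import Mathlib

open scoped ComplexConjugate

noncomputable section

namespace MNLS

/-! ### Uniformization variable and phase -/

/-- `k(z) = (z - u₀²/z) / (2α)`. -/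
def specK (α u₀ : ℝ) (z : ℂ) : ℂ := (z - (u₀ : ℂ) ^ 2 / z) / (2 * α)

/-- `λ(z) = (z + u₀²/z) / 2`. -/
def specLam (u₀ : ℝ) (z : ℂ) : ℂ := (z + (u₀ : ℂ) ^ 2 / z) / 2

/-- `θ(x,t,z) = -k(z) λ(z) [x + (2α k(z)² - 4α - u₀²/α) t]`. -/
def theta (α u₀ : ℝ) (x t : ℝ) (z : ℂ) : ℂ :=
  -(specK α u₀ z * specLam u₀ z *
    ((x : ℂ) + (2 * α * specK α u₀ z ^ 2 - 4 * α - (u₀ : ℂ) ^ 2 / α) * t))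

/-- `D⁺ = {z : Re z · Im z < 0}`. -/
def Dplus : Set ℂ := {z | z.re * z.im < 0}

/-- The boundary `Σ = (ℝ ∪ iℝ) \ {0}` with the two branch points `z = ± i u₀`
(the zeros of `γ(z) = 1 + u₀²/z²`, where the scattering matrix is not defined) removed. -/
def contour (u₀ : ℝ) : Set ℂ := {z | z.re * z.im = 0 ∧ z ≠ 0 ∧ z ^ 2 + (u₀ : ℂ) ^ 2 ≠ 0}

/-! ### The equation and the class of solutions -/

/-- `u` is a classical solution of
`i u_t + u_xx + 4 i α u_x + (i/α) (|u|² u)_x = 0` on `ℝ × ℝ`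
with the boundary values `u → u₋` (`x → -∞`), `u → u₊` (`x → +∞`), attained in the sense in
which direct scattering theory is set up. Arguments are in the order `u x t`. -/
structure IsNZBCSolution (α : ℝ) (um up : ℂ) (u : ℝ → ℝ → ℂ) : Prop where
  smooth : ContDiff ℝ 2 (fun p : ℝ × ℝ => u p.1 p.2)
  equation : ∀ x t : ℝ,
    Complex.I * deriv (fun s => u x s) t
      + deriv (fun y => deriv (fun y' => u y' t) y) x
      + 4 * Complex.I * α * deriv (fun y => u y t) x
      + Complex.I / α * deriv (fun y => (‖u y t‖ : ℂ) ^ 2 * u y t) x = 0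
  tendsto_left : TendstoLocallyUniformly (fun x t => u x t) (fun _ => um) Filter.atBot
  tendsto_right : TendstoLocallyUniformly (fun x t => u x t) (fun _ => up) Filter.atTop
  deriv_tendsto_left :
    TendstoLocallyUniformly (fun x t => deriv (fun y => u y t) x) (fun _ => 0) Filter.atBot
  deriv_tendsto_right :
    TendstoLocallyUniformly (fun x t => deriv (fun y => u y t) x) (fun _ => 0) Filter.atTop
  integrable_left : ∀ t : ℝ,
    MeasureTheory.IntegrableOn (fun x : ℝ => (1 + |x|) * ‖u x t - um‖) (Set.Iic 0)
  integrable_right : ∀ t : ℝ,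
    MeasureTheory.IntegrableOn (fun x : ℝ => (1 + |x|) * ‖u x t - up‖) (Set.Ici 0)
  deriv_integrable : ∀ t : ℝ,
    MeasureTheory.Integrable (fun x : ℝ => deriv (fun y => u y t) x)

/-- `ν₋(x,t) = (1/2α) ∫_{-∞}^x (u₀² - |u(y,t)|²) dy`. -/
def nuMinus (α u₀ : ℝ) (u : ℝ → ℝ → ℂ) (x t : ℝ) : ℝ :=
  1 / (2 * α) * ∫ y in Set.Iic x, (u₀ ^ 2 - ‖u y t‖ ^ 2)

/-! ### Lax pair -/

def sigma3 : Matrix (Fin 2) (Fin 2) ℂ := !![1, 0; 0, -1]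

/-- The off-diagonal matrix with entries `a` and `a*`; `Q = offDiag u`, `Q_x = offDiag u_x`. -/
def offDiag (a : ℂ) : Matrix (Fin 2) (Fin 2) ℂ := !![0, a; conj a, 0]

/-- `X = -i α k² σ₃ + i k Q`. -/
def laxX (α u₀ : ℝ) (u : ℝ → ℝ → ℂ) (z : ℂ) (x t : ℝ) : Matrix (Fin 2) (Fin 2) ℂ :=
  (-(Complex.I * α * specK α u₀ z ^ 2)) • sigma3
    + (Complex.I * specK α u₀ z) • offDiag (u x t)

/-- `T = (-2iα²k⁴ + 4iα²k²) σ₃ + i k² |u|² σ₃ + 2iαk(k² - 2) Q - (i/α) k Q³ - k σ₃ Q_x`. -/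
def laxT (α u₀ : ℝ) (u : ℝ → ℝ → ℂ) (z : ℂ) (x t : ℝ) : Matrix (Fin 2) (Fin 2) ℂ :=
  (-(2 * Complex.I * (α : ℂ) ^ 2 * specK α u₀ z ^ 4)
      + 4 * Complex.I * (α : ℂ) ^ 2 * specK α u₀ z ^ 2) • sigma3
    + (Complex.I * specK α u₀ z ^ 2 * (‖u x t‖ : ℂ) ^ 2) • sigma3
    + (2 * Complex.I * α * specK α u₀ z * (specK α u₀ z ^ 2 - 2)) • offDiag (u x t)
    - (Complex.I / α * specK α u₀ z) • offDiag (u x t) ^ 3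
    - specK α u₀ z • (sigma3 * offDiag (deriv (fun y => u y t) x))

/-- The eigenvector matrix `Y_± = I + (1/z) σ₃ Q_±` for the boundary value `c = u_±`. -/
def eigY (c z : ℂ) : Matrix (Fin 2) (Fin 2) ℂ := 1 + z⁻¹ • (sigma3 * offDiag c)

/-! ### Jost solutions -/

/-- `φ` is the `j`-th column of the Jost solution normalized at the end `l` of the `x`-axis
(`atBot` or `atTop`), where `u → c`: it solves `φ_x = X φ`, `φ_t = T φ`, and it is
asymptotic to the `j`-th column of `Y e^{iθσ₃}`. -/
def IsJostColumn (α u₀ : ℝ) (u : ℝ → ℝ → ℂ) (l : Filter ℝ) (c : ℂ) (j : Fin 2) (z : ℂ)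
    (φ : ℝ → ℝ → Fin 2 → ℂ) : Prop :=
  (∀ x t : ℝ, HasDerivAt (fun y => φ y t) ((laxX α u₀ u z x t).mulVec (φ x t)) x) ∧
  (∀ x t : ℝ, HasDerivAt (fun s => φ x s) ((laxT α u₀ u z x t).mulVec (φ x t)) t) ∧
  ∀ t : ℝ, Filter.Tendsto
    (fun x => Complex.exp (-(Complex.I * theta α u₀ x t z * sigma3 j j)) • φ x t)
    l (nhds (fun i => eigY c z i j))

/-- The `j`-th column of the Jost solution `φ_-(x,t,z)` (used where it exists and is unique:
`j = 0` on `{Re z Im z ≥ 0}`, `j = 1` on `{Re z Im z ≤ 0}`, without `0, ± i u₀`). -/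
def jostMinus (α u₀ : ℝ) (um : ℂ) (u : ℝ → ℝ → ℂ) (j : Fin 2) (z : ℂ) : ℝ → ℝ → Fin 2 → ℂ :=
  Classical.epsilon (IsJostColumn α u₀ u Filter.atBot um j z)

/-- The `j`-th column of the Jost solution `φ_+(x,t,z)` (used where it exists and is unique:
`j = 0` on `{Re z Im z ≤ 0}`, `j = 1` on `{Re z Im z ≥ 0}`, without `0, ± i u₀`). -/
def jostPlus (α u₀ : ℝ) (up : ℂ) (u : ℝ → ℝ → ℂ) (j : Fin 2) (z : ℂ) : ℝ → ℝ → Fin 2 → ℂ :=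
  Classical.epsilon (IsJostColumn α u₀ u Filter.atTop up j z)

/-! ### Scattering data -/

/-- The Wronskian `Wr(a, b) = det (a, b)`. -/
def wronskian (a b : Fin 2 → ℂ) : ℂ := a 0 * b 1 - a 1 * b 0

/-- `γ(z) = 1 + u₀²/z² = det Y_±`. -/
def detY (u₀ : ℝ) (z : ℂ) : ℂ := 1 + (u₀ : ℂ) ^ 2 / z ^ 2

/-- `s₁₁ = Wr(φ_{+,1}, φ_{-,2}) / γ`; since `X` and `T` are trace-free, the Wronskian does not
depend on `(x,t)` and may be taken at `(0,0)`. -/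
def s11 (α u₀ : ℝ) (um up : ℂ) (u : ℝ → ℝ → ℂ) (z : ℂ) : ℂ :=
  wronskian (jostPlus α u₀ up u 0 z 0 0) (jostMinus α u₀ um u 1 z 0 0) / detY u₀ z

/-- `s₂₁ = Wr(φ_{-,1}, φ_{+,1}) / γ`, again evaluated at `(0,0)`. -/
def s21 (α u₀ : ℝ) (um up : ℂ) (u : ℝ → ℝ → ℂ) (z : ℂ) : ℂ :=
  wronskian (jostMinus α u₀ um u 0 z 0 0) (jostPlus α u₀ up u 0 z 0 0) / detY u₀ z

/-- The reflection coefficient `ρ = s₂₁ / s₁₁` on the contour. -/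
def reflCoeff (α u₀ : ℝ) (um up : ℂ) (u : ℝ → ℝ → ℂ) (z : ℂ) : ℂ :=
  s21 α u₀ um up u z / s11 α u₀ um up u z

/-- The reflection coefficient is defined and vanishes on the contour. -/
def IsReflectionless (α u₀ : ℝ) (um up : ℂ) (u : ℝ → ℝ → ℂ) : Prop :=
  ∀ z ∈ contour u₀, s11 α u₀ um up u z ≠ 0 ∧ reflCoeff α u₀ um up u z = 0

/-! ### Discrete spectrum and norming constants -/

/-- The index set of `ζ_1, …, ζ_{2N₁+N₂}`: two copies of `1, …, N₁`, followed by `1, …, N₂`. -/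
abbrev SpecIdx (N₁ N₂ : ℕ) : Type := (Fin N₁ ⊕ Fin N₁) ⊕ Fin N₂

/-- `ζ_n = z_n`, `ζ_{N₁+n} = -u₀²/z_n*` for `n ≤ N₁`, and `ζ_{2N₁+m} = w_m` for `m ≤ N₂`. -/
def zeta (u₀ : ℝ) {N₁ N₂ : ℕ} (zs : Fin N₁ → ℂ) (ws : Fin N₂ → ℂ) : SpecIdx N₁ N₂ → ℂ :=
  Sum.elim (Sum.elim zs (fun n => -((u₀ : ℂ) ^ 2 / conj (zs n)))) ws

/-- The zeros of `s₁₁` in `D⁺` are exactly the points `± ζ_n`, and they are simple. Here the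
`z_n` are distinct points of `D⁺` with `Im z_n > 0`, `|z_n| > u₀`, and the `w_m` are distinct
points of the arc `{u₀ e^{iφ} : π/2 < φ < π}`. (By symmetry the zeros of `s₂₂` in `D⁻` are
then the points `± ζ_n*`.) -/
structure HasSimpleDiscreteSpectrum (α u₀ : ℝ) (um up : ℂ) (u : ℝ → ℝ → ℂ) {N₁ N₂ : ℕ}
    (zs : Fin N₁ → ℂ) (ws : Fin N₂ → ℂ) : Prop where
  zs_mem : ∀ n, zs n ∈ Dplus ∧ 0 < (zs n).im ∧ u₀ < ‖zs n‖
  zs_injective : Function.Injective zs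
  ws_mem : ∀ m, ∃ φ : ℝ, Real.pi / 2 < φ ∧ φ < Real.pi ∧
    ws m = u₀ * Complex.exp (Complex.I * φ)
  ws_injective : Function.Injective ws
  zeros : ∀ z ∈ Dplus, s11 α u₀ um up u z = 0 ↔
    ∃ n : SpecIdx N₁ N₂, z = zeta u₀ zs ws n ∨ z = -zeta u₀ zs ws n
  simple : ∀ n : SpecIdx N₁ N₂, deriv (s11 α u₀ um up u) (zeta u₀ zs ws n) ≠ 0

/-- The constant `b` in `φ_{+,1}(x,t,ζ) = b φ_{-,2}(x,t,ζ)` at a zero `ζ` of `s₁₁`. -/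
def propConst (α u₀ : ℝ) (um up : ℂ) (u : ℝ → ℝ → ℂ) (ζ : ℂ) : ℂ :=
  Classical.epsilon fun b : ℂ =>
    ∀ x t : ℝ, jostPlus α u₀ up u 0 ζ x t = b • jostMinus α u₀ um u 1 ζ x t

/-- The norming constant `C = b / s₁₁'(ζ)` at a simple zero `ζ` of `s₁₁`. -/
def normingConst (α u₀ : ℝ) (um up : ℂ) (u : ℝ → ℝ → ℂ) (ζ : ℂ) : ℂ :=
  propConst α u₀ um up u ζ / deriv (s11 α u₀ um up u) ζ

/-! ### The matrices of the soliton formula -/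

section Soliton

variable {ι : Type} [Fintype ι] [DecidableEq ι]

/-- `c_j(x,t,z) = C_j / (z² - ζ_j²) · e^{-2iθ(x,t,ζ_j)}`. -/
def solC (α u₀ : ℝ) (ζ C : ι → ℂ) (x t : ℝ) (j : ι) (z : ℂ) : ℂ :=
  C j / (z ^ 2 - ζ j ^ 2) * Complex.exp (-(2 * Complex.I * theta α u₀ x t (ζ j)))

/-- `A_{nk} = 4 ∑_j ζ_j² c_j(ζ_n*) (c_k(ζ_j*))*`. -/
def solA (α u₀ : ℝ) (ζ C : ι → ℂ) (x t : ℝ) : Matrix ι ι ℂ :=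
  Matrix.of fun n k => ∑ j, 4 * ζ j ^ 2 * solC α u₀ ζ C x t j (conj (ζ n))
    * conj (solC α u₀ ζ C x t k (conj (ζ j)))

/-- `B_n = 1 + 2 u₋ ∑_j c_j(ζ_n*)`. -/
def solB (α u₀ : ℝ) (um : ℂ) (ζ C : ι → ℂ) (x t : ℝ) (n : ι) : ℂ :=
  1 + 2 * um * ∑ j, solC α u₀ ζ C x t j (conj (ζ n))

/-- `Y_n = C_n* e^{2iθ(x,t,ζ_n*)}`. -/
def solY (α u₀ : ℝ) (ζ C : ι → ℂ) (x t : ℝ) (n : ι) : ℂ :=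
  conj (C n) * Complex.exp (2 * Complex.I * theta α u₀ x t (conj (ζ n)))

/-- `M = I + A`. -/
def solM (α u₀ : ℝ) (ζ C : ι → ℂ) (x t : ℝ) : Matrix ι ι ℂ := 1 + solA α u₀ ζ C x t

/-- `M^aug`, with the block rows `(0, Y)` and `(B, M)`. -/
def solMaug (α u₀ : ℝ) (um : ℂ) (ζ C : ι → ℂ) (x t : ℝ) : Matrix (Unit ⊕ ι) (Unit ⊕ ι) ℂ :=
  Matrix.fromBlocks 0 (Matrix.of fun _ n => solY α u₀ ζ C x t n)
    (Matrix.of fun n _ => solB α u₀ um ζ C x t n) (solM α u₀ ζ C x t)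

end Soliton

end MNLS

end

open scoped ComplexConjugate


namespace MNLS

open Set Filter Topology MeasureTheory

/-! ### Complex analysis -/

section ComplexAnalysis

open Complex
open scoped Interval

/-! The problem is moved to the variable `s = z²`. After removal of `e^{iθ}` the first Jost columns
have the form `(a, e/z)`, where `a` and `e` depend on `s` only. The left pair lives on the closed
upper half of the `s`-plane without the origin, the right pair `(a', e')` on the closed lower half,
and the second columns come from the first by `s ↦ conj s`. The set `D⁺` becomes the open lower
half-plane, and `± ζ_n` merge into the single point `ζ_n²`.

Vanishing reflection means that on the real `s`-axis the right pair is `s₁₁` times the left pair. So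
the function equal to `a` above the axis and to `a' / s₁₁` below it continues analytically across
the axis, and likewise for `e`; its only poles are at most simple and sit at the `ζ_n²`. It is
bounded near `∞`, near `0` and near the branch point `-u₀²`, so Liouville's theorem gives its
partial fractions (`exists_partial_fractions`, `JumpProblem.partial_fractions`). At a zero of `s₁₁`
the columns are proportional, which expresses each residue by the conjugate of the left pair at
`conj (ζ_n²)` (`residue_conditions`). Evaluation at these points closes the system, and elimination
of `e` leaves `M X = B` (`solM_mulVec_eq_solB`).

The constant terms carry the potential. Along the imaginary axis `a → e^{iν₋}` and `e → -conj u ·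
e^{iν₋}`. The symmetry `s ↦ u₀⁴ / conj s` exchanges `0` and `∞` and yields a second expression for
the constant term of `e`, in terms of `u₋` and the residues. Equating the two gives `u`, and a Schur
complement turns the sum into the quotient of determinants (`det_solMaug_div`).

The matrix `M` is invertible by positivity: a kernel vector produces rational functions `f`, `G`
with `|f|² + r |G|² = 0` for `r > 0` (`vanishing_lemma`).

The analytic input is the construction of the pairs. A Volterra series with tailored weights gives
existence, continuity up to the axis and holomorphy (`volSum_spec`); an approximate diagonalization
gives the behaviour for large `s`. Zero curvature extends a solution at time `0` to a common
solution of both Lax equations (`exists_flat_section`), and a Wronskian argument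
(`eq_of_planar_ode_of_tendsto`) identifies the chosen Jost columns with the constructed ones at
every time. At the branch point a boundary limit excludes a zero of `s₁₁` (`exists_bound_inv_near`).
-/

theorem rect_integral_eq_zero_of_continuousOn {f : ℂ → ℂ} {z w : ℂ}
    (hc : ContinuousOn f ([[z.re, w.re]] ×ℂ [[z.im, w.im]]))
    (hd : ∀ v ∈ [[z.re, w.re]] ×ℂ [[z.im, w.im]], v.im ≠ 0 → DifferentiableAt ℂ f v)
    (h0 : (0 : ℝ) ∉ Ioo (min z.im w.im) (max z.im w.im)) :
    (∫ x : ℝ in z.re..w.re, f (x + z.im * I)) - (∫ x : ℝ in z.re..w.re, f (x + w.im * I)) +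
      I • (∫ y : ℝ in z.im..w.im, f (w.re + y * I)) -
      I • (∫ y : ℝ in z.im..w.im, f (z.re + y * I)) = 0 := by
  refine integral_boundary_rect_eq_zero_of_continuousOn_of_differentiableOn f z w hc ?_
  intro v hv
  refine (hd v ⟨?_, ?_⟩ ?_).differentiableWithinAt
  · exact Ioo_subset_Icc_self hv.1
  · exact Ioo_subset_Icc_self hv.2
  · intro h
    exact h0 (h ▸ hv.2)

/-- A continuous function which is holomorphic off the real line is holomorphic. -/
theorem differentiableOn_of_continuousOn_of_off_real {f : ℂ → ℂ} {U : Set ℂ} (hU : IsOpen U)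
    (hc : ContinuousOn f U) (hd : ∀ z ∈ U, z.im ≠ 0 → DifferentiableAt ℂ f z) :
    DifferentiableOn ℂ f U := by
  -- Morera's theorem. A rectangle crossed by the real axis is cut along it: the integrals over the
  -- cut cancel, and each half meets the axis only in its boundary, where continuity suffices.
  refine (isConservativeOn_and_continuousOn_iff_isDifferentiableOn hU).1 ⟨?_, hc⟩
  intro z w hzw
  rw [← add_eq_zero_iff_eq_neg, wedgeIntegral_add_wedgeIntegral_eq]
  have hzw' : [[z.re, w.re]] ×ℂ [[z.im, w.im]] ⊆ U := hzw
  by_cases h0 : (0 : ℝ) ∈ Ioo (min z.im w.im) (max z.im w.im)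
  swap
  · exact rect_integral_eq_zero_of_continuousOn (hc.mono hzw') (fun v hv => hd v (hzw' hv)) h0
  have h0' : (0 : ℝ) ∈ [[z.im, w.im]] := Ioo_subset_Icc_self h0
  have s1 : [[z.im, 0]] ⊆ [[z.im, w.im]] := uIcc_subset_uIcc_left h0'
  have s2 : [[0, w.im]] ⊆ [[z.im, w.im]] := uIcc_subset_uIcc_right h0'
  have r1 : [[z.re, w.re]] ×ℂ [[z.im, 0]] ⊆ U := fun v hv => hzw' ⟨hv.1, s1 hv.2⟩
  have r2 : [[z.re, w.re]] ×ℂ [[0, w.im]] ⊆ U := fun v hv => hzw' ⟨hv.1, s2 hv.2⟩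
  have e1 := rect_integral_eq_zero_of_continuousOn (f := f) (z := z) (w := (w.re : ℂ))
    (by simpa using hc.mono r1) (fun v hv => hd v (r1 (by simpa using hv)))
    (by simp only [ofReal_im, mem_Ioo, not_and, not_lt]; intro h; 
        rcases le_total z.im 0 with h' | h' <;> simp [h'] at h ⊢)
  have e2 := rect_integral_eq_zero_of_continuousOn (f := f) (z := (z.re : ℂ)) (w := w)
    (by simpa using hc.mono r2) (fun v hv => hd v (r2 (by simpa using hv)))
    (by simp only [ofReal_im, mem_Ioo, not_and, not_lt]; intro h; 
        rcases le_total w.im 0 with h' | h' <;> simp [h'] at h ⊢)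
  have iv : ∀ x ∈ [[z.re, w.re]], ∀ a b : ℝ, [[a, b]] ⊆ [[z.im, w.im]] →
      IntervalIntegrable (fun y : ℝ => f (x + y * I)) volume a b := by
    intro x hx a b hab
    apply ContinuousOn.intervalIntegrable
    refine hc.comp (by fun_prop) fun y hy => hzw' ?_
    exact ⟨by simpa using hx, by simpa using hab hy⟩
  have a1 := intervalIntegral.integral_add_adjacent_intervals
    (iv w.re right_mem_uIcc _ _ s1) (iv w.re right_mem_uIcc _ _ s2)
  have a2 := intervalIntegral.integral_add_adjacent_intervals
    (iv z.re left_mem_uIcc _ _ s1) (iv z.re left_mem_uIcc _ _ s2)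
  rw [← a1, ← a2]
  simp only [ofReal_re, ofReal_im, ofReal_zero, zero_mul, add_zero, smul_eq_mul] at e1 e2 ⊢
  linear_combination e1 + e2

/-- Liouville's theorem with finitely many removable singularities. -/
theorem exists_eq_const_of_differentiableAt_off_finite {S : Set ℂ} (hS : S.Finite) {h : ℂ → ℂ}
    (hd : ∀ z ∉ S, DifferentiableAt ℂ h z)
    (hb : ∀ z ∈ S, ∃ C : ℝ, ∀ᶠ w in 𝓝[≠] z, ‖h w‖ ≤ C)
    (hinf : ∃ C R : ℝ, ∀ w : ℂ, R ≤ ‖w‖ → ‖h w‖ ≤ C) :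
    ∃ c, ∀ z ∉ S, h z = c := by
  classical
  -- Each singularity is filled in with the limit of `h`, which exists by Riemann's theorem on
  -- removable singularities.
  set H : ℂ → ℂ := fun z => if z ∈ S then limUnder (𝓝[≠] z) h else h z with hH
  have hnS : ∀ z, ∀ᶠ w in 𝓝[≠] z, w ∉ S := by
    intro z
    have : (S \ {z})ᶜ ∈ 𝓝 z :=
      (hS.subset sdiff_subset).isClosed.isOpen_compl.mem_nhds (by simp)
    filter_upwards [nhdsWithin_le_nhds this, self_mem_nhdsWithin] with w hw hwz hwS
    exact hw ⟨hwS, hwz⟩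
  have hHd : Differentiable ℂ H := by
    intro z
    by_cases hz : z ∈ S
    · obtain ⟨C, hC⟩ := hb z hz
      obtain ⟨s, hs, hs'⟩ : ∃ s ∈ 𝓝 z, ∀ w ∈ s, w ≠ z → ‖h w‖ ≤ C ∧ w ∉ S := by
        have := hC.and (hnS z)
        rw [eventually_nhdsWithin_iff] at this
        exact ⟨_, this, fun w hw hwz => hw hwz⟩
      have key := differentiableOn_update_limUnder_of_bddAbove (f := h) hs
        (fun w hw => (hd w (hs' w hw.1 hw.2).2).differentiableWithinAt)
        ⟨C, by rintro _ ⟨w, hw, rfl⟩; exact (hs' w hw.1 hw.2).1⟩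
      refine (key.differentiableAt hs).congr_of_eventuallyEq ?_
      filter_upwards [hs] with w hw
      by_cases hwz : w = z
      · subst hwz; simp [hH, hz]
      · simp [hH, hwz, (hs' w hw hwz).2]
    · refine (hd z hz).congr_of_eventuallyEq ?_
      filter_upwards [hS.isClosed.isOpen_compl.mem_nhds hz] with w hw
      simp only [mem_compl_iff] at hw
      simp [hH, hw]
  obtain ⟨C, R, hC⟩ := hinf
  obtain ⟨R', hR'⟩ := hS.isBounded.exists_norm_le
  have hbd : Bornology.IsBounded (range H) := by
    obtain ⟨C', hC'⟩ := (isCompact_closedBall (0 : ℂ) (max R (R' + 1))).exists_bound_of_continuousOn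
      hHd.continuous.continuousOn
    rw [isBounded_iff_forall_norm_le]
    refine ⟨max C C', ?_⟩
    rintro _ ⟨z, rfl⟩
    by_cases hz : ‖z‖ ≤ max R (R' + 1)
    · exact (hC' z (by simpa using hz)).trans (le_max_right _ _)
    · push Not at hz
      have h1 : z ∉ S := fun h => by
        have := hR' z h; have := le_max_right R (R' + 1); linarith
      have : H z = h z := by simp [hH, h1]
      rw [this]
      exact (hC z ((le_max_left _ _).trans hz.le)).trans (le_max_left _ _)
  refine ⟨H 0, fun z hz => ?_⟩
  have := hHd.apply_eq_apply_of_bounded hbd z 0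
  simpa [hH, hz] using this

/-- At a simple zero of the denominator, a quotient minus its principal part is bounded. -/
theorem div_sub_principal_part_bounded {g h : ℂ → ℂ} {p : ℂ} (hg : AnalyticAt ℂ g p)
    (hh : AnalyticAt ℂ h p) (h0 : h p = 0) (h1 : deriv h p ≠ 0) :
    ∃ C : ℝ, ∀ᶠ w in 𝓝[≠] p, ‖g w / h w - g p / deriv h p / (w - p)‖ ≤ C := by
  obtain ⟨U, hU, hhU⟩ := hh.exists_mem_nhds_analyticOnNhd
  have hD : ∀ᶠ w in 𝓝 p, DifferentiableAt ℂ (dslope h p) w := by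
    have : DifferentiableOn ℂ (dslope h p) U :=
      (differentiableOn_dslope hU).2 hhU.differentiableOn
    filter_upwards [eventually_mem_nhds_iff.2 hU] with w hw using this.differentiableAt hw
  have hDc : ContinuousAt (dslope h p) p := hD.self_of_nhds.continuousAt
  have hDp : dslope h p p ≠ 0 := by simpa using h1
  -- Since `h w = (w - p) * dslope h p w`, the quotient minus its principal part is the `dslope` at
  -- `p` of `g / dslope h p`, and this is continuous at `p`.
  have hGd : DifferentiableAt ℂ (fun w => g w / dslope h p w) p :=
    hg.differentiableAt.div hD.self_of_nhds hDp
  have hc : ContinuousAt (dslope (fun w => g w / dslope h p w) p) p :=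
    continuousAt_dslope_same.2 hGd
  obtain ⟨C, hC⟩ : ∃ C : ℝ, ∀ᶠ w in 𝓝 p, ‖dslope (fun w => g w / dslope h p w) p w‖ ≤ C :=
    ⟨_, (hc.norm.eventually_le_const (lt_add_one _))⟩
  refine ⟨C, ?_⟩
  filter_upwards [nhdsWithin_le_nhds hC, nhdsWithin_le_nhds (hDc.eventually_ne hDp),
    self_mem_nhdsWithin] with w hw hDw hwp
  have hwp' : w - p ≠ 0 := sub_ne_zero.2 hwp
  rw [dslope_of_ne _ hwp, slope_def_field] at hw
  convert hw using 2
  have hs : h w = (w - p) * dslope h p w := by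
    rw [dslope_of_ne _ hwp, slope_def_field, h0]; field_simp; ring
  rw [hs, dslope_same]
  field_simp

/-- Holomorphic dependence of an integral on a parameter. -/
theorem differentiableOn_integral_of_locally_dominated {β : Type*} [MeasurableSpace β]
    {μ : Measure β} {F : ℂ → β → ℂ} {U : Set ℂ} (hU : IsOpen U)
    (hm : ∀ s ∈ U, AEStronglyMeasurable (F s) μ)
    (hd : ∀ b, DifferentiableOn ℂ (fun s => F s b) U)
    (bound : β → ℝ) (hbi : Integrable bound μ)
    (hb : ∀ᵐ b ∂μ, ∀ w ∈ U, ‖F w b‖ ≤ bound b) :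
    DifferentiableOn ℂ (fun s => ∫ b, F s b ∂μ) U := by
  intro s hs
  obtain ⟨r, hr, hrU⟩ := Metric.isOpen_iff.1 hU s hs
  have hball : ∀ w ∈ Metric.ball s (r / 2), Metric.closedBall w (r / 4) ⊆ U := by
    intro w hw v hv
    apply hrU
    rw [Metric.mem_ball] at hw ⊢
    rw [Metric.mem_closedBall] at hv
    have := dist_triangle v w s
    linarith
  -- The bound `bound b / (r / 4)` on the derivative is Cauchy's estimate on circles of radius `r /
  -- 4`, which stay in `U` when centred in the ball of radius `r / 2`.
  have key := hasDerivAt_integral_of_dominated_loc_of_deriv_le (μ := μ) (F := F)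
    (F' := fun w b => deriv (fun s => F s b) w) (x₀ := s) (bound := fun b => bound b / (r / 4))
    (Metric.ball_mem_nhds s (half_pos hr))
    (by filter_upwards [hU.mem_nhds hs] with w hw using hm w hw)
    (hbi.mono' (hm s hs) (by filter_upwards [hb] with b hb using hb s hs))
    ?_ ?_ (hbi.div_const _) ?_
  · exact key.2.differentiableAt.differentiableWithinAt
  -- Measurability of the derivative in `b`: it is a limit of difference quotients along a sequence
  -- in `U`.
  · have hlim : Tendsto (fun n : ℕ => s + ((r / 2 / (n + 1) : ℝ) : ℂ)) atTop (𝓝[≠] s) := by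
      refine tendsto_nhdsWithin_iff.2 ⟨?_, ?_⟩
      · have : Tendsto (fun n : ℕ => r / 2 / ((n : ℝ) + 1)) atTop (𝓝 0) :=
          tendsto_const_div_atTop_nhds_zero_nat (r / 2) |>.comp (tendsto_add_atTop_nat 1)
            |>.congr (by intro n; simp)
        have := (Complex.continuous_ofReal.tendsto 0).comp this
        simpa using this.const_add s
      · refine Eventually.of_forall fun n => ?_
        have : (r / 2 / ((n : ℝ) + 1)) ≠ 0 := by positivity
        exact fun h => this (by exact_mod_cast (add_eq_left.1 h))
    have hmem : ∀ n : ℕ, s + ((r / 2 / (n + 1) : ℝ) : ℂ) ∈ U := by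
      intro n
      apply hrU
      rw [Metric.mem_ball, dist_eq_norm]
      have : (1 : ℝ) ≤ n + 1 := by simp
      rw [add_sub_cancel_left, Complex.norm_real, Real.norm_of_nonneg (by positivity)]
      calc r / 2 / (n + 1) ≤ r / 2 := div_le_self (by positivity) this
        _ < r := by linarith
    refine aestronglyMeasurable_of_tendsto_ae atTop
      (f := fun (n : ℕ) b => slope (fun w => F w b) s (s + ((r / 2 / (n + 1) : ℝ) : ℂ))) ?_ ?_
    · intro n
      simp only [slope, vsub_eq_sub, smul_eq_mul]
      exact ((hm _ (hmem n)).sub (hm s hs)).const_mul _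
    · refine Eventually.of_forall fun b => ?_
      exact (hasDerivAt_iff_tendsto_slope.1
        ((hd b).differentiableAt (hU.mem_nhds hs)).hasDerivAt).comp hlim
  · filter_upwards [hb] with b hb w hw
    refine norm_deriv_le_of_forall_mem_sphere_norm_le (by positivity) ?_ ?_
    · apply DifferentiableOn.diffContOnCl
      exact (hd b).mono (Metric.closure_ball_subset_closedBall.trans (hball w hw))
    · intro v hv
      exact hb v (hball w hw (Metric.sphere_subset_closedBall hv))
  · filter_upwards with b w hw
    exact ((hd b).differentiableAt (hU.mem_nhds
      (hball w hw (Metric.mem_closedBall_self (by positivity))))).hasDerivAt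

end ComplexAnalysis

/-! ### Linear ordinary differential equations -/

section LinearODE

variable {E : Type*} [NormedAddCommGroup E] [NormedSpace ℝ E]

theorem norm_le_of_norm_deriv_le_of_nonneg {f f' : ℝ → E} {K ε R : ℝ} (hK : 1 ≤ K) (hε : 0 ≤ ε)
    (hf : ∀ x, HasDerivAt f (f' x) x) (hb : ∀ x, |x| ≤ R → ‖f' x‖ ≤ K * ‖f x‖ + ε) {x : ℝ}
    (hx : 0 ≤ x) (hxR : x ≤ R) : ‖f x‖ ≤ (‖f 0‖ + ε) * Real.exp (K * x) := by
  have := norm_le_gronwallBound_of_norm_deriv_right_le (f := f) (f' := f') (δ := ‖f 0‖) (K := K)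
    (ε := ε) (a := 0) (b := x) (fun y _ => (hf y).continuousAt.continuousWithinAt)
    (fun y _ => (hf y).hasDerivWithinAt) le_rfl
    (fun y hy => hb y (by rw [abs_of_nonneg hy.1]; exact hy.2.le.trans hxR)) x ⟨hx, le_rfl⟩
  refine this.trans ?_
  rw [gronwallBound_of_K_ne_0 (by linarith)]
  have h1 : 1 ≤ Real.exp (K * (x - 0)) := Real.one_le_exp (by rw [sub_zero]; positivity)
  have h2 : ε / K ≤ ε := div_le_self hε hK
  have h3 : ε / K * (Real.exp (K * (x - 0)) - 1) ≤ ε * Real.exp (K * (x - 0)) := by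
    have h4 : 0 ≤ ε / K := by positivity
    nlinarith
  rw [sub_zero] at *
  linarith

/-- A two-sided Grönwall estimate. -/
theorem norm_le_of_norm_deriv_le {f f' : ℝ → E} {K ε R : ℝ} (hK : 1 ≤ K) (hε : 0 ≤ ε)
    (hf : ∀ x, HasDerivAt f (f' x) x) (hb : ∀ x, |x| ≤ R → ‖f' x‖ ≤ K * ‖f x‖ + ε) {x : ℝ}
    (hx : |x| ≤ R) : ‖f x‖ ≤ (‖f 0‖ + ε) * Real.exp (K * |x|) := by
  rcases le_total 0 x with h | h
  · rw [abs_of_nonneg h] at hx ⊢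
    exact norm_le_of_norm_deriv_le_of_nonneg hK hε hf hb h hx
  · rw [abs_of_nonpos h] at hx ⊢
    have := norm_le_of_norm_deriv_le_of_nonneg (f := fun y => f (-y)) (f' := fun y => -f' (-y))
      (R := R) hK hε (fun y => by simpa [Function.comp_def] using (hf (-y)).scomp y (hasDerivAt_neg y))
      (fun y hy => by simpa using hb (-y) (by simpa using hy)) (x := -x) (by linarith) hx
    simpa using this

theorem eq_zero_of_linear_ode {A : ℝ → E →L[ℝ] E} (hA : Continuous A) {f : ℝ → E}
    (hf : ∀ x, HasDerivAt f (A x (f x)) x) {x₀ : ℝ} (h0 : f x₀ = 0) (x : ℝ) : f x = 0 := by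
  obtain ⟨K, hK⟩ := (isCompact_Icc (a := x₀ - |x - x₀|) (b := x₀ + |x - x₀|)).exists_bound_of_continuousOn
    hA.continuousOn
  have := norm_le_of_norm_deriv_le (f := fun y => f (x₀ + y)) (K := max 1 K) (ε := 0)
    (R := |x - x₀|) (le_max_left _ _) le_rfl
    (fun y => by simpa [Function.comp_def] using (hf (x₀ + y)).scomp y ((hasDerivAt_id y).const_add x₀))
    (fun y hy => by
      rw [add_zero]
      refine ((A _).le_opNorm _).trans ?_
      gcongr
      refine (hK _ ?_).trans (le_max_right _ _)
      rw [abs_le] at hy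
      constructor <;> linarith) (x := x - x₀) le_rfl
  simpa [h0] using this

/-- Global existence for linear equations. -/
theorem exists_linear_ode_solution [CompleteSpace E] {A : ℝ → E →L[ℝ] E} (hA : Continuous A)
    (v : E) : ∃ f : ℝ → E, f 0 = v ∧ ∀ x, HasDerivAt f (A x (f x)) x := by
  -- Picard iteration as a series: `y n` is the `n`-th term, not the `n`-th partial sum.
  let y : ℕ → ℝ → E := fun n => Nat.rec (fun _ => v) (fun _ g x => ∫ τ in (0 : ℝ)..x, A τ (g τ)) n
  have y0 : ∀ x, y 0 x = v := fun _ => rfl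
  have ys : ∀ n x, y (n + 1) x = ∫ τ in (0 : ℝ)..x, A τ (y n τ) := fun _ _ => rfl
  have hyc : ∀ n, Continuous (y n) := by
    intro n
    induction n with
    | zero => exact continuous_const
    | succ n ih =>
      exact intervalIntegral.continuous_primitive
        (fun a b => (hA.clm_apply ih).intervalIntegrable a b) 0
  have hyd : ∀ n x, HasDerivAt (y (n + 1)) (A x (y n x)) x := fun n x =>
    intervalIntegral.integral_hasDerivAt_right ((hA.clm_apply (hyc n)).intervalIntegrable _ _)
      ((hA.clm_apply (hyc n)).stronglyMeasurableAtFilter _ _) (hA.clm_apply (hyc n)).continuousAt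
  have hbound : ∀ T M : ℝ, 0 ≤ M → (∀ τ, |τ| ≤ T → ‖A τ‖ ≤ M) → ∀ n x, |x| ≤ T →
      ‖y n x‖ ≤ ‖v‖ * ((M * |x|) ^ n / n.factorial) := by
    intro T M hM hAM n
    induction n with
    | zero => intro x _; simp [y0]
    | succ n ih =>
      intro x hx
      -- Rescaling to `[0, 1]` treats both signs of `x` at once.
      have e : y (n + 1) x = x • ∫ σ in (0 : ℝ)..1, A (x * σ) (y n (x * σ)) := by
        rw [ys]
        have := intervalIntegral.smul_integral_comp_mul_left (a := 0) (b := 1)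
          (fun τ => A τ (y n τ)) x
        rw [this]; simp
      rw [e, norm_smul, Real.norm_eq_abs]
      have : ‖∫ σ in (0 : ℝ)..1, A (x * σ) (y n (x * σ))‖ ≤
          ∫ σ in (0 : ℝ)..1, M * (‖v‖ * ((M * |x|) ^ n / n.factorial)) * σ ^ n := by
        refine intervalIntegral.norm_integral_le_of_norm_le zero_le_one ?_ ?_
        · refine Eventually.of_forall fun σ hσ => ?_
          have hs : |x * σ| = |x| * σ := by rw [abs_mul, abs_of_nonneg hσ.1.le]
          have hxs : |x * σ| ≤ T := by
            rw [hs]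
            exact (mul_le_of_le_one_right (abs_nonneg x) hσ.2).trans hx
          refine ((A _).le_opNorm _).trans ?_
          calc ‖A (x * σ)‖ * ‖y n (x * σ)‖
              ≤ M * (‖v‖ * ((M * |x * σ|) ^ n / n.factorial)) :=
                mul_le_mul (hAM _ hxs) (ih _ hxs) (norm_nonneg _) hM
            _ = _ := by rw [hs]; ring
        · exact Continuous.intervalIntegrable (by fun_prop) _ _
      calc |x| * ‖∫ σ in (0 : ℝ)..1, A (x * σ) (y n (x * σ))‖
          ≤ |x| * ∫ σ in (0 : ℝ)..1, M * (‖v‖ * ((M * |x|) ^ n / n.factorial)) * σ ^ n := by gcongr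
        _ = ‖v‖ * ((M * |x|) ^ (n + 1) / (n + 1).factorial) := by
          rw [intervalIntegral.integral_const_mul, integral_pow, Nat.factorial_succ]
          push_cast
          have : (n : ℝ) + 1 ≠ 0 := by positivity
          field_simp
          simp only [one_pow, zero_pow (Nat.succ_ne_zero n)]
          ring
  refine ⟨fun x => ∑' n, y n x, ?_, fun x => ?_⟩
  · show ∑' n, y n 0 = v
    rw [tsum_eq_single 0 fun n hn => ?_, y0]
    obtain ⟨m, rfl⟩ := Nat.exists_eq_succ_of_ne_zero hn
    simp [ys]
  · set T := |x| + 1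
    have hT : 0 ≤ T := by positivity
    obtain ⟨M, hM⟩ := (isCompact_Icc (a := -T) (b := T)).exists_bound_of_continuousOn hA.continuousOn
    have hM' : ∀ τ, |τ| ≤ T → ‖A τ‖ ≤ max M 0 := fun τ hτ =>
      (hM τ (abs_le.1 hτ)).trans (le_max_left _ _)
    have hb := hbound T (max M 0) (le_max_right _ _) hM'
    have hb' : ∀ n x, |x| ≤ T → ‖y n x‖ ≤ ‖v‖ * ((max M 0 * T) ^ n / n.factorial) := by
      intro n x hx
      refine (hb n x hx).trans ?_
      gcongr
    have hsum : Summable fun n : ℕ => ‖v‖ * ((max M 0 * T) ^ n / n.factorial) :=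
      (Real.summable_pow_div_factorial _).mul_left _
    have hxT : |x| ≤ T := by simp [T]
    have hsx : ∀ τ, |τ| ≤ T → Summable fun n => y n τ := fun τ hτ =>
      Summable.of_norm_bounded hsum fun n => hb' n τ hτ
    have hmem : x ∈ Ioo (-T) T := abs_lt.1 (by simp [T])
    have key := hasDerivAt_tsum_of_isPreconnected (g := fun n => y (n + 1))
      (g' := fun n x => A x (y n x)) (u := fun n => max M 0 * (‖v‖ * ((max M 0 * T) ^ n / n.factorial)))
      (hsum.mul_left _) (t := Ioo (-T) T) isOpen_Ioo isPreconnected_Ioo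
      (fun n z _ => hyd n z)
      (fun n z hz => ((A z).le_opNorm _).trans (mul_le_mul (hM' z (abs_lt.2 hz).le)
        (hb' n z (abs_lt.2 hz).le) (norm_nonneg _) (le_max_right _ _)))
      hmem ((summable_nat_add_iff 1).2 (hsx x hxT)) hmem
    have e1 : A x (∑' n, y n x) = ∑' n, A x (y n x) := (A x).map_tsum (hsx x hxT)
    rw [e1]
    have e2 : (fun z => ∑' n, y n z) =ᶠ[𝓝 x] fun z => v + ∑' n, y (n + 1) z := by
      filter_upwards [isOpen_Ioo.mem_nhds hmem] with z hz
      rw [(hsx z (abs_lt.2 hz).le).tsum_eq_zero_add, y0]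
    exact (key.const_add v).congr_of_eventuallyEq e2

end LinearODE

end MNLS


namespace MNLS

/-! ### The linear system of the soliton formula -/

theorem solC_eq {ι : Type} (α u₀ : ℝ) (ζ C : ι → ℂ) (x t : ℝ) (j : ι) (z : ℂ) :
    solC α u₀ ζ C x t j z =
      C j * Complex.exp (-(2 * Complex.I * theta α u₀ x t (ζ j))) / (z ^ 2 - ζ j ^ 2) := by
  rw [solC]; ring


section LinearSystem

variable {ι : Type} [Fintype ι] [DecidableEq ι]

/-- Simple fractions with distinct poles are linearly independent: after clearing denominators the
sum is a polynomial with infinitely many roots, hence zero, and its value at `s j` isolates `p j`.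
-/
theorem eq_zero_of_sum_div_sub_eq_zero {s p : ι → ℂ} (hs : Function.Injective s)
    (him : ∀ j, (s j).im ≠ 0) (h : ∀ r : ℝ, 0 < r → ∑ j, p j / ((r : ℂ) - s j) = 0) (j : ι) :
    p j = 0 := by
  classical
  let P : Polynomial ℂ := ∑ j, Polynomial.C (p j) *
    ∏ i ∈ Finset.univ.erase j, (Polynomial.X - Polynomial.C (s i))
  have hr : ∀ (r : ℝ) i, (r : ℂ) - s i ≠ 0 := by
    intro r i h
    apply him i
    have := congrArg Complex.im h
    simpa using this
  have hroot : ∀ r : ℝ, 0 < r → P.IsRoot (r : ℂ) := by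
    intro r hr0
    have e : P.eval (r : ℂ) = (∑ j, p j / ((r : ℂ) - s j)) * ∏ i, ((r : ℂ) - s i) := by
      simp only [P, Polynomial.eval_finsetSum, Polynomial.eval_mul, Polynomial.eval_C,
        Polynomial.eval_prod, Polynomial.eval_sub, Polynomial.eval_X, Finset.sum_mul]
      refine Finset.sum_congr rfl fun j _ => ?_
      rw [← Finset.mul_prod_erase _ _ (Finset.mem_univ j)]
      field_simp [hr r j]
    rw [Polynomial.IsRoot, e, h r hr0, zero_mul]
  have hP : P = 0 := by
    apply Polynomial.eq_zero_of_infinite_isRoot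
    refine Set.Infinite.mono (s := (fun r : ℝ => (r : ℂ)) '' Set.Ioi 0) ?_ ?_
    · rintro _ ⟨r, hr0, rfl⟩
      exact hroot r hr0
    · exact (Set.Ioi_infinite 0).image Complex.ofReal_injective.injOn
  have e : P.eval (s j) = p j * ∏ i ∈ Finset.univ.erase j, (s j - s i) := by
    simp only [P, Polynomial.eval_finsetSum, Polynomial.eval_mul, Polynomial.eval_C,
      Polynomial.eval_prod, Polynomial.eval_sub, Polynomial.eval_X]
    refine Finset.sum_eq_single j (fun b _ hb => ?_) (by simp)
    rw [Finset.prod_eq_zero (i := j) (by simp [Ne.symm hb]) (sub_self _), mul_zero]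
  rw [hP, Polynomial.eval_zero] at e
  refine (mul_eq_zero.1 e.symm).resolve_right (Finset.prod_ne_zero_iff.2 fun i hi => ?_)
  exact sub_ne_zero.2 fun h => (Finset.ne_of_mem_erase hi) (hs h).symm

/-- The vanishing lemma behind the invertibility of `I + A`. -/
theorem vanishing_lemma {s z d X g : ι → ℂ} (hs : Function.Injective s)
    (him : ∀ j, (s j).im < 0) (hz : ∀ j, z j ^ 2 = s j)
    (hg : ∀ j, g j = -∑ k, 2 * z j * conj (d k) * X k / (s j - conj (s k)))
    (hX : ∀ n, X n = ∑ j, 2 * z j * d j * g j / (conj (s n) - s j)) : X = 0 := by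
  have hsub : ∀ j k, s j - conj (s k) ≠ 0 := by
    intro j k h
    have := congrArg Complex.im h
    simp at this
    linarith [him j, him k]
  have hr1 : ∀ (r : ℝ) i, (r : ℂ) - s i ≠ 0 := by
    intro r i h
    have := congrArg Complex.im h
    simp at this
    linarith [him i]
  have hr2 : ∀ (r : ℝ) i, (r : ℂ) - conj (s i) ≠ 0 := by
    intro r i h
    have := congrArg Complex.im h
    simp at this
    linarith [him i]
  -- `p` and `q` are the residues of rational functions `f` and `G` with poles at the `s j`. With
  -- `f*(s) = conj (f (conj s))`, the system says that `f f* + s G G*` has residue zero at each `s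
  -- j` (`hZ`) and, by conjugation, at each `conj (s k)` (`hZ'`).
  set p : ι → ℂ := fun j => 2 * z j * d j * g j with hp
  set q : ι → ℂ := fun j => 2 * d j * conj (X j) with hq
  have hZ : ∀ j, p j * ∑ k, conj (p k) / (s j - conj (s k))
      + q j * s j * ∑ k, conj (q k) / (s j - conj (s k)) = 0 := by
    intro j
    have h1 : ∑ k, conj (p k) / (s j - conj (s k)) = conj (X j) := by
      rw [hX j, map_sum]
      simp [hp]
    have h2 : z j * ∑ k, conj (q k) / (s j - conj (s k)) = -g j := by
      rw [hg j, neg_neg, Finset.mul_sum]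
      refine Finset.sum_congr rfl fun k _ => ?_
      simp only [hq, map_mul, Complex.conj_conj, map_ofNat]
      ring
    have : q j * s j * ∑ k, conj (q k) / (s j - conj (s k)) =
        q j * z j * (z j * ∑ k, conj (q k) / (s j - conj (s k))) := by rw [← hz j]; ring
    rw [h1, this, h2]
    simp only [hp, hq]
    ring
  have hZ' : ∀ k, conj (p k) * ∑ j, p j / (conj (s k) - s j)
      + conj (q k) * conj (s k) * ∑ j, q j / (conj (s k) - s j) = 0 := by
    intro k
    have := congrArg conj (hZ k)
    simpa using this
  have hf : ∀ r : ℝ, 0 < r → ∑ j, p j / ((r : ℂ) - s j) = 0 := by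
    intro r hr0
    set f := ∑ j, p j / ((r : ℂ) - s j) with hf
    set G := ∑ j, q j / ((r : ℂ) - s j) with hG
    have cf : conj f = ∑ k, conj (p k) / ((r : ℂ) - conj (s k)) := by simp [hf]
    have cG : conj G = ∑ k, conj (q k) / ((r : ℂ) - conj (s k)) := by simp [hG]
    have key : f * conj f + r * (G * conj G) = 0 := by
      -- The partial fractions of `f f* + s G G*`; there is no polynomial part since the function is
      -- `O(1/s)`. For real `r > 0` its value is `|f|² + r |G|²`, so vanishing residues force `f =
      -- 0` there.
      have e1 : f * conj f + r * (G * conj G) =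
          ∑ j, (p j * ∑ k, conj (p k) / (s j - conj (s k))
            + q j * s j * ∑ k, conj (q k) / (s j - conj (s k))) / (r - s j)
          + ∑ k, (conj (p k) * ∑ j, p j / (conj (s k) - s j)
            + conj (q k) * conj (s k) * ∑ j, q j / (conj (s k) - s j)) / (r - conj (s k)) := by
        have hsw : ∑ k, (conj (p k) * ∑ j, p j / (conj (s k) - s j)
            + conj (q k) * conj (s k) * ∑ j, q j / (conj (s k) - s j)) / (r - conj (s k)) =
            ∑ j, ∑ k, (conj (p k) * (p j / (conj (s k) - s j))
            + conj (q k) * conj (s k) * (q j / (conj (s k) - s j))) / (r - conj (s k)) := by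
          simp only [Finset.mul_sum, ← Finset.sum_add_distrib, Finset.sum_div]
          exact Finset.sum_comm
        rw [hsw, cf, cG, hf, hG, Finset.sum_mul_sum, Finset.sum_mul_sum]
        simp only [Finset.mul_sum, ← Finset.sum_add_distrib, Finset.sum_div]
        refine Finset.sum_congr rfl fun j _ => Finset.sum_congr rfl fun k _ => ?_
        have a1 := hr1 r j
        have a2 := hr2 r k
        have a3 := hsub j k
        have a4 : conj (s k) - s j = -(s j - conj (s k)) := by ring
        rw [a4]
        field_simp
        ring
      rw [e1]
      simp [hZ, hZ']
    have key' : Complex.normSq f + r * Complex.normSq G = 0 := by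
      rw [Complex.mul_conj, Complex.mul_conj] at key
      exact_mod_cast key
    have h1 := Complex.normSq_nonneg f
    have h2 := mul_nonneg hr0.le (Complex.normSq_nonneg G)
    exact Complex.normSq_eq_zero.1 (by linarith)
  have hp0 := eq_zero_of_sum_div_sub_eq_zero hs (fun j => (him j).ne) hf
  funext n
  rw [hX n]
  refine Finset.sum_eq_zero fun j _ => ?_
  have := hp0 j
  simp only [hp] at this
  rw [this, zero_div]

/-- `A` is a product of two Cauchy-type matrices. Taking as `g` the intermediate vector splits `(I +
A) X = 0` into the two equations of `vanishing_lemma`. -/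
theorem det_solM_ne_zero (α u₀ : ℝ) (ζ C : ι → ℂ) (x t : ℝ)
    (hinj : Function.Injective fun j => ζ j ^ 2) (him : ∀ j, (ζ j ^ 2).im < 0) :
    (solM α u₀ ζ C x t).det ≠ 0 := by
  intro h0
  obtain ⟨X, hX0, hX⟩ := Matrix.exists_mulVec_eq_zero_iff.2 h0
  apply hX0
  set d : ι → ℂ := fun j => C j * Complex.exp (-(2 * Complex.I * theta α u₀ x t (ζ j))) with hd
  refine vanishing_lemma (s := fun j => ζ j ^ 2) (z := ζ) (d := d) hinj him (fun _ => rfl)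
    (g := fun j => -∑ k, 2 * ζ j * conj (d k) * X k / (ζ j ^ 2 - conj (ζ k ^ 2)))
    (fun _ => rfl) fun n => ?_
  have := congrFun hX n
  simp only [solM, Matrix.add_mulVec, Matrix.one_mulVec, Pi.add_apply, Pi.zero_apply] at this
  rw [eq_neg_of_add_eq_zero_left this, Matrix.mulVec, dotProduct]
  simp only [solA, Matrix.of_apply, Finset.sum_mul]
  rw [Finset.sum_comm, ← Finset.sum_neg_distrib]
  refine Finset.sum_congr rfl fun j _ => ?_
  simp only [mul_neg, neg_div, Finset.mul_sum, Finset.sum_div]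
  congr 1
  refine Finset.sum_congr rfl fun k _ => ?_
  simp only [solC_eq, hd, map_div₀, map_mul, map_sub, map_pow, Complex.conj_conj]
  ring

/-- Schur complement: the bordered determinant is `det M` times `-Y M⁻¹ B`, and `M⁻¹ B` is `X`. -/
theorem det_solMaug_div (α u₀ : ℝ) (um : ℂ) (ζ C : ι → ℂ) (x t : ℝ)
    (h0 : (solM α u₀ ζ C x t).det ≠ 0) (X : ι → ℂ)
    (hX : (solM α u₀ ζ C x t).mulVec X = solB α u₀ um ζ C x t) :
    (solMaug α u₀ um ζ C x t).det / (solM α u₀ ζ C x t).det = -∑ n, solY α u₀ ζ C x t n * X n := by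
  set M := solM α u₀ ζ C x t with hM
  have : Invertible M := M.invertibleOfIsUnitDet (isUnit_iff_ne_zero.2 h0)
  rw [solMaug, ← hM, Matrix.det_fromBlocks₂₂, mul_div_cancel_left₀ _ h0, Matrix.det_unique]
  have hcol : (Matrix.of fun n (_ : Unit) => solB α u₀ um ζ C x t n) =
      M * (Matrix.of fun n (_ : Unit) => X n) := by
    ext n i
    rw [Matrix.of_apply, ← hX]
    simp [Matrix.mul_apply, Matrix.mulVec, dotProduct]
  rw [hcol, Matrix.mul_assoc, Matrix.invOf_mul_cancel_left]
  simp [Matrix.mul_apply]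

end LinearSystem

end MNLS

noncomputable section
namespace MNLS

open Set Filter Topology MeasureTheory

/-! ### Integrals over left half-lines -/

section HalfLine

variable {E : Type*} [NormedAddCommGroup E]

theorem integrableOn_Iic_of_continuous {f : ℝ → E} (hf : Continuous f) {b : ℝ}
    (hi : IntegrableOn f (Iic b)) (x : ℝ) : IntegrableOn f (Iic x) := by
  rcases le_total x b with h | h
  · exact hi.mono_set (Iic_subset_Iic.2 h)
  · rw [← Iic_union_Icc_eq_Iic h]
    exact hi.union hf.continuousOn.integrableOn_Icc

theorem hasDerivAt_integral_Iic [NormedSpace ℝ E] [CompleteSpace E] {f : ℝ → E}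
    (hf : Continuous f) (hi : ∀ x, IntegrableOn f (Iic x)) (x : ℝ) :
    HasDerivAt (fun x => ∫ y in Iic x, f y) (f x) x := by
  have e : (fun x => ∫ y in Iic x, f y) = fun x => (∫ y in Iic 0, f y) + ∫ y in (0 : ℝ)..x, f y := by
    funext x
    rw [← intervalIntegral.integral_Iic_sub_Iic (hi 0) (hi x)]
    abel
  rw [e]
  exact (intervalIntegral.integral_hasDerivAt_right (hf.intervalIntegrable _ _)
    (hf.stronglyMeasurableAtFilter _ _) hf.continuousAt).const_add _

theorem integrableOn_Iic_of_hasDerivAt_nonneg {G g : ℝ → ℝ} {m : ℝ} (hg : Continuous g)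
    (hG : ∀ x, HasDerivAt G (g x) x) (h0 : ∀ x, 0 ≤ g x) (hm : Tendsto G atBot (𝓝 m)) (x : ℝ) :
    IntegrableOn g (Iic x) := by
  refine integrableOn_Iic_of_intervalIntegral_norm_tendsto (G x - m) x (l := atBot) (a := id)
    (fun i => hg.integrableOn_Ioc) tendsto_id ?_
  have : ∀ i : ℝ, ∫ y in id i..x, ‖g y‖ = G x - G i := by
    intro i
    simp_rw [Real.norm_of_nonneg (h0 _)]
    exact intervalIntegral.integral_eq_sub_of_hasDerivAt (fun y _ => hG y)
      (hg.intervalIntegrable _ _)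
  simp_rw [this]
  exact hm.const_sub _

/-- The majorants in the Volterra estimates are exact derivatives `g = G'`, so bounding an integral
amounts to evaluating `G` at the ends. -/
theorem norm_integral_Iic_le_of_hasDerivAt [NormedSpace ℝ E] {f : ℝ → E} {G g : ℝ → ℝ} {m : ℝ}
    (hg : Continuous g) (hG : ∀ x, HasDerivAt G (g x) x) (h0 : ∀ x, 0 ≤ g x)
    (hm : Tendsto G atBot (𝓝 m)) {x : ℝ} (hf : ∀ y ≤ x, ‖f y‖ ≤ g y) :
    ‖∫ y in Iic x, f y‖ ≤ G x - m := by
  have hi := integrableOn_Iic_of_hasDerivAt_nonneg hg hG h0 hm x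
  rw [← integral_Iic_of_hasDerivAt_of_tendsto' (fun y _ => hG y) hi hm]
  exact norm_integral_le_of_norm_le hi ((ae_restrict_mem measurableSet_Iic).mono hf)

/-- First and second antiderivatives, vanishing at `-∞`, of a function with integrable first
moment. -/
theorem exists_antiderivatives {v : ℝ → ℝ} (hv : Continuous v) (h0 : ∀ x, 0 ≤ v x)
    (hi : IntegrableOn (fun x => (1 + |x|) * v x) (Iic 0)) :
    ∃ h P : ℝ → ℝ, (∀ x, HasDerivAt h (v x) x) ∧ (∀ x, HasDerivAt P (h x) x) ∧
      (∀ x, 0 ≤ h x) ∧ (∀ x, 0 ≤ P x) ∧ Tendsto h atBot (𝓝 0) ∧ Tendsto P atBot (𝓝 0) := by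
  have i0 : ∀ x, IntegrableOn v (Iic x) := integrableOn_Iic_of_continuous hv
    (hi.mono' hv.aestronglyMeasurable (Eventually.of_forall fun x => by
      rw [Real.norm_of_nonneg (h0 x)]
      nlinarith [h0 x, abs_nonneg x]))
  have hcont : Continuous fun x => x * v x := by fun_prop
  have i1 : ∀ x, IntegrableOn (fun x => x * v x) (Iic x) := integrableOn_Iic_of_continuous hcont
    (hi.mono' hcont.aestronglyMeasurable (Eventually.of_forall fun x => by
      rw [norm_mul, Real.norm_of_nonneg (h0 x), Real.norm_eq_abs]
      nlinarith [h0 x, abs_nonneg x]))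
  have d0 := hasDerivAt_integral_Iic hv i0
  have d1 := hasDerivAt_integral_Iic hcont i1
  have hn : ∀ x, 0 ≤ ∫ y in Iic x, v y := fun x => integral_nonneg h0
  have t0 : Tendsto (fun x => ∫ y in Iic x, v y) atBot (𝓝 0) := tendsto_integral_Iic_zero tendsto_id
  have t1 : Tendsto (fun x => ∫ y in Iic x, y * v y) atBot (𝓝 0) :=
    tendsto_integral_Iic_zero tendsto_id
  -- The second antiderivative is `∫ (x - y) v y` over `y ≤ x`. It is finite because of the first
  -- moment, and for `x ≤ 0` it is at most `-∫ y v y`, which tends to `0`.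
  have eP : ∀ x, x * (∫ y in Iic x, v y) - ∫ y in Iic x, y * v y =
      ∫ y in Iic x, (x - y) * v y := by
    intro x
    rw [← integral_const_mul, ← integral_sub ((i0 x).const_mul x) (i1 x)]
    congr 1
    funext y
    ring
  have hP : ∀ x, 0 ≤ x * (∫ y in Iic x, v y) - ∫ y in Iic x, y * v y := by
    intro x
    rw [eP]
    refine setIntegral_nonneg measurableSet_Iic fun y hy => mul_nonneg (sub_nonneg.2 hy) (h0 y)
  refine ⟨fun x => ∫ y in Iic x, v y, fun x => x * (∫ y in Iic x, v y) - ∫ y in Iic x, y * v y,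
    d0, fun x => ?_, hn, hP, t0, ?_⟩
  · exact (((hasDerivAt_id x).mul (d0 x)).sub (d1 x)).congr_deriv (by simp)
  · refine tendsto_of_tendsto_of_tendsto_of_le_of_le' tendsto_const_nhds (by simpa using t1.neg)
      (Eventually.of_forall hP) ?_
    filter_upwards [eventually_le_atBot 0] with x hx
    have := mul_nonpos_of_nonpos_of_nonneg hx (hn x)
    linarith

end HalfLine

/-! ### The scattering problem in the variable `s = z²` -/

/-- `κ(s) = (s - u₀²) / (2αs)`, which is `k(z)/z` for `s = z²`. -/
def kap (α u₀ : ℝ) (s : ℂ) : ℂ := (s - (u₀ : ℂ) ^ 2) / (2 * α * s)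

/-- `ω(s) = (s - u₀⁴/s) / (2α)`, which is `2 k(z) λ(z)` for `s = z²`. -/
def omg (α u₀ : ℝ) (s : ℂ) : ℂ := (s - (u₀ : ℂ) ^ 4 / s) / (2 * α)

/-- The closed upper half-plane without the origin. -/
def upperH : Set ℂ := {s | 0 ≤ s.im ∧ s ≠ 0}

/-- The closed lower half-plane without the origin. -/
def lowerH : Set ℂ := {s | s.im ≤ 0 ∧ s ≠ 0}

/-- `(a, e)` are the components, as functions of `s = z²` and `x`, of the solution normalized at
the end `l` of the `x`-axis: `e^{-iθ} φ_{±,1} = (a, e/z)`. -/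
structure IsJostPair (α u₀ : ℝ) (c : ℂ) (w : ℝ → ℂ) (l : Filter ℝ) (H : Set ℂ)
    (a e : ℂ → ℝ → ℂ) : Prop where
  deriv_fst : ∀ s ∈ H, ∀ x, HasDerivAt (a s)
    (Complex.I * kap α u₀ s * ((u₀ : ℂ) ^ 2 * a s x + w x * e s x)) x
  deriv_snd : ∀ s ∈ H, ∀ x, HasDerivAt (e s)
    (Complex.I * kap α u₀ s * s * (e s x + conj (w x) * a s x)) x
  tendsto_fst : ∀ s ∈ H, Tendsto (a s) l (𝓝 1)
  tendsto_snd : ∀ s ∈ H, Tendsto (e s) l (𝓝 (-conj c))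
  cont_fst : ∀ x, ContinuousOn (fun s => a s x) H
  cont_snd : ∀ x, ContinuousOn (fun s => e s x) H
  hol_fst : ∀ x, ∀ s ∈ H, s.im ≠ 0 → DifferentiableAt ℂ (fun s => a s x) s
  hol_snd : ∀ x, ∀ s ∈ H, s.im ≠ 0 → DifferentiableAt ℂ (fun s => e s x) s

/-- The coefficient matrix of `IsJostPair`, taken at `w = c` with `|c| = u₀`, has determinant zero;
its eigenvalues are `0` and the trace, and this identity says that the trace is `iω`. -/
theorem kap_mul_add (α u₀ : ℝ) {s : ℂ} (hs : s ≠ 0) :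
    kap α u₀ s * (s + (u₀ : ℂ) ^ 2) = omg α u₀ s := by
  rw [kap, omg]
  rcases eq_or_ne (α : ℂ) 0 with h | h
  · simp [h]
  · field_simp
    ring

/-- This sign decides where the left solution exists: the kernel `exp (iω (x - y))` is bounded for
`y ≤ x`. -/
theorem omg_im_nonneg {α u₀ : ℝ} (hα : 0 < α) {s : ℂ} (hs : s ∈ upperH) :
    0 ≤ (omg α u₀ s).im := by
  have : (omg α u₀ s).im = s.im * (1 + u₀ ^ 4 / Complex.normSq s) / (2 * α) := by
    have e : omg α u₀ s = (s - (u₀ ^ 4 : ℝ) * s⁻¹) / ((2 * α : ℝ) : ℂ) := by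
      rw [omg]; push_cast; ring
    rw [e, Complex.div_ofReal_im, Complex.sub_im, Complex.im_ofReal_mul, Complex.inv_im]
    ring
  rw [this]
  have := hs.1
  have := Complex.normSq_nonneg s
  positivity

theorem continuousOn_kap (α u₀ : ℝ) (hα : 0 < α) : ContinuousOn (kap α u₀) {0}ᶜ := by
  have : (α : ℂ) ≠ 0 := by exact_mod_cast hα.ne'
  unfold kap
  refine ContinuousOn.div (by fun_prop) (by fun_prop) fun s hs => ?_
  simp only [mem_compl_iff, mem_singleton_iff] at hs
  simp [hs, this]

theorem differentiableOn_kap (α u₀ : ℝ) (hα : 0 < α) : DifferentiableOn ℂ (kap α u₀) {0}ᶜ := by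
  have : (α : ℂ) ≠ 0 := by exact_mod_cast hα.ne'
  unfold kap
  refine DifferentiableOn.div (by fun_prop) (by fun_prop) fun s hs => ?_
  simp only [mem_compl_iff, mem_singleton_iff] at hs
  simp [hs, this]

theorem differentiableOn_omg (α u₀ : ℝ) : DifferentiableOn ℂ (omg α u₀) {0}ᶜ := by
  unfold omg
  refine DifferentiableOn.div_const (DifferentiableOn.sub (by fun_prop)
    (DifferentiableOn.div (by fun_prop) (by fun_prop) fun s hs => by simpa using hs)) _

/-! ### Construction of the left Jost solution -/

/-- Integrand of the first component of the Volterra equation. -/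
def volA (α u₀ : ℝ) (c : ℂ) (w : ℝ → ℂ) (s : ℂ) (y : ℝ) (a q : ℂ) : ℂ :=
  Complex.I * kap α u₀ s * (c * q + (w y - c) * (q - conj c * a))

/-- Integrand of the second component of the Volterra equation, without the exponential. -/
def volQ (α u₀ : ℝ) (c : ℂ) (w : ℝ → ℂ) (s : ℂ) (y : ℝ) (a q : ℂ) : ℂ :=
  Complex.I * kap α u₀ s * (s * conj (w y - c) * a + conj c * (w y - c) * (q - conj c * a))

/-- The Volterra operator for `(a, q)`, where `q = e + c* a`. -/
def volStep (α u₀ : ℝ) (c : ℂ) (w : ℝ → ℂ) (p : (ℂ → ℝ → ℂ) × (ℂ → ℝ → ℂ)) :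
    (ℂ → ℝ → ℂ) × (ℂ → ℝ → ℂ) :=
  (fun s x => ∫ y in Iic x, volA α u₀ c w s y (p.1 s y) (p.2 s y),
    fun s x => ∫ y in Iic x, Complex.exp (Complex.I * omg α u₀ s * (x - y)) *
      volQ α u₀ c w s y (p.1 s y) (p.2 s y))

/-- The constant controlling the Volterra kernels at the spectral parameter `s`. -/
def volC (α u₀ : ℝ) (c s : ℂ) : ℝ := ‖kap α u₀ s‖ * (1 + ‖s‖ + ‖c‖ + ‖c‖ ^ 2)

theorem norm_volA_le (α u₀ : ℝ) (c : ℂ) (w : ℝ → ℂ) (s : ℂ) (y : ℝ) (a q : ℂ) :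
    ‖volA α u₀ c w s y a q‖ ≤ volC α u₀ c s * (‖q‖ + ‖w y - c‖ * (‖a‖ + ‖q‖)) := by
  have h1 : ‖c * q + (w y - c) * (q - conj c * a)‖ ≤
      ‖c‖ * ‖q‖ + ‖w y - c‖ * (‖q‖ + ‖c‖ * ‖a‖) := by
    refine (norm_add_le _ _).trans ?_
    rw [norm_mul, norm_mul]
    gcongr
    refine (norm_sub_le _ _).trans ?_
    simp
  rw [volA, norm_mul, norm_mul, Complex.norm_I, one_mul, volC, mul_assoc]
  refine mul_le_mul_of_nonneg_left (h1.trans ?_) (norm_nonneg _)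
  have := norm_nonneg c; have := norm_nonneg s; have := norm_nonneg q; have := norm_nonneg a
  have := norm_nonneg (w y - c)
  have e : (1 + ‖s‖ + ‖c‖ + ‖c‖ ^ 2) * (‖q‖ + ‖w y - c‖ * (‖a‖ + ‖q‖)) =
    ‖c‖ * ‖q‖ + ‖w y - c‖ * (‖q‖ + ‖c‖ * ‖a‖) + ((1 + ‖s‖ + ‖c‖ ^ 2) * ‖q‖ +
      ‖w y - c‖ * ((1 + ‖s‖ + ‖c‖ ^ 2) * ‖a‖ + (‖s‖ + ‖c‖ + ‖c‖ ^ 2) * ‖q‖)) := by ring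
  rw [e]
  exact le_add_of_nonneg_right (by positivity)

theorem norm_volQ_le (α u₀ : ℝ) (c : ℂ) (w : ℝ → ℂ) (s : ℂ) (y : ℝ) (a q : ℂ) :
    ‖volQ α u₀ c w s y a q‖ ≤ volC α u₀ c s * (‖w y - c‖ * (‖a‖ + ‖q‖)) := by
  have h1 : ‖s * conj (w y - c) * a + conj c * (w y - c) * (q - conj c * a)‖ ≤
      ‖s‖ * ‖w y - c‖ * ‖a‖ + ‖c‖ * ‖w y - c‖ * (‖q‖ + ‖c‖ * ‖a‖) := by
    refine (norm_add_le _ _).trans ?_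
    rw [norm_mul, norm_mul, norm_mul, norm_mul, RCLike.norm_conj, RCLike.norm_conj]
    gcongr
    refine (norm_sub_le _ _).trans ?_
    simp
  rw [volQ, norm_mul, norm_mul, Complex.norm_I, one_mul, volC, mul_assoc ‖kap α u₀ s‖]
  refine mul_le_mul_of_nonneg_left (h1.trans ?_) (norm_nonneg _)
  have := norm_nonneg c; have := norm_nonneg s; have := norm_nonneg q; have := norm_nonneg a
  have := norm_nonneg (w y - c)
  have e : (1 + ‖s‖ + ‖c‖ + ‖c‖ ^ 2) * (‖w y - c‖ * (‖a‖ + ‖q‖)) =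
    ‖s‖ * ‖w y - c‖ * ‖a‖ + ‖c‖ * ‖w y - c‖ * (‖q‖ + ‖c‖ * ‖a‖) +
      ‖w y - c‖ * ((1 + ‖c‖) * ‖a‖ + (1 + ‖s‖ + ‖c‖ ^ 2) * ‖q‖) := by ring
  rw [e]
  exact le_add_of_nonneg_right (by positivity)

theorem norm_exp_omg_le {α u₀ : ℝ} (hα : 0 < α) {s : ℂ} (hs : s ∈ upperH) {x y : ℝ} (hxy : y ≤ x) :
    ‖Complex.exp (Complex.I * omg α u₀ s * (x - y))‖ ≤ 1 := by
  rw [Complex.norm_exp, ← Complex.ofReal_sub, Complex.re_mul_ofReal]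
  simp only [Complex.mul_re, Complex.I_re, Complex.I_im, zero_mul, one_mul, zero_sub]
  rw [← Real.exp_zero]
  apply Real.exp_le_exp.2
  have := mul_nonneg (omg_im_nonneg (u₀ := u₀) hα hs) (sub_nonneg.2 hxy)
  linarith

/-- The weights of the Volterra iteration. -/
structure VolterraWeights (v : ℝ → ℝ) (C : ℝ) (h L : ℝ → ℝ) : Prop where
  h_nonneg : ∀ x, 0 ≤ h x
  L_nonneg : ∀ x, 0 ≤ L x
  h_deriv : ∀ x, HasDerivAt h (v x) x
  L_deriv : ∀ x, HasDerivAt L (4 * C * (4 * C * h x + v x * (4 * C * h x + 1))) x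
  h_lim : Tendsto h atBot (𝓝 0)
  L_lim : Tendsto L atBot (𝓝 0)

/-- The iterates are to satisfy `‖a‖ ≤ β e^L` and `‖q‖ ≤ 4 β C h e^L`, with `β` halved at each step;
`L'` is four times the factor that these bounds produce in the first integrand. Its summand `4 C h`,
coming from `c q`, is not multiplied by the potential, so `L` contains the double integral `P` of
`v`. This is where the first moment is needed. -/
theorem exists_volterraWeights {v : ℝ → ℝ} (hv : Continuous v) (h0 : ∀ x, 0 ≤ v x)
    (hi : IntegrableOn (fun x => (1 + |x|) * v x) (Iic 0)) {C : ℝ} (hC : 0 ≤ C) :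
    ∃ h L, VolterraWeights v C h L := by
  obtain ⟨h, P, dh, dP, nh, nP, th, tP⟩ := exists_antiderivatives hv h0 hi
  refine ⟨h, fun x => 4 * C * (4 * C * P x + 2 * C * h x ^ 2 + h x), nh, fun x => ?_, dh,
    fun x => ?_, th, ?_⟩
  · have := nh x; have := nP x; positivity
  · have := ((((dP x).const_mul (4 * C)).add (((dh x).pow 2).const_mul (2 * C))).add
      (dh x)).const_mul (4 * C)
    refine this.congr_deriv ?_
    norm_num only [pow_one]
    ring
  · have := (((tP.const_mul (4 * C)).add ((th.pow 2).const_mul (2 * C))).add th).const_mul (4 * C)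
    simpa using this

end MNLS
end

/-! ### One step of the Volterra iteration -/

noncomputable section
namespace MNLS

open Set Filter Topology MeasureTheory

/-- The properties preserved by the Volterra iteration on a set `S` of spectral parameters. -/
structure IsVolterraIterate (S : Set ℂ) (C : ℝ) (h L : ℝ → ℝ) (β : ℝ)
    (a q : ℂ → ℝ → ℂ) : Prop where
  cont_fst : ∀ s ∈ S, Continuous (a s)
  cont_snd : ∀ s ∈ S, Continuous (q s)
  contOn_fst : ∀ x, ContinuousOn (fun s => a s x) S
  contOn_snd : ∀ x, ContinuousOn (fun s => q s x) S
  hol_fst : ∀ x, DifferentiableOn ℂ (fun s => a s x) (interior S)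
  hol_snd : ∀ x, DifferentiableOn ℂ (fun s => q s x) (interior S)
  bound_fst : ∀ s ∈ S, ∀ x, ‖a s x‖ ≤ β * Real.exp (L x)
  bound_snd : ∀ s ∈ S, ∀ x, ‖q s x‖ ≤ β * (4 * C * h x) * Real.exp (L x)

section Step

variable {α u₀ : ℝ} {c : ℂ} {w : ℝ → ℂ} {S : Set ℂ} {C : ℝ} {h L : ℝ → ℝ} {β : ℝ}
  {a q : ℂ → ℝ → ℂ}

/-- The majorant is the derivative of `(β / 4) e^L`. -/
theorem IsVolterraIterate.norm_volA_le (hC : ∀ s ∈ S, volC α u₀ c s ≤ C) (hC0 : 0 ≤ C)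
    (hp : IsVolterraIterate S C h L β a q)
    {s : ℂ} (hs : s ∈ S) (y : ℝ) :
    ‖volA α u₀ c w s y (a s y) (q s y)‖ ≤ β / 4 *
      (Real.exp (L y) * (4 * C * (4 * C * h y + ‖w y - c‖ * (4 * C * h y + 1)))) := by
  refine (MNLS.norm_volA_le α u₀ c w s y _ _).trans ?_
  calc _ ≤ C * (β * (4 * C * h y) * Real.exp (L y) + ‖w y - c‖ *
        (β * Real.exp (L y) + β * (4 * C * h y) * Real.exp (L y))) := by
        gcongr
        · exact hC s hs
        · exact hp.bound_snd s hs y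
        · exact hp.bound_fst s hs y
        · exact hp.bound_snd s hs y
    _ = _ := by ring

/-- The majorant is the derivative of `2 C β h e^L`, which is half of the bound on `q` before the
step. -/
theorem IsVolterraIterate.norm_volQ_le (hC : ∀ s ∈ S, volC α u₀ c s ≤ C) (hC0 : 0 ≤ C)
    (hW : VolterraWeights (fun x => ‖w x - c‖) C h L) (hβ : 0 ≤ β)
    (hp : IsVolterraIterate S C h L β a q)
    {s : ℂ} (hs : s ∈ S) (y : ℝ) :
    ‖volQ α u₀ c w s y (a s y) (q s y)‖ ≤ 2 * C * β * (‖w y - c‖ * Real.exp (L y) + h y *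
      (Real.exp (L y) * (4 * C * (4 * C * h y + ‖w y - c‖ * (4 * C * h y + 1))))) := by
  refine (MNLS.norm_volQ_le α u₀ c w s y _ _).trans ?_
  have h1 := hW.h_nonneg y
  calc _ ≤ C * (‖w y - c‖ *
        (β * Real.exp (L y) + β * (4 * C * h y) * Real.exp (L y))) := by
        gcongr
        · exact hC s hs
        · exact hp.bound_fst s hs y
        · exact hp.bound_snd s hs y
    _ ≤ C * (‖w y - c‖ *
        (β * Real.exp (L y) + β * (4 * C * h y) * Real.exp (L y))) +
        C * β * Real.exp (L y) * (‖w y - c‖ + h y * (2 * (4 * C * (4 * C * h y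
          + ‖w y - c‖ * (4 * C * h y))) + 4 * C * ‖w y - c‖)) :=
        le_add_of_nonneg_right (by positivity)
    _ = _ := by ring

variable (hα : 0 < α) (hw : Continuous w) (hS : S ⊆ upperH) (hC : ∀ s ∈ S, volC α u₀ c s ≤ C)
  (hC0 : 0 ≤ C) (hW : VolterraWeights (fun x => ‖w x - c‖) C h L) (hβ : 0 ≤ β)
  (hp : IsVolterraIterate S C h L β a q)
include hα hw hS hC hC0 hW hβ hp

/-- The majorants integrate exactly, so a step halves `β`. Continuity and holomorphy in `s` pass
under the integral by domination, the exponential kernel being at most `1` because `S ⊆ upperH`. The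
bound with `e^L - 1` will give the limit of the sum at `-∞`. -/
theorem IsVolterraIterate.volStep_aux :
    IsVolterraIterate S C h L (β / 2) (volStep α u₀ c w (a, q)).1 (volStep α u₀ c w (a, q)).2 ∧
    ∀ s ∈ S, ∀ x,
      HasDerivAt ((volStep α u₀ c w (a, q)).1 s) (volA α u₀ c w s x (a s x) (q s x)) x ∧
      HasDerivAt ((volStep α u₀ c w (a, q)).2 s)
        (Complex.I * omg α u₀ s * (volStep α u₀ c w (a, q)).2 s x +
          volQ α u₀ c w s x (a s x) (q s x)) x ∧
      ‖(volStep α u₀ c w (a, q)).1 s x‖ ≤ β / 2 * (Real.exp (L x) - 1) := by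
  have hLc : Continuous L := continuous_iff_continuousAt.2 fun x => (hW.L_deriv x).continuousAt
  have hhc : Continuous h := continuous_iff_continuousAt.2 fun x => (hW.h_deriv x).continuousAt
  have hS0 : S ⊆ {0}ᶜ := fun s hs => (hS hs).2
  have hU0 : interior S ⊆ {0}ᶜ := interior_subset.trans hS0
  have hkc : ContinuousOn (kap α u₀) S := (continuousOn_kap α u₀ hα).mono hS0
  have hoc : ContinuousOn (omg α u₀) S := (differentiableOn_omg α u₀).continuousOn.mono hS0
  have hkd : DifferentiableOn ℂ (kap α u₀) (interior S) := (differentiableOn_kap α u₀ hα).mono hU0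
  have hod : DifferentiableOn ℂ (omg α u₀) (interior S) := (differentiableOn_omg α u₀).mono hU0
  have hfc := hp.cont_fst
  have hqc := hp.cont_snd
  -- continuity of the integrands in the space variable
  have cA : ∀ s ∈ S, Continuous fun y => volA α u₀ c w s y (a s y) (q s y) := by
    intro s hs
    have := hfc s hs; have := hqc s hs
    unfold volA; fun_prop
  have cQ : ∀ s ∈ S, Continuous fun y => volQ α u₀ c w s y (a s y) (q s y) := by
    intro s hs
    have := hfc s hs; have := hqc s hs
    unfold volQ
    have : Continuous fun y => conj (w y - c) := Complex.continuous_conj.comp (hw.sub continuous_const)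
    fun_prop
  -- dominating functions
  set gA : ℝ → ℝ := fun y => β / 4 *
      (Real.exp (L y) * (4 * C * (4 * C * h y + ‖w y - c‖ * (4 * C * h y + 1)))) with hgA
  set gQ : ℝ → ℝ := fun y => 2 * C * β * (‖w y - c‖ * Real.exp (L y) + h y *
      (Real.exp (L y) * (4 * C * (4 * C * h y + ‖w y - c‖ * (4 * C * h y + 1))))) with hgQ
  have gAc : Continuous gA := by fun_prop
  have gQc : Continuous gQ := by fun_prop
  have gA0 : ∀ y, 0 ≤ gA y := fun y => by have := hW.h_nonneg y; simp only [hgA]; positivity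
  have gQ0 : ∀ y, 0 ≤ gQ y := fun y => by have := hW.h_nonneg y; simp only [hgQ]; positivity
  have dA : ∀ x, HasDerivAt (fun x => β / 4 * Real.exp (L x)) (gA x) x := fun x =>
    ((hW.L_deriv x).exp).const_mul _
  have dQ : ∀ x, HasDerivAt (fun x => 2 * C * β * (h x * Real.exp (L x))) (gQ x) x := fun x =>
    ((hW.h_deriv x).mul ((hW.L_deriv x).exp)).const_mul _
  have tA : Tendsto (fun x => β / 4 * Real.exp (L x)) atBot (𝓝 (β / 4)) := by
    simpa using ((Real.continuous_exp.tendsto 0).comp hW.L_lim).const_mul (β / 4)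
  have tQ : Tendsto (fun x => 2 * C * β * (h x * Real.exp (L x))) atBot (𝓝 0) := by
    simpa using (hW.h_lim.mul ((Real.continuous_exp.tendsto 0).comp hW.L_lim)).const_mul (2 * C * β)
  have bA : ∀ s ∈ S, ∀ y, ‖volA α u₀ c w s y (a s y) (q s y)‖ ≤ gA y := fun s hs y =>
    hp.norm_volA_le hC hC0 hs y
  have bQ : ∀ s ∈ S, ∀ y, ‖volQ α u₀ c w s y (a s y) (q s y)‖ ≤ gQ y := fun s hs y =>
    hp.norm_volQ_le hC hC0 hW hβ hs y
  have iA : ∀ x, IntegrableOn gA (Iic x) := integrableOn_Iic_of_hasDerivAt_nonneg gAc dA gA0 tA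
  have iQ : ∀ x, IntegrableOn gQ (Iic x) := integrableOn_Iic_of_hasDerivAt_nonneg gQc dQ gQ0 tQ
  have bE : ∀ s ∈ S, ∀ x : ℝ, ∀ y : ℝ, y ≤ x → ‖Complex.exp (Complex.I * omg α u₀ s * (x - y)) *
      volQ α u₀ c w s y (a s y) (q s y)‖ ≤ gQ y := by
    intro s hs x y hyx
    rw [norm_mul]
    exact (mul_le_of_le_one_left (norm_nonneg _) (norm_exp_omg_le hα (hS hs) hyx)).trans (bQ s hs y)
  -- derivatives
  have DA : ∀ s ∈ S, ∀ x, HasDerivAt ((volStep α u₀ c w (a, q)).1 s)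
      (volA α u₀ c w s x (a s x) (q s x)) x := fun s hs =>
    hasDerivAt_integral_Iic (cA s hs) fun x =>
      (iA x).mono' (cA s hs).aestronglyMeasurable (Eventually.of_forall (bA s hs))
  have DQ : ∀ s ∈ S, ∀ x, HasDerivAt ((volStep α u₀ c w (a, q)).2 s)
        (Complex.I * omg α u₀ s * (volStep α u₀ c w (a, q)).2 s x +
          volQ α u₀ c w s x (a s x) (q s x)) x := by
    intro s hs x
    have cF : Continuous fun y : ℝ => Complex.exp (-(Complex.I * omg α u₀ s * y)) *
        volQ α u₀ c w s y (a s y) (q s y) := by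
      have := cQ s hs
      fun_prop
    have iF : ∀ x, IntegrableOn (fun y : ℝ => Complex.exp (-(Complex.I * omg α u₀ s * y)) *
        volQ α u₀ c w s y (a s y) (q s y)) (Iic x) := by
      refine integrableOn_Iic_of_continuous cF (b := 0) ((iQ 0).mono' cF.aestronglyMeasurable ?_)
      filter_upwards [ae_restrict_mem measurableSet_Iic] with y hy
      simpa [mul_comm] using bE s hs 0 y hy
    -- The part of the kernel depending on `x` is pulled out, so that the remaining integrand does
    -- not involve `x`.
    have e : (volStep α u₀ c w (a, q)).2 s = fun x : ℝ => Complex.exp (Complex.I * omg α u₀ s * x) *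
        ∫ y in Iic x, Complex.exp (-(Complex.I * omg α u₀ s * y)) *
          volQ α u₀ c w s y (a s y) (q s y) := by
      funext x
      rw [← integral_const_mul]
      simp only [volStep]
      congr 1
      funext y
      rw [← mul_assoc, ← Complex.exp_add]
      ring_nf
    have d1 : HasDerivAt (fun x : ℝ => Complex.exp (Complex.I * omg α u₀ s * x))
        (Complex.exp (Complex.I * omg α u₀ s * x) * (Complex.I * omg α u₀ s)) x := by
      have : HasDerivAt (fun x : ℝ => Complex.I * omg α u₀ s * x) (Complex.I * omg α u₀ s) x := by
        simpa using (Complex.ofRealCLM.hasDerivAt (x := x)).const_mul (Complex.I * omg α u₀ s)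
      exact this.cexp
    have := d1.mul (hasDerivAt_integral_Iic cF iF x)
    rw [e]
    refine this.congr_deriv ?_
    rw [← mul_assoc (Complex.exp (Complex.I * omg α u₀ s * x)) (Complex.exp _), ← Complex.exp_add,
      add_neg_cancel, Complex.exp_zero]
    ring
  have BA : ∀ s ∈ S, ∀ x, ‖(volStep α u₀ c w (a, q)).1 s x‖ ≤ β / 2 * (Real.exp (L x) - 1) := by
    intro s hs x
    have := norm_integral_Iic_le_of_hasDerivAt gAc dA gA0 tA (x := x) (fun y _ => bA s hs y)
    refine this.trans ?_
    have : 1 ≤ Real.exp (L x) := Real.one_le_exp (hW.L_nonneg x)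
    nlinarith
  refine ⟨⟨fun s hs => continuous_iff_continuousAt.2 fun x => (DA s hs x).continuousAt,
    fun s hs => continuous_iff_continuousAt.2 fun x => (DQ s hs x).continuousAt,
    fun x => ?_, fun x => ?_, fun x => ?_, fun x => ?_, fun s hs x => ?_, fun s hs x => ?_⟩,
    fun s hs x => ⟨DA s hs x, DQ s hs x, BA s hs x⟩⟩
  · refine continuousOn_of_dominated (fun s hs => (cA s hs).aestronglyMeasurable)
      (fun s hs => Eventually.of_forall (bA s hs)) (iA x) (Eventually.of_forall fun y => ?_)
    have := hp.contOn_fst y; have := hp.contOn_snd y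
    unfold volA; fun_prop
  · refine continuousOn_of_dominated (fun s hs => ?_)
      (fun s hs => (ae_restrict_mem measurableSet_Iic).mono (bE s hs x)) (iQ x)
      (Eventually.of_forall fun y => ?_)
    · have := cQ s hs
      exact Continuous.aestronglyMeasurable (by fun_prop)
    · have := hp.contOn_fst y; have := hp.contOn_snd y
      unfold volQ; fun_prop
  · refine differentiableOn_integral_of_locally_dominated isOpen_interior
      (fun s hs => (cA s (interior_subset hs)).aestronglyMeasurable) (fun y => ?_) gA (iA x)
      (Eventually.of_forall fun y s hs => bA s (interior_subset hs) y)
    have := hp.hol_fst y; have := hp.hol_snd y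
    unfold volA; fun_prop
  · refine differentiableOn_integral_of_locally_dominated isOpen_interior
      (fun s hs => ?_) (fun y => ?_) gQ (iQ x)
      ((ae_restrict_mem measurableSet_Iic).mono fun y hy s hs => bE s (interior_subset hs) x y hy)
    · have := cQ s (interior_subset hs)
      exact Continuous.aestronglyMeasurable (by fun_prop)
    · have := hp.hol_fst y; have := hp.hol_snd y
      unfold volQ; fun_prop
  · refine (BA s hs x).trans ?_
    have := Real.exp_pos (L x)
    nlinarith
  · have := norm_integral_Iic_le_of_hasDerivAt gQc dQ gQ0 tQ (x := x) (bE s hs x)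
    refine this.trans (le_of_eq ?_)
    ring

end Step

end MNLS
end

/-! ### Summation of the Neumann series and existence of the left and right pairs -/

noncomputable section
namespace MNLS

open Set Filter Topology MeasureTheory

/-- The terms of the Neumann series for the left Jost solution. -/
def volIter (α u₀ : ℝ) (c : ℂ) (w : ℝ → ℂ) : ℕ → (ℂ → ℝ → ℂ) × (ℂ → ℝ → ℂ)
  | 0 => (fun _ _ => 1, fun _ _ => 0)
  | n + 1 => volStep α u₀ c w (volIter α u₀ c w n)

def volSumA (α u₀ : ℝ) (c : ℂ) (w : ℝ → ℂ) (s : ℂ) (x : ℝ) : ℂ :=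
  ∑' n, (volIter α u₀ c w n).1 s x

def volSumQ (α u₀ : ℝ) (c : ℂ) (w : ℝ → ℂ) (s : ℂ) (x : ℝ) : ℂ :=
  ∑' n, (volIter α u₀ c w n).2 s x

theorem summable_half_pow_mul (K : ℝ) : Summable fun n : ℕ => (1 / 2 : ℝ) ^ n * K :=
  (summable_geometric_of_lt_one (by norm_num) (by norm_num)).mul_right K

/-- The `n`-th term is at most `2⁻ⁿ` times a bound that is independent of `s ∈ S` and locally
bounded in `x`, so the series may be differentiated termwise in both variables. The limits at `-∞`
follow from `e^L - 1 → 0` and `h e^L → 0`. -/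
theorem volSum_spec {α u₀ : ℝ} {c : ℂ} {w : ℝ → ℂ} (hα : 0 < α) (hw : Continuous w)
    (hi : IntegrableOn (fun x => (1 + |x|) * ‖w x - c‖) (Iic 0)) {S : Set ℂ} (hS : S ⊆ upperH)
    {C : ℝ} (hC : ∀ s ∈ S, volC α u₀ c s ≤ C) (hC0 : 0 ≤ C) :
    (∀ s ∈ S, ∀ x, HasDerivAt (volSumA α u₀ c w s)
      (volA α u₀ c w s x (volSumA α u₀ c w s x) (volSumQ α u₀ c w s x)) x) ∧
    (∀ s ∈ S, ∀ x, HasDerivAt (volSumQ α u₀ c w s)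
      (Complex.I * omg α u₀ s * volSumQ α u₀ c w s x +
        volQ α u₀ c w s x (volSumA α u₀ c w s x) (volSumQ α u₀ c w s x)) x) ∧
    (∀ s ∈ S, Tendsto (volSumA α u₀ c w s) atBot (𝓝 1)) ∧
    (∀ s ∈ S, Tendsto (volSumQ α u₀ c w s) atBot (𝓝 0)) ∧
    (∀ x, ContinuousOn (fun s => volSumA α u₀ c w s x) S) ∧
    (∀ x, ContinuousOn (fun s => volSumQ α u₀ c w s x) S) ∧
    (∀ x, DifferentiableOn ℂ (fun s => volSumA α u₀ c w s x) (interior S)) ∧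
    (∀ x, DifferentiableOn ℂ (fun s => volSumQ α u₀ c w s x) (interior S)) := by
  obtain ⟨h, L, hW⟩ := exists_volterraWeights (v := fun x => ‖w x - c‖) (by fun_prop)
    (fun x => norm_nonneg _) hi hC0
  have hLc : Continuous L := continuous_iff_continuousAt.2 fun x => (hW.L_deriv x).continuousAt
  have hhc : Continuous h := continuous_iff_continuousAt.2 fun x => (hW.h_deriv x).continuousAt
  set p := volIter α u₀ c w with hp
  have p0 : p 0 = (fun _ _ => 1, fun _ _ => 0) := rfl
  have ps : ∀ n, p (n + 1) = volStep α u₀ c w ((p n).1, (p n).2) := fun n => rfl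
  have hit : ∀ n, IsVolterraIterate S C h L ((1 / 2) ^ n) (p n).1 (p n).2 := by
    intro n
    induction n with
    | zero =>
      rw [p0]
      refine ⟨fun s _ => continuous_const, fun s _ => continuous_const, fun x => continuousOn_const,
        fun x => continuousOn_const, fun x => differentiableOn_const _,
        fun x => differentiableOn_const _, fun s _ x => ?_, fun s _ x => ?_⟩
      · simpa using hW.L_nonneg x
      · have := hW.h_nonneg x
        simp only [norm_zero]
        positivity
    | succ n ih =>
      rw [ps, pow_succ, mul_one_div]
      exact (ih.volStep_aux hα hw hS hC hC0 hW (by positivity)).1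
  have hst : ∀ n, ∀ s ∈ S, ∀ x,
      HasDerivAt ((p (n + 1)).1 s) (volA α u₀ c w s x ((p n).1 s x) ((p n).2 s x)) x ∧
      HasDerivAt ((p (n + 1)).2 s) (Complex.I * omg α u₀ s * (p (n + 1)).2 s x +
          volQ α u₀ c w s x ((p n).1 s x) ((p n).2 s x)) x ∧
      ‖(p (n + 1)).1 s x‖ ≤ (1 / 2) ^ n / 2 * (Real.exp (L x) - 1) := fun n =>
    ((hit n).volStep_aux hα hw hS hC hC0 hW (by positivity)).2
  have sA : ∀ s ∈ S, ∀ x, Summable fun n => (p n).1 s x := fun s hs x =>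
    Summable.of_norm_bounded (summable_half_pow_mul (Real.exp (L x))) fun n =>
      (hit n).bound_fst s hs x
  have sQ : ∀ s ∈ S, ∀ x, Summable fun n => (p n).2 s x := fun s hs x =>
    Summable.of_norm_bounded (summable_half_pow_mul (4 * C * h x * Real.exp (L x))) fun n => by
      simpa [mul_assoc] using (hit n).bound_snd s hs x
  have sumA : ∀ s ∈ S, ∀ x, volSumA α u₀ c w s x = 1 + ∑' n, (p (n + 1)).1 s x := by
    intro s hs x
    rw [volSumA, (sA s hs x).tsum_eq_zero_add]
    rfl
  have sumQ : ∀ s ∈ S, ∀ x, volSumQ α u₀ c w s x = ∑' n, (p (n + 1)).2 s x := by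
    intro s hs x
    rw [volSumQ, (sQ s hs x).tsum_eq_zero_add]
    simp [volIter, hp]
  have hlinA : ∀ s ∈ S, ∀ x, ∑' n, volA α u₀ c w s x ((p n).1 s x) ((p n).2 s x) =
      volA α u₀ c w s x (volSumA α u₀ c w s x) (volSumQ α u₀ c w s x) := by
    intro s hs x
    have h1 := (sA s hs x).hasSum
    have h2 := (sQ s hs x).hasSum
    exact (((h2.mul_left c).add ((h2.sub (h1.mul_left (conj c))).mul_left (w x - c))).mul_left
      (Complex.I * kap α u₀ s)).tsum_eq
  have hlinQ : ∀ s ∈ S, ∀ x, HasSum (fun n => volQ α u₀ c w s x ((p n).1 s x) ((p n).2 s x))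
      (volQ α u₀ c w s x (volSumA α u₀ c w s x) (volSumQ α u₀ c w s x)) := by
    intro s hs x
    have h1 := (sA s hs x).hasSum
    have h2 := (sQ s hs x).hasSum
    exact ((h1.mul_left (s * conj (w x - c))).add
      ((h2.sub (h1.mul_left (conj c))).mul_left (conj c * (w x - c)))).mul_left
        (Complex.I * kap α u₀ s)
  refine ⟨fun s hs x => ?_, fun s hs x => ?_, fun s hs => ?_, fun s hs => ?_, fun x => ?_,
    fun x => ?_, fun x => ?_, fun x => ?_⟩
  · obtain ⟨K, hK⟩ := (isCompact_Icc (a := x - 1) (b := x + 1)).exists_bound_of_continuousOn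
      (f := fun y => 1 / 4 *
      (Real.exp (L y) * (4 * C * (4 * C * h y + ‖w y - c‖ * (4 * C * h y + 1)))))
      (by fun_prop)
    have hmem : x ∈ Ioo (x - 1) (x + 1) := ⟨by linarith, by linarith⟩
    have key := hasDerivAt_tsum_of_isPreconnected (g := fun n => (p (n + 1)).1 s)
      (g' := fun n y => volA α u₀ c w s y ((p n).1 s y) ((p n).2 s y))
      (summable_half_pow_mul K) isOpen_Ioo (isPreconnected_Ioo (a := x - 1) (b := x + 1))
      (fun n y _ => (hst n s hs y).1)
      (fun n y hy => by
        refine ((hit n).norm_volA_le hC hC0 hs y).trans ?_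
        rw [div_eq_mul_one_div, mul_assoc]
        refine mul_le_mul_of_nonneg_left ?_ (by positivity)
        exact (le_abs_self _).trans (hK y (Ioo_subset_Icc_self hy)))
      hmem ((summable_nat_add_iff 1).2 (sA s hs x)) hmem
    rw [hlinA s hs x] at key
    refine (key.const_add 1).congr_of_eventuallyEq (Eventually.of_forall fun y => ?_)
    exact sumA s hs y
  · obtain ⟨K, hK⟩ := (isCompact_Icc (a := x - 1) (b := x + 1)).exists_bound_of_continuousOn
      (f := fun y => ‖omg α u₀ s‖ * (1 / 2 * (4 * C * h y) * Real.exp (L y)) +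
        2 * C * (‖w y - c‖ * Real.exp (L y) + h y *
      (Real.exp (L y) * (4 * C * (4 * C * h y + ‖w y - c‖ * (4 * C * h y + 1))))))
      (by fun_prop)
    have hmem : x ∈ Ioo (x - 1) (x + 1) := ⟨by linarith, by linarith⟩
    have key := hasDerivAt_tsum_of_isPreconnected (g := fun n => (p (n + 1)).2 s)
      (g' := fun n y => Complex.I * omg α u₀ s * (p (n + 1)).2 s y +
          volQ α u₀ c w s y ((p n).1 s y) ((p n).2 s y))
      (summable_half_pow_mul K) isOpen_Ioo (isPreconnected_Ioo (a := x - 1) (b := x + 1))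
      (fun n y _ => (hst n s hs y).2.1)
      (fun n y hy => by
        have h1 := (hit n).norm_volQ_le hC hC0 hW (by positivity) hs y
        have h2 := (hit (n + 1)).bound_snd s hs y
        have h3 := (le_abs_self _).trans (hK y (Ioo_subset_Icc_self hy))
        refine (norm_add_le _ _).trans ?_
        rw [norm_mul, norm_mul, Complex.norm_I, one_mul]
        calc _ ≤ ‖omg α u₀ s‖ * ((1 / 2) ^ (n + 1) * (4 * C * h y) * Real.exp (L y)) + _ :=
              add_le_add (mul_le_mul_of_nonneg_left h2 (norm_nonneg _)) h1
          _ = (1 / 2) ^ n * (‖omg α u₀ s‖ * (1 / 2 * (4 * C * h y) * Real.exp (L y)) +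
                2 * C * (‖w y - c‖ * Real.exp (L y) + h y * (Real.exp (L y) *
                (4 * C * (4 * C * h y + ‖w y - c‖ * (4 * C * h y + 1)))))) := by ring
          _ ≤ _ := mul_le_mul_of_nonneg_left h3 (by positivity))
      hmem ((summable_nat_add_iff 1).2 (sQ s hs x)) hmem
    rw [(((((summable_nat_add_iff 1).2 (sQ s hs x)).hasSum).mul_left _).add
      (hlinQ s hs x)).tsum_eq, ← sumQ s hs x] at key
    refine key.congr_of_eventuallyEq (Eventually.of_forall fun y => ?_)
    exact sumQ s hs y
  · rw [tendsto_iff_norm_sub_tendsto_zero]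
    have t1 : Tendsto (fun x => Real.exp (L x) - 1) atBot (𝓝 0) := by
      simpa using ((Real.continuous_exp.tendsto 0).comp hW.L_lim).sub_const 1
    refine squeeze_zero (fun _ => norm_nonneg _) (fun x => ?_) t1
    rw [sumA s hs x, add_sub_cancel_left]
    refine tsum_of_norm_bounded (g := fun n : ℕ => (1 / 2) ^ n / 2 * (Real.exp (L x) - 1)) ?_
      fun n => (hst n s hs x).2.2
    have := ((hasSum_geometric_two).div_const 2).mul_right (Real.exp (L x) - 1)
    simpa using this
  · rw [tendsto_iff_norm_sub_tendsto_zero]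
    have t1 : Tendsto (fun x => 2 * ((4 * C * h x) * Real.exp (L x))) atBot (𝓝 0) := by
      simpa using (((hW.h_lim.const_mul (4 * C))).mul
        ((Real.continuous_exp.tendsto 0).comp hW.L_lim)).const_mul 2
    refine squeeze_zero (fun _ => norm_nonneg _) (fun x => ?_) t1
    rw [sub_zero]
    refine tsum_of_norm_bounded (g := fun n : ℕ => (1 / 2) ^ n * ((4 * C * h x) * Real.exp (L x)))
      (hasSum_geometric_two.mul_right _) fun n => ?_
    simpa [mul_assoc] using (hit n).bound_snd s hs x
  · exact continuousOn_tsum (fun n => (hit n).contOn_fst x)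
      (summable_half_pow_mul (Real.exp (L x))) fun n s hs => (hit n).bound_fst s hs x
  · exact continuousOn_tsum (fun n => (hit n).contOn_snd x)
      (summable_half_pow_mul (4 * C * h x * Real.exp (L x))) fun n s hs => by
        simpa [mul_assoc] using (hit n).bound_snd s hs x
  · exact Complex.differentiableOn_tsum_of_summable_norm
      (summable_half_pow_mul (Real.exp (L x))) (fun n => (hit n).hol_fst x) isOpen_interior
      fun n s hs => (hit n).bound_fst s (interior_subset hs) x
  · exact Complex.differentiableOn_tsum_of_summable_norm
      (summable_half_pow_mul (4 * C * h x * Real.exp (L x))) (fun n => (hit n).hol_snd x)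
      isOpen_interior fun n s hs => by
        simpa [mul_assoc] using (hit n).bound_snd s (interior_subset hs) x

/-- Existence of the left Jost solution on the closed upper half-plane of the variable `s`. -/
theorem exists_isJostPair_atBot {α u₀ : ℝ} {c : ℂ} {w : ℝ → ℂ} (hα : 0 < α) (hc : ‖c‖ = u₀)
    (hw : Continuous w) (hi : IntegrableOn (fun x => (1 + |x|) * ‖w x - c‖) (Iic 0)) :
    ∃ a e, IsJostPair α u₀ c w atBot upperH a e := by
  -- `volC` is unbounded on `upperH`, so the series is controlled only locally. Off the real axis
  -- the sets `S` are full neighbourhoods, as holomorphy requires; on the axis they are relative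
  -- ones, which suffice for continuity.
  have key : ∀ s₀ ∈ upperH, ∃ S, S ⊆ upperH ∧ s₀ ∈ S ∧ S ∈ 𝓝[upperH] s₀ ∧
      (s₀.im ≠ 0 → S ∈ 𝓝 s₀) ∧ ∃ C, 0 ≤ C ∧ ∀ s ∈ S, volC α u₀ c s ≤ C := by
    intro s₀ hs₀
    have hcont : ContinuousAt (volC α u₀ c) s₀ := by
      have := (continuousOn_kap α u₀ hα).continuousAt (isOpen_compl_singleton.mem_nhds hs₀.2)
      unfold volC
      fun_prop
    have hev := hcont.eventually_le_const (lt_add_one (volC α u₀ c s₀))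
    refine ⟨{s | volC α u₀ c s ≤ volC α u₀ c s₀ + 1} ∩ upperH, inter_subset_right, ⟨?_, hs₀⟩,
      inter_mem (nhdsWithin_le_nhds hev) self_mem_nhdsWithin, fun him => inter_mem hev ?_,
      volC α u₀ c s₀ + 1, ?_, fun s hs => hs.1⟩
    · simp
    · filter_upwards [(isOpen_lt continuous_const Complex.continuous_im).mem_nhds
        (lt_of_le_of_ne hs₀.1 (Ne.symm him)), isOpen_compl_singleton.mem_nhds hs₀.2] with s h1 h2
      exact ⟨le_of_lt h1, h2⟩
    · unfold volC
      positivity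
  have hcc : conj c * c = (u₀ : ℂ) ^ 2 := by
    rw [mul_comm, Complex.mul_conj, Complex.normSq_eq_norm_sq, hc]; push_cast; rfl
  refine ⟨volSumA α u₀ c w, fun s x => volSumQ α u₀ c w s x - conj c * volSumA α u₀ c w s x,
    fun s hs x => ?_, fun s hs x => ?_, fun s hs => ?_, fun s hs => ?_, fun x s hs => ?_,
    fun x s hs => ?_, fun x s hs him => ?_, fun x s hs him => ?_⟩ <;>
  obtain ⟨S, hSu, hs₀S, hSn, hSi, C, hC0, hC⟩ := key s hs <;>
  obtain ⟨d1, d2, t1, t2, c1, c2, o1, o2⟩ := volSum_spec hα hw hi hSu hC hC0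
  · refine (d1 s hs₀S x).congr_deriv ?_
    rw [volA]
    linear_combination (Complex.I * kap α u₀ s * volSumA α u₀ c w s x) * hcc
  · refine ((d2 s hs₀S x).sub ((d1 s hs₀S x).const_mul (conj c))).congr_deriv ?_
    rw [volA, volQ, ← kap_mul_add α u₀ hs.2, map_sub]
    linear_combination (Complex.I * kap α u₀ s * (-volSumQ α u₀ c w s x)) * hcc
  · exact t1 s hs₀S
  · simpa using (t2 s hs₀S).sub ((t1 s hs₀S).const_mul (conj c))
  · exact (c1 x s hs₀S).mono_of_mem_nhdsWithin hSn
  · exact ((c2 x s hs₀S).sub ((c1 x s hs₀S).const_smul (conj c))).mono_of_mem_nhdsWithin hSn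
  · exact (o1 x).differentiableAt (isOpen_interior.mem_nhds (mem_interior_iff_mem_nhds.2 (hSi him)))
  · have hm := isOpen_interior.mem_nhds (mem_interior_iff_mem_nhds.2 (hSi him))
    exact ((o2 x).differentiableAt hm).sub (((o1 x).differentiableAt hm).const_mul _)

/-- Reflection `x ↦ -x` combined with conjugation interchanges left and right solutions. -/
theorem IsJostPair.reflect {α u₀ : ℝ} {c : ℂ} {w : ℝ → ℂ} {a e : ℂ → ℝ → ℂ} {l l' : Filter ℝ}
    {H H' : Set ℂ} (h : IsJostPair α u₀ (conj c) (fun x => conj (w (-x))) l H a e)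
    (hl : Tendsto Neg.neg l' l) (hm : ∀ s ∈ H', conj s ∈ H) :
    IsJostPair α u₀ c w l' H' (fun s x => conj (a (conj s) (-x)))
      (fun s x => conj (e (conj s) (-x))) := by
  have hk : ∀ s, conj (kap α u₀ (conj s)) = kap α u₀ s := fun s => by
    simp only [kap, map_div₀, map_sub, map_mul, map_pow, Complex.conj_conj, Complex.conj_ofReal,
      map_ofNat]
  have hd : ∀ {f : ℝ → ℂ} {f' : ℂ} {x : ℝ}, HasDerivAt f f' (-x) →
      HasDerivAt (fun x => conj (f (-x))) (-conj f') x := by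
    intro f f' x hf
    have h1 := hf.scomp x (hasDerivAt_neg x)
    have h2 := (Complex.conjCLE.toContinuousLinearMap.hasFDerivAt.comp_hasDerivAt x h1)
    simpa [Function.comp_def] using h2
  refine ⟨fun s hs x => ?_, fun s hs x => ?_, fun s hs => ?_, fun s hs => ?_, fun x => ?_,
    fun x => ?_, fun x s hs him => ?_, fun x s hs him => ?_⟩
  · refine (hd (h.deriv_fst _ (hm s hs) (-x))).congr_deriv ?_
    simp [hk]
  · refine (hd (h.deriv_snd _ (hm s hs) (-x))).congr_deriv ?_
    simp [hk]
  · simpa [Function.comp_def] using (Complex.continuous_conj.tendsto _).comp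
      ((h.tendsto_fst _ (hm s hs)).comp hl)
  · simpa [Function.comp_def] using (Complex.continuous_conj.tendsto _).comp
      ((h.tendsto_snd _ (hm s hs)).comp hl)
  · exact Complex.continuous_conj.comp_continuousOn
      ((h.cont_fst (-x)).comp Complex.continuous_conj.continuousOn hm)
  · exact Complex.continuous_conj.comp_continuousOn
      ((h.cont_snd (-x)).comp Complex.continuous_conj.continuousOn hm)
  · exact differentiableAt_conj_conj_iff.2 (h.hol_fst (-x) _ (hm s hs) (by simpa using him))
  · exact differentiableAt_conj_conj_iff.2 (h.hol_snd (-x) _ (hm s hs) (by simpa using him))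

theorem exists_isJostPair_atTop {α u₀ : ℝ} {c : ℂ} {w : ℝ → ℂ} (hα : 0 < α) (hc : ‖c‖ = u₀)
    (hw : Continuous w) (hi : IntegrableOn (fun x => (1 + |x|) * ‖w x - c‖) (Ici 0)) :
    ∃ a e, IsJostPair α u₀ c w atTop lowerH a e := by
  obtain ⟨a, e, h⟩ := exists_isJostPair_atBot (α := α) (u₀ := u₀) (c := conj c)
    (w := fun x => conj (w (-x))) hα (by simpa using hc)
    (Complex.continuous_conj.comp (hw.comp continuous_neg)) (by
      have := hi.comp_neg
      simpa [← map_sub] using this)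
  exact ⟨_, _, h.reflect tendsto_neg_atTop_atBot fun s hs =>
    ⟨by simpa using hs.1, by simpa using hs.2⟩⟩

end MNLS
end

noncomputable section
namespace MNLS

open Set Filter Topology MeasureTheory

/-! ### Asymptotics for a large spectral parameter -/

/-- Grönwall's inequality on a left half-line. -/
theorem le_mul_exp_of_le_integral_Iic {m g : ℝ → ℝ} {A C X K : ℝ} (hm : Continuous m)
    (hg : Continuous g) (hg0 : ∀ x, 0 ≤ g x) (hgi : IntegrableOn g (Iic X)) (hC : 0 ≤ C)
    (hmK : ∀ x ≤ X, |m x| ≤ K) (h : ∀ x ≤ X, m x ≤ A + C * ∫ y in Iic x, g y * m y) {x : ℝ}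
    (hx : x ≤ X) : m x ≤ A * Real.exp (C * ∫ y in Iic x, g y) := by
  have hgi' := integrableOn_Iic_of_continuous hg hgi
  have hgm : ∀ x, IntegrableOn (fun y => g y * m y) (Iic x) := by
    refine integrableOn_Iic_of_continuous (hg.mul hm) (b := X)
      ((hgi.mul_const K).mono' (hg.mul hm).aestronglyMeasurable ?_)
    filter_upwards [ae_restrict_mem measurableSet_Iic] with y hy
    rw [norm_mul, Real.norm_of_nonneg (hg0 y)]
    exact mul_le_mul_of_nonneg_left (hmK y hy) (hg0 y)
  have dG := hasDerivAt_integral_Iic hg hgi'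
  have dJ := hasDerivAt_integral_Iic (hg.mul hm) hgm
  set G : ℝ → ℝ := fun x => ∫ y in Iic x, g y with hG
  set J : ℝ → ℝ := fun x => ∫ y in Iic x, g y * m y with hJ
  -- The integrating factor makes `Φ` antitone, with limit `A` at `-∞`; hence `Φ ≤ A`.
  set Φ : ℝ → ℝ := fun x => (A + C * J x) * Real.exp (-(C * G x)) with hΦ
  have dΦ : ∀ x, HasDerivAt Φ (C * g x * (m x - (A + C * J x)) * Real.exp (-(C * G x))) x := by
    intro x
    have dJ' : HasDerivAt J (g x * m x) x := dJ x
    have dG' : HasDerivAt (fun x => -(C * G x)) (-(C * g x)) x := ((dG x).const_mul C).neg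
    exact (((dJ'.const_mul C).const_add A).mul dG'.exp).congr_deriv (by ring)
  have hanti : AntitoneOn Φ (Iic X) := by
    refine antitoneOn_of_deriv_nonpos (convex_Iic X)
      (fun y _ => (dΦ y).continuousAt.continuousWithinAt)
      (fun y _ => (dΦ y).differentiableAt.differentiableWithinAt) fun y hy => ?_
    rw [interior_Iic] at hy
    rw [(dΦ y).deriv]
    have h1 := h y (le_of_lt hy)
    have h2 : m y - (A + C * J y) ≤ 0 := by simp only [hJ]; linarith
    exact mul_nonpos_of_nonpos_of_nonneg
      (mul_nonpos_of_nonneg_of_nonpos (mul_nonneg hC (hg0 y)) h2) (Real.exp_pos _).le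
  have hlim : Tendsto Φ atBot (𝓝 A) := by
    have t1 : Tendsto J atBot (𝓝 0) := tendsto_integral_Iic_zero tendsto_id
    have t2 : Tendsto G atBot (𝓝 0) := tendsto_integral_Iic_zero tendsto_id
    have := ((t1.const_mul C).const_add A).mul
      ((Real.continuous_exp.tendsto _).comp (t2.const_mul C).neg)
    simpa using this
  have hΦA : Φ x ≤ A := by
    refine ge_of_tendsto hlim ?_
    filter_upwards [eventually_le_atBot x] with y hy
    exact hanti (hy.trans hx) hx hy
  have := h x hx
  have e : A + C * J x = Φ x * Real.exp (C * G x) := by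
    simp only [hΦ]
    rw [mul_assoc, ← Real.exp_add]
    simp
  calc m x ≤ A + C * J x := this
    _ = Φ x * Real.exp (C * G x) := e
    _ ≤ A * Real.exp (C * G x) := mul_le_mul_of_nonneg_right hΦA (Real.exp_pos _).le

theorem exists_norm_le_Iic_of_tendsto {E : Type*} [NormedAddCommGroup E] {f : ℝ → E}
    (hf : Continuous f) {m : E} (hm : Tendsto f atBot (𝓝 m)) (X : ℝ) :
    ∃ K, 0 ≤ K ∧ ∀ x ≤ X, ‖f x‖ ≤ K := by
  have h1 : ∀ᶠ x in atBot, ‖f x‖ ≤ ‖m‖ + 1 := hm.norm.eventually_le_const (lt_add_one _)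
  obtain ⟨b, hb⟩ := eventually_atBot.1 h1
  obtain ⟨K, hK⟩ := (isCompact_Icc (a := b) (b := X)).exists_bound_of_continuousOn hf.continuousOn
  refine ⟨max (‖m‖ + 1) K, le_max_of_le_left (by positivity), fun x hx => ?_⟩
  rcases le_total x b with h | h
  · exact (hb x h).trans (le_max_left _ _)
  · exact (hK x ⟨h, hx⟩).trans (le_max_right _ _)

/-- The class of potentials at a fixed time, near `-∞`. -/
structure IsLeftPotential (u₀ : ℝ) (c : ℂ) (w w' : ℝ → ℂ) : Prop where
  norm_lim : ‖c‖ = u₀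
  deriv : ∀ x, HasDerivAt w (w' x) x
  cont_deriv : Continuous w'
  lim : Tendsto w atBot (𝓝 c)
  integrable : IntegrableOn (fun x => (1 + |x|) * ‖w x - c‖) (Iic 0)
  integrable_deriv : IntegrableOn w' (Iic 0)

/-- The phase `(1/2α) ∫_{-∞}^x (u₀² - |w|²)`. -/
def phase (α u₀ : ℝ) (w : ℝ → ℂ) (x : ℝ) : ℝ := 1 / (2 * α) * ∫ y in Iic x, (u₀ ^ 2 - ‖w y‖ ^ 2)

section Asymptotics

variable {α u₀ : ℝ} {c : ℂ} {w w' : ℝ → ℂ} {a e : ℂ → ℝ → ℂ}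

theorem IsLeftPotential.continuous (hw : IsLeftPotential u₀ c w w') : Continuous w :=
  continuous_iff_continuousAt.2 fun x => (hw.deriv x).continuousAt

theorem IsLeftPotential.integrable_defect (hw : IsLeftPotential u₀ c w w') (x : ℝ) :
    IntegrableOn (fun y => u₀ ^ 2 - ‖w y‖ ^ 2) (Iic x) := by
  have hc := hw.continuous
  obtain ⟨K, hK0, hK⟩ := exists_norm_le_Iic_of_tendsto hc hw.lim 0
  refine integrableOn_Iic_of_continuous (by fun_prop) (b := 0)
    ((hw.integrable.mul_const (‖c‖ + K)).mono'
      (Continuous.aestronglyMeasurable (by fun_prop)) ?_) x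
  filter_upwards [ae_restrict_mem measurableSet_Iic] with y hy
  have h1 : |‖c‖ - ‖w y‖| ≤ ‖w y - c‖ := by
    rw [norm_sub_rev]; exact abs_norm_sub_norm_le _ _
  have h2 : u₀ ^ 2 - ‖w y‖ ^ 2 = (‖c‖ - ‖w y‖) * (‖c‖ + ‖w y‖) := by rw [hw.norm_lim]; ring
  rw [h2, norm_mul, Real.norm_eq_abs, Real.norm_of_nonneg (by positivity)]
  refine mul_le_mul ?_ (by linarith [hK y hy]) (by positivity) (by positivity)
  have := abs_nonneg y
  nlinarith [norm_nonneg (w y - c)]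

theorem hasDerivAt_conj {f : ℝ → ℂ} {f' : ℂ} {x : ℝ} (hf : HasDerivAt f f' x) :
    HasDerivAt (fun x => conj (f x)) (conj f') x := by
  simpa [Function.comp_def] using
    Complex.conjCLE.toContinuousLinearMap.hasFDerivAt.comp_hasDerivAt x hf

/-- This combination is the component along the eigenvalue `0` at the current value of `w`, up to a
scalar factor: the non-integrable term `iκ w e` cancels, leaving only the defect `u₀² - |w|²` and
`w'`, integrable with bounds uniform for large `s`. -/
theorem IsJostPair.hasDerivAt_sub (h : IsJostPair α u₀ c w atBot upperH a e)
    (hw : IsLeftPotential u₀ c w w') {s : ℂ} (hs : s ∈ upperH) (x : ℝ) :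
    HasDerivAt (fun x => a s x - w x * e s x / s)
      (Complex.I * kap α u₀ s * ((u₀ : ℂ) ^ 2 - w x * conj (w x)) * a s x - w' x * e s x / s) x := by
  refine ((h.deriv_fst s hs x).sub (((hw.deriv x).mul (h.deriv_snd s hs x)).div_const s)).congr_deriv ?_
  have := hs.2
  field_simp
  ring

/-- The companion of `hasDerivAt_sub`: this combination evolves with the eigenvalue `iω`, up to the
same integrable terms. -/
theorem IsJostPair.hasDerivAt_add (h : IsJostPair α u₀ c w atBot upperH a e)
    (hw : IsLeftPotential u₀ c w w') {s : ℂ} (hs : s ∈ upperH) (x : ℝ) :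
    HasDerivAt (fun x => e s x + conj (w x) * a s x)
      (Complex.I * omg α u₀ s * (e s x + conj (w x) * a s x) +
        (-(Complex.I * kap α u₀ s * ((u₀ : ℂ) ^ 2 - w x * conj (w x)) * e s x)
          + conj (w' x) * a s x)) x := by
  refine ((h.deriv_snd s hs x).add ((hasDerivAt_conj (hw.deriv x)).mul
    (h.deriv_fst s hs x))).congr_deriv ?_
  rw [← kap_mul_add α u₀ hs.2]
  ring

theorem IsJostPair.continuous_fst {l : Filter ℝ} {H : Set ℂ} (h : IsJostPair α u₀ c w l H a e)
    {s : ℂ} (hs : s ∈ H) : Continuous (a s) :=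
  continuous_iff_continuousAt.2 fun x => (h.deriv_fst s hs x).continuousAt

theorem IsJostPair.continuous_snd {l : Filter ℝ} {H : Set ℂ} (h : IsJostPair α u₀ c w l H a e)
    {s : ℂ} (hs : s ∈ H) : Continuous (e s) :=
  continuous_iff_continuousAt.2 fun x => (h.deriv_snd s hs x).continuousAt

theorem norm_kap_le (hα : 0 < α) {s : ℂ} (hs : 1 + u₀ ^ 2 ≤ ‖s‖) : ‖kap α u₀ s‖ ≤ 1 / α := by
  have hs0 : 0 < ‖s‖ := by nlinarith [sq_nonneg u₀]
  rw [kap, norm_div, norm_mul, norm_mul, Complex.norm_real, Real.norm_of_nonneg hα.le,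
    Complex.norm_ofNat, div_le_div_iff₀ (by positivity) hα]
  have : ‖s - (u₀ : ℂ) ^ 2‖ ≤ ‖s‖ + u₀ ^ 2 := by
    refine (norm_sub_le _ _).trans ?_
    simp
  nlinarith

/-- Variation of constants for the decaying component. -/
theorem IsJostPair.add_eq_integral (hα : 0 < α) (h : IsJostPair α u₀ c w atBot upperH a e)
    (hw : IsLeftPotential u₀ c w w') {s : ℂ} (hs : s ∈ upperH) (x : ℝ) :
    e s x + conj (w x) * a s x = ∫ y in Iic x, Complex.exp (Complex.I * omg α u₀ s * (x - y)) *
      (-(Complex.I * kap α u₀ s * ((u₀ : ℂ) ^ 2 - w y * conj (w y)) * e s y)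
          + conj (w' y) * a s y) := by
  have ca := h.continuous_fst hs
  have ce := h.continuous_snd hs
  have cw := hw.continuous
  have cw' := hw.cont_deriv
  have ccw := Complex.continuous_conj.comp cw
  have ccw' := Complex.continuous_conj.comp cw'
  simp only [Function.comp_def] at ccw ccw'
  obtain ⟨Ka, hKa0, hKa⟩ := exists_norm_le_Iic_of_tendsto ca (h.tendsto_fst s hs) x
  obtain ⟨Ke, hKe0, hKe⟩ := exists_norm_le_Iic_of_tendsto ce (h.tendsto_snd s hs) x
  set F : ℝ → ℂ := fun y => -(Complex.I * kap α u₀ s * ((u₀ : ℂ) ^ 2 - w y * conj (w y)) * e s y)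
          + conj (w' y) * a s y with hF
  have d : ∀ y ∈ Iic x, HasDerivAt
      (fun y : ℝ => Complex.exp (Complex.I * omg α u₀ s * (x - y)) * (e s y + conj (w y) * a s y))
      (Complex.exp (Complex.I * omg α u₀ s * (x - y)) * F y) y := by
    intro y _
    have d1 : HasDerivAt (fun y : ℝ => Complex.I * omg α u₀ s * (x - y))
        (-(Complex.I * omg α u₀ s)) y := by
      simpa using ((Complex.ofRealCLM.hasDerivAt (x := y)).const_sub (x : ℂ)).const_mul
        (Complex.I * omg α u₀ s)
    refine (d1.cexp.mul (h.hasDerivAt_add hw hs y)).congr_deriv ?_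
    simp only [hF]
    ring
  have hFi : IntegrableOn (fun y : ℝ => Complex.exp (Complex.I * omg α u₀ s * (x - y)) * F y)
      (Iic x) := by
    have i1 := ((hw.integrable_defect x).norm.const_mul (‖kap α u₀ s‖ * Ke)).add
      ((integrableOn_Iic_of_continuous cw' hw.integrable_deriv x).norm.mul_const Ka)
    refine i1.mono' (Continuous.aestronglyMeasurable (by fun_prop)) ?_
    filter_upwards [ae_restrict_mem measurableSet_Iic] with y hy
    rw [norm_mul]
    refine (mul_le_of_le_one_left (norm_nonneg _) (norm_exp_omg_le hα hs hy)).trans ?_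
    have e1 : ‖(u₀ : ℂ) ^ 2 - w y * conj (w y)‖ = ‖u₀ ^ 2 - ‖w y‖ ^ 2‖ := by
      rw [Complex.mul_conj, Complex.normSq_eq_norm_sq, ← Complex.norm_real]
      push_cast
      rfl
    simp only [hF, Pi.add_apply]
    refine (norm_add_le _ _).trans ?_
    rw [norm_neg, norm_mul, norm_mul, norm_mul, norm_mul, Complex.norm_I, one_mul, e1,
      RCLike.norm_conj]
    have := hKa y hy
    have := hKe y hy
    calc _ ≤ ‖kap α u₀ s‖ * ‖u₀ ^ 2 - ‖w y‖ ^ 2‖ * Ke + ‖w' y‖ * Ka := by gcongr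
      _ = _ := by ring
  have t : Tendsto (fun y : ℝ => Complex.exp (Complex.I * omg α u₀ s * (x - y)) *
      (e s y + conj (w y) * a s y)) atBot (𝓝 0) := by
    have t1 : Tendsto (fun y => e s y + conj (w y) * a s y) atBot (𝓝 0) := by
      have := (h.tendsto_snd s hs).add
        (((Complex.continuous_conj.tendsto _).comp hw.lim).mul (h.tendsto_fst s hs))
      simpa using this
    refine squeeze_zero_norm' ?_ (tendsto_zero_iff_norm_tendsto_zero.1 t1)
    filter_upwards [eventually_le_atBot x] with y hy
    rw [norm_mul]
    exact mul_le_of_le_one_left (norm_nonneg _) (norm_exp_omg_le hα hs hy)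
  have := integral_Iic_of_hasDerivAt_of_tendsto' d hFi t
  rw [this]
  simp

/-- Uniform boundedness of the Jost solution for large `s`. -/
theorem IsJostPair.exists_bound (hα : 0 < α) (h : IsJostPair α u₀ c w atBot upperH a e)
    (hw : IsLeftPotential u₀ c w w') (X : ℝ) :
    ∃ M R : ℝ, 0 ≤ M ∧ 1 + u₀ ^ 2 ≤ R ∧ ∀ s ∈ upperH, R ≤ ‖s‖ → ∀ x ≤ X,
      ‖a s x‖ ≤ M ∧ ‖e s x‖ ≤ M := by
  have cw := hw.continuous
  have cw' := hw.cont_deriv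
  obtain ⟨B, hB0, hB⟩ := exists_norm_le_Iic_of_tendsto cw hw.lim X
  set g : ℝ → ℝ := fun y => ‖u₀ ^ 2 - ‖w y‖ ^ 2‖ + ‖w' y‖ with hg
  have cg : Continuous g := by fun_prop
  have hg0 : ∀ y, 0 ≤ g y := fun y => by positivity
  have hgi : ∀ x, IntegrableOn g (Iic x) := fun x =>
    (hw.integrable_defect x).norm.add (integrableOn_Iic_of_continuous cw' hw.integrable_deriv x).norm
  have hδ : ∀ y, ‖(u₀ : ℂ) ^ 2 - w y * conj (w y)‖ = ‖u₀ ^ 2 - ‖w y‖ ^ 2‖ := by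
    intro y
    rw [Complex.mul_conj, Complex.normSq_eq_norm_sq, ← Complex.norm_real]
    push_cast
    rfl
  -- `R` keeps the determinant `1 + |w|²/s` of the change from `(a, e)` to `(p, Q)` at least `1/2`
  -- in modulus, and `C1` then bounds the inverse. `C2` is doubled because `p` and `Q` each
  -- contribute `C2 / 2` to the integral inequality.
  set R := 1 + u₀ ^ 2 + 2 * B ^ 2 with hR
  set C1 := 2 * (1 + B) with hC1
  set C2 := 2 * ((1 / α + 1) * C1) with hC2
  have hC2n : 0 ≤ C2 := by positivity
  set G := ∫ y in Iic X, g y with hG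
  refine ⟨C1 * (2 * Real.exp (C2 * G)), R, by positivity, by simp only [hR]; nlinarith, ?_⟩
  intro s hs hsR
  have hs1 : 1 + u₀ ^ 2 ≤ ‖s‖ := by simp only [hR] at hsR; nlinarith [sq_nonneg B]
  have hs1' : 1 ≤ ‖s‖ := by nlinarith [sq_nonneg u₀]
  have hs0 := hs.2
  have ca := h.continuous_fst hs
  have ce := h.continuous_snd hs
  have hk := norm_kap_le (u₀ := u₀) hα hs1
  set p : ℝ → ℂ := fun x => a s x - w x * e s x / s with hp
  set Q : ℝ → ℂ := fun x => e s x + conj (w x) * a s x with hQ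
  have cp : Continuous p := by fun_prop
  have cQ : Continuous Q := by
    have := Complex.continuous_conj.comp cw
    simp only [Function.comp_def] at this
    fun_prop
  have tp : Tendsto p atBot (𝓝 (1 - c * -conj c / s)) :=
    (h.tendsto_fst s hs).sub ((hw.lim.mul (h.tendsto_snd s hs)).div_const s)
  have tQ : Tendsto Q atBot (𝓝 0) := by
    have := (h.tendsto_snd s hs).add
      (((Complex.continuous_conj.tendsto _).comp hw.lim).mul (h.tendsto_fst s hs))
    simpa using this
  obtain ⟨Kp, -, hKp⟩ := exists_norm_le_Iic_of_tendsto cp tp X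
  obtain ⟨KQ, -, hKQ⟩ := exists_norm_le_Iic_of_tendsto cQ tQ X
  -- reconstruction of `a` and `e`
  have hD : ∀ x ≤ X, 1 / 2 ≤ ‖1 + w x * conj (w x) / s‖ := by
    intro x hx
    have h1 : ‖w x * conj (w x) / s‖ ≤ 1 / 2 := by
      rw [norm_div, norm_mul, RCLike.norm_conj, div_le_iff₀ (by linarith)]
      have := hB x hx
      have := norm_nonneg (w x)
      simp only [hR] at hsR
      nlinarith [sq_nonneg u₀]
    have h2 := norm_sub_norm_le (1 : ℂ) (-(w x * conj (w x) / s))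
    rw [norm_one, norm_neg, sub_neg_eq_add] at h2
    linarith
  have ha : ∀ x ≤ X, ‖a s x‖ ≤ C1 * (‖p x‖ + ‖Q x‖) := by
    intro x hx
    have e1 : (1 + w x * conj (w x) / s) * a s x = p x + w x * Q x / s := by
      simp only [hp, hQ]; ring
    have h1 : ‖p x + w x * Q x / s‖ ≤ ‖p x‖ + B * ‖Q x‖ := by
      refine (norm_add_le _ _).trans ?_
      rw [norm_div, norm_mul]
      gcongr
      refine (div_le_self (by positivity) hs1').trans ?_
      gcongr
      exact hB x hx
    rw [← e1, norm_mul] at h1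
    have h2 := mul_le_mul_of_nonneg_right (hD x hx) (norm_nonneg (a s x))
    simp only [hC1]
    nlinarith [norm_nonneg (p x), norm_nonneg (Q x), mul_nonneg hB0 (norm_nonneg (p x))]
  have he : ∀ x ≤ X, ‖e s x‖ ≤ C1 * (‖p x‖ + ‖Q x‖) := by
    intro x hx
    have e1 : (1 + w x * conj (w x) / s) * e s x = Q x - conj (w x) * p x := by
      simp only [hp, hQ]; ring
    have h1 : ‖Q x - conj (w x) * p x‖ ≤ ‖Q x‖ + B * ‖p x‖ := by
      refine (norm_sub_le _ _).trans ?_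
      rw [norm_mul, RCLike.norm_conj]
      gcongr
      exact hB x hx
    rw [← e1, norm_mul] at h1
    have h2 := mul_le_mul_of_nonneg_right (hD x hx) (norm_nonneg (e s x))
    simp only [hC1]
    nlinarith [norm_nonneg (p x), norm_nonneg (Q x), mul_nonneg hB0 (norm_nonneg (Q x))]
  set m : ℝ → ℝ := fun x => ‖p x‖ + ‖Q x‖ with hm
  have cm : Continuous m := by fun_prop
  have hm0 : ∀ x, 0 ≤ m x := fun x => by positivity
  have gmi : ∀ x ≤ X, IntegrableOn (fun y => g y * m y) (Iic x) := by
    intro x hx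
    refine ((hgi x).mul_const (Kp + KQ)).mono' (cg.mul cm).aestronglyMeasurable ?_
    filter_upwards [ae_restrict_mem measurableSet_Iic] with y hy
    rw [norm_mul, Real.norm_of_nonneg (hg0 y), Real.norm_of_nonneg (hm0 y)]
    exact mul_le_mul_of_nonneg_left (add_le_add (hKp y (hy.out.trans hx)) (hKQ y (hy.out.trans hx))) (hg0 y)
  have hbp : ∀ y ≤ X, ‖Complex.I * kap α u₀ s * ((u₀ : ℂ) ^ 2 - w y * conj (w y)) * a s y
      - w' y * e s y / s‖ ≤ C2 / 2 * (g y * m y) := by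
    intro y hy
    refine (norm_sub_le _ _).trans ?_
    rw [norm_mul, norm_mul, norm_mul, norm_div, norm_mul, Complex.norm_I, one_mul, hδ]
    have h1 : ‖w' y‖ * ‖e s y‖ / ‖s‖ ≤ ‖w' y‖ * ‖e s y‖ := div_le_self (by positivity) hs1'
    have h2 := ha y hy
    have h3 := he y hy
    have h4 := hm0 y
    calc _ ≤ 1 / α * ‖u₀ ^ 2 - ‖w y‖ ^ 2‖ * (C1 * m y) + ‖w' y‖ * (C1 * m y) := by
          refine add_le_add (by gcongr) (h1.trans (by gcongr))
      _ ≤ 1 / α * ‖u₀ ^ 2 - ‖w y‖ ^ 2‖ * (C1 * m y) + ‖w' y‖ * (C1 * m y) +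
          (‖u₀ ^ 2 - ‖w y‖ ^ 2‖ * (C1 * m y) + 1 / α * ‖w' y‖ * (C1 * m y)) :=
          le_add_of_nonneg_right (by positivity)
      _ = _ := by simp only [hC2, hg]; ring
  have hbQ : ∀ y ≤ X, ‖-(Complex.I * kap α u₀ s * ((u₀ : ℂ) ^ 2 - w y * conj (w y)) * e s y)
          + conj (w' y) * a s y‖ ≤ C2 / 2 * (g y * m y) := by
    intro y hy
    refine (norm_add_le _ _).trans ?_
    rw [norm_neg, norm_mul, norm_mul, norm_mul, norm_mul, Complex.norm_I, one_mul, hδ,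
      RCLike.norm_conj]
    have h2 := ha y hy
    have h3 := he y hy
    have h4 := hm0 y
    calc _ ≤ 1 / α * ‖u₀ ^ 2 - ‖w y‖ ^ 2‖ * (C1 * m y) + ‖w' y‖ * (C1 * m y) := by
          gcongr
      _ ≤ 1 / α * ‖u₀ ^ 2 - ‖w y‖ ^ 2‖ * (C1 * m y) + ‖w' y‖ * (C1 * m y) +
          (‖u₀ ^ 2 - ‖w y‖ ^ 2‖ * (C1 * m y) + 1 / α * ‖w' y‖ * (C1 * m y)) :=
          le_add_of_nonneg_right (by positivity)
      _ = _ := by simp only [hC2, hg]; ring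
  have hineq : ∀ x ≤ X, m x ≤ 2 + C2 * ∫ y in Iic x, g y * m y := by
    intro x hx
    have i2 := (gmi x hx).const_mul (C2 / 2)
    have cF : Continuous fun y => Complex.I * kap α u₀ s * ((u₀ : ℂ) ^ 2 - w y * conj (w y)) * a s y
      - w' y * e s y / s := by
      have := Complex.continuous_conj.comp cw
      simp only [Function.comp_def] at this
      fun_prop
    have iF := Integrable.mono' i2 cF.aestronglyMeasurable
      ((ae_restrict_mem measurableSet_Iic).mono fun y hy => hbp y (le_trans hy hx))
    have e1 := integral_Iic_of_hasDerivAt_of_tendsto'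
      (fun y (_ : y ∈ Iic x) => h.hasDerivAt_sub hw hs y) iF tp
    have h1 : ‖p x‖ ≤ 2 + C2 / 2 * ∫ y in Iic x, g y * m y := by
      have hl : ‖1 - c * -conj c / s‖ ≤ 2 := by
        refine (norm_sub_le _ _).trans ?_
        rw [norm_one, norm_div, norm_mul, norm_neg, RCLike.norm_conj, hw.norm_lim]
        have : u₀ * u₀ / ‖s‖ ≤ 1 := by rw [div_le_one (by linarith)]; nlinarith
        linarith
      have e2 : p x = (1 - c * -conj c / s) + ∫ y in Iic x,
          (Complex.I * kap α u₀ s * ((u₀ : ℂ) ^ 2 - w y * conj (w y)) * a s y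
            - w' y * e s y / s) := by rw [e1]; ring
      rw [e2]
      refine (norm_add_le _ _).trans (add_le_add hl ?_)
      rw [← integral_const_mul]
      exact norm_integral_le_of_norm_le i2
        ((ae_restrict_mem measurableSet_Iic).mono fun y hy => hbp y (le_trans hy hx))
    have h2 : ‖Q x‖ ≤ C2 / 2 * ∫ y in Iic x, g y * m y := by
      simp only [hQ]
      rw [h.add_eq_integral hα hw hs x, ← integral_const_mul]
      refine norm_integral_le_of_norm_le i2
        ((ae_restrict_mem measurableSet_Iic).mono fun y hy => ?_)
      rw [norm_mul]
      exact (mul_le_of_le_one_left (norm_nonneg _) (norm_exp_omg_le hα hs hy)).trans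
        (hbQ y (le_trans hy hx))
    simp only [hm]
    linarith
  have hfin : ∀ x ≤ X, m x ≤ 2 * Real.exp (C2 * G) := by
    intro x hx
    have h1 := le_mul_exp_of_le_integral_Iic cm cg hg0 (hgi X) hC2n (K := Kp + KQ)
      (fun y hy => by
        rw [abs_of_nonneg (hm0 y)]
        exact add_le_add (hKp y hy) (hKQ y hy)) hineq hx
    refine h1.trans ?_
    gcongr
    exact setIntegral_mono_set (hgi X) (Eventually.of_forall hg0)
      (Iic_subset_Iic.2 hx).eventuallyLE
  intro x hx
  have hC1n : 0 ≤ C1 := by positivity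
  exact ⟨(ha x hx).trans (mul_le_mul_of_nonneg_left (hfin x hx) hC1n),
    (he x hx).trans (mul_le_mul_of_nonneg_left (hfin x hx) hC1n)⟩

end Asymptotics

end MNLS
end

/-! ### Limits as `s → ∞` and recovery of the potential -/

noncomputable section
namespace MNLS

open Set Filter Topology MeasureTheory

section Asymptotics

variable {α u₀ : ℝ} {c : ℂ} {w w' : ℝ → ℂ} {a e : ℂ → ℝ → ℂ}

theorem IsLeftPotential.hasDerivAt_phase (hw : IsLeftPotential u₀ c w w') (x : ℝ) :
    HasDerivAt (phase α u₀ w) (1 / (2 * α) * (u₀ ^ 2 - ‖w x‖ ^ 2)) x :=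
  (hasDerivAt_integral_Iic (by have := hw.continuous; fun_prop) hw.integrable_defect x).const_mul _

theorem ofReal_defect (w : ℂ) :
    (u₀ : ℂ) ^ 2 - w * conj w = ((u₀ ^ 2 - ‖w‖ ^ 2 : ℝ) : ℂ) := by
  rw [Complex.mul_conj, Complex.normSq_eq_norm_sq]
  push_cast
  rfl

/-- Uniform asymptotics of the Jost solution as `s → ∞`. -/
theorem IsJostPair.exists_asymptotics (hα : 0 < α) (h : IsJostPair α u₀ c w atBot upperH a e)
    (hw : IsLeftPotential u₀ c w w') (X : ℝ) :
    ∃ M R : ℝ, 0 ≤ M ∧ 0 < R ∧ ∀ s ∈ upperH, R ≤ ‖s‖ →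
      ‖a s X - Complex.exp (Complex.I * phase α u₀ w X)‖ ≤ M / ‖s‖ ∧ ‖e s X‖ ≤ M := by
  have cw := hw.continuous
  have cw' := hw.cont_deriv
  obtain ⟨B, hB0, hB⟩ := exists_norm_le_Iic_of_tendsto cw hw.lim X
  obtain ⟨M, R, hM0, hR, hMR⟩ := h.exists_bound hα hw X
  have hαc : (α : ℂ) ≠ 0 := by exact_mod_cast hα.ne'
  set g : ℝ → ℝ := fun y => ‖u₀ ^ 2 - ‖w y‖ ^ 2‖ + ‖w' y‖ with hg
  have hgi : IntegrableOn g (Iic X) :=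
    (hw.integrable_defect X).norm.add (integrableOn_Iic_of_continuous cw' hw.integrable_deriv X).norm
  have hg0 : ∀ y, 0 ≤ g y := fun y => by positivity
  set C := (u₀ ^ 2 / (2 * α) + 1 + B / (2 * α)) * M with hC
  have hC0 : 0 ≤ C := by positivity
  set G := ∫ y in Iic X, g y with hG
  have hG0 : 0 ≤ G := integral_nonneg hg0
  refine ⟨C * G + u₀ ^ 2 + B * M + M, R, by positivity, by nlinarith [sq_nonneg u₀],
    fun s hs hsR => ?_⟩
  have hs0 := hs.2
  have hsp : 0 < ‖s‖ := norm_pos_iff.2 hs0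
  have hMs := hMR s hs hsR
  -- As `s → ∞`, `κ` tends to `1/(2α)`, so `a - w e / s` rotates with the derivative of the phase.
  -- The factor `E` undoes this rotation, and the derivative `F` of the product is `O(1/s)`.
  set E : ℝ → ℂ := fun x => Complex.exp (-(Complex.I * phase α u₀ w x)) with hE
  have hEn : ∀ x, ‖E x‖ = 1 := fun x => by
    simp only [hE]
    rw [show -(Complex.I * (phase α u₀ w x : ℂ)) = ((-phase α u₀ w x : ℝ) : ℂ) * Complex.I by
      push_cast; ring]
    exact Complex.norm_exp_ofReal_mul_I _
  set p : ℝ → ℂ := fun x => a s x - w x * e s x / s with hp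
  set F : ℝ → ℂ := fun y => E y * ((-(Complex.I * ((u₀ : ℂ) ^ 2 - w y * conj (w y))
    * u₀ ^ 2 * a s y / (2 * α)) - w' y * e s y
    + Complex.I * ((u₀ : ℂ) ^ 2 - w y * conj (w y)) * w y * e s y / (2 * α)) / s) with hF
  have dE : ∀ x, HasDerivAt E (E x * (-(Complex.I *
      ((1 / (2 * α) * (u₀ ^ 2 - ‖w x‖ ^ 2) : ℝ) : ℂ)))) x := fun x =>
    (((hw.hasDerivAt_phase x).ofReal_comp).const_mul Complex.I).neg.cexp
  have d : ∀ x, HasDerivAt (fun x => E x * p x) (F x) x := by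
    intro x
    refine ((dE x).mul (h.hasDerivAt_sub hw hs x)).congr_deriv ?_
    have e1 : ((1 / (2 * α) * (u₀ ^ 2 - ‖w x‖ ^ 2) : ℝ) : ℂ) =
        1 / (2 * α) * ((u₀ : ℂ) ^ 2 - w x * conj (w x)) := by
      rw [ofReal_defect]; push_cast; ring
    rw [e1]
    simp only [hF, kap]
    field_simp
    ring
  have hFb : ∀ y ≤ X, ‖F y‖ ≤ C / ‖s‖ * g y := by
    intro y hy
    simp only [hF]
    rw [norm_mul, hEn, one_mul, norm_div, div_mul_eq_mul_div]
    gcongr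
    refine (norm_add_le _ _).trans ?_
    refine (add_le_add_left (norm_sub_le _ _) _).trans ?_
    rw [ofReal_defect]
    simp only [norm_neg, norm_div, norm_mul, norm_pow, Complex.norm_I, one_mul, Complex.norm_real,
      Complex.norm_ofNat, Real.norm_of_nonneg hα.le]
    have h1 := (hMs y hy).1
    have h2 := (hMs y hy).2
    have h3 := hB y hy
    have hu : ‖u₀‖ ^ 2 = u₀ ^ 2 := by rw [Real.norm_eq_abs, sq_abs]
    rw [hu]
    calc _ ≤ ‖u₀ ^ 2 - ‖w y‖ ^ 2‖ * u₀ ^ 2 * M / (2 * α) + ‖w' y‖ * M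
          + ‖u₀ ^ 2 - ‖w y‖ ^ 2‖ * B * M / (2 * α) := by gcongr
      _ ≤ ‖u₀ ^ 2 - ‖w y‖ ^ 2‖ * u₀ ^ 2 * M / (2 * α) + ‖w' y‖ * M
          + ‖u₀ ^ 2 - ‖w y‖ ^ 2‖ * B * M / (2 * α) +
          (‖u₀ ^ 2 - ‖w y‖ ^ 2‖ * M + ‖w' y‖ * (u₀ ^ 2 / (2 * α) + B / (2 * α)) * M) :=
          le_add_of_nonneg_right (by positivity)
      _ = _ := by simp only [hC, hg]; ring
  have ca := h.continuous_fst hs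
  have ce := h.continuous_snd hs
  have cE : Continuous E := continuous_iff_continuousAt.2 fun x => (dE x).continuousAt
  have cF : Continuous F := by
    have := Complex.continuous_conj.comp cw
    simp only [Function.comp_def] at this
    fun_prop
  have i2 : IntegrableOn (fun y => C / ‖s‖ * g y) (Iic X) := hgi.const_mul _
  have iF := Integrable.mono' i2 cF.aestronglyMeasurable
    ((ae_restrict_mem measurableSet_Iic).mono fun y hy => hFb y hy)
  have tE : Tendsto E atBot (𝓝 1) := by
    have t1 : Tendsto (phase α u₀ w) atBot (𝓝 0) := by
      have : Tendsto (fun x => ∫ y in Iic x, (u₀ ^ 2 - ‖w y‖ ^ 2)) atBot (𝓝 0) :=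
        tendsto_integral_Iic_zero tendsto_id
      have h0 := this.const_mul (1 / (2 * α))
      rw [mul_zero] at h0
      exact h0
    have t2 : Continuous fun r : ℝ => Complex.exp (-(Complex.I * r)) := by fun_prop
    have h0 := (t2.tendsto 0).comp t1
    rw [Complex.ofReal_zero, mul_zero, neg_zero, Complex.exp_zero] at h0
    exact h0
  have tp : Tendsto (fun x => E x * p x) atBot (𝓝 (1 * (1 - c * -conj c / s))) :=
    tE.mul ((h.tendsto_fst s hs).sub ((hw.lim.mul (h.tendsto_snd s hs)).div_const s))
  have e1 := integral_Iic_of_hasDerivAt_of_tendsto' (fun y (_ : y ∈ Iic X) => d y) iF tp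
  have hb1 : ‖E X * p X - 1 * (1 - c * -conj c / s)‖ ≤ C * G / ‖s‖ := by
    rw [← e1]
    refine (norm_integral_le_of_norm_le i2
      ((ae_restrict_mem measurableSet_Iic).mono fun y hy => hFb y hy)).trans (le_of_eq ?_)
    rw [integral_const_mul]
    ring
  have hexp : E X * Complex.exp (Complex.I * phase α u₀ w X) = 1 := by
    simp only [hE]
    rw [← Complex.exp_add]
    simp
  refine ⟨?_, (hMs X le_rfl).2.trans (by nlinarith [mul_nonneg hC0 hG0, mul_nonneg hB0 hM0, sq_nonneg u₀])⟩
  have e2 : E X * (a s X - Complex.exp (Complex.I * phase α u₀ w X)) =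
      (E X * p X - 1 * (1 - c * -conj c / s)) + c * conj c / s + E X * (w X * e s X / s) := by
    rw [mul_sub, hexp]
    simp only [hp]
    ring
  have e3 : ‖a s X - Complex.exp (Complex.I * phase α u₀ w X)‖ =
      ‖E X * (a s X - Complex.exp (Complex.I * phase α u₀ w X))‖ := by
    rw [norm_mul, hEn, one_mul]
  rw [e3, e2]
  refine (norm_add₃_le).trans ?_
  have h2 : ‖c * conj c / s‖ = u₀ ^ 2 / ‖s‖ := by
    rw [norm_div, norm_mul, RCLike.norm_conj, hw.norm_lim]
    ring
  have h3 : ‖E X * (w X * e s X / s)‖ ≤ B * M / ‖s‖ := by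
    rw [norm_mul, hEn, one_mul, norm_div, norm_mul]
    have := hB X le_rfl
    have := (hMs X le_rfl).2
    gcongr
  rw [h2]
  calc _ ≤ C * G / ‖s‖ + u₀ ^ 2 / ‖s‖ + B * M / ‖s‖ := by gcongr
    _ ≤ C * G / ‖s‖ + u₀ ^ 2 / ‖s‖ + B * M / ‖s‖ + M / ‖s‖ := le_add_of_nonneg_right (by positivity)
    _ = _ := by ring

theorem I_mul_mem_upperH {τ : ℝ} (hτ : 0 < τ) : Complex.I * τ ∈ upperH :=
  ⟨by simpa using hτ.le, by simpa using hτ.ne'⟩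

theorem norm_I_mul {τ : ℝ} (hτ : 0 < τ) : ‖Complex.I * (τ : ℂ)‖ = τ := by
  simp [abs_of_pos hτ]

/-- A single ray is enough: the limit will identify the constant term of a partial fraction
expansion. -/
theorem IsJostPair.tendsto_fst_I_mul (hα : 0 < α) (h : IsJostPair α u₀ c w atBot upperH a e)
    (hw : IsLeftPotential u₀ c w w') (X : ℝ) :
    Tendsto (fun τ : ℝ => a (Complex.I * τ) X) atTop
      (𝓝 (Complex.exp (Complex.I * phase α u₀ w X))) := by
  obtain ⟨M, R, hM, hR, hMR⟩ := h.exists_asymptotics hα hw X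
  rw [tendsto_iff_norm_sub_tendsto_zero]
  refine squeeze_zero' (Eventually.of_forall fun _ => norm_nonneg _) ?_
    (tendsto_const_nhds.div_atTop tendsto_id : Tendsto (fun τ : ℝ => M / τ) atTop (𝓝 0))
  filter_upwards [eventually_ge_atTop R, eventually_gt_atTop 0] with τ h1 h2
  have := (hMR _ (I_mul_mem_upperH h2) (by rwa [norm_I_mul h2])).1
  rwa [norm_I_mul h2] at this

/-- For `s = iτ` the kernel `exp (iω (X - y))` is real and decays as `τ → ∞` for `y < X`. Dominated
convergence in the variation-of-constants formula gives `e + conj w · a → 0`, so the potential is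
read off from `e`. -/
theorem IsJostPair.tendsto_snd_I_mul (hα : 0 < α) (h : IsJostPair α u₀ c w atBot upperH a e)
    (hw : IsLeftPotential u₀ c w w') (X : ℝ) :
    Tendsto (fun τ : ℝ => e (Complex.I * τ) X) atTop
      (𝓝 (-(conj (w X) * Complex.exp (Complex.I * phase α u₀ w X)))) := by
  have cw := hw.continuous
  have cw' := hw.cont_deriv
  obtain ⟨M, R, hM0, hR, hMR⟩ := h.exists_bound hα hw X
  set F : ℂ → ℝ → ℂ := fun s y => -(Complex.I * kap α u₀ s *
    ((u₀ : ℂ) ^ 2 - w y * conj (w y)) * e s y) + conj (w' y) * a s y with hF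
  set g : ℝ → ℝ := fun y => 1 / α * ‖u₀ ^ 2 - ‖w y‖ ^ 2‖ * M + ‖w' y‖ * M with hg
  have hgi : IntegrableOn g (Iic X) :=
    (((hw.integrable_defect X).norm.const_mul _).mul_const _).add
      ((integrableOn_Iic_of_continuous cw' hw.integrable_deriv X).norm.mul_const _)
  have hFb : ∀ s ∈ upperH, R ≤ ‖s‖ → ∀ y ≤ X, ‖F s y‖ ≤ g y := by
    intro s hs hsR y hy
    simp only [hF]
    refine (norm_add_le _ _).trans ?_
    have hk := norm_kap_le (u₀ := u₀) hα (hR.trans hsR)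
    have h1 := hMR s hs hsR y hy
    rw [norm_neg, norm_mul, norm_mul, norm_mul, norm_mul, Complex.norm_I, one_mul, ofReal_defect,
      Complex.norm_real, RCLike.norm_conj]
    have h2 := h1.1
    have h3 := h1.2
    simp only [hg]
    gcongr
  have key : Tendsto (fun τ : ℝ => ∫ y in Iic X, Complex.exp (Complex.I * omg α u₀ (Complex.I * τ)
      * (X - y)) * F (Complex.I * τ) y) atTop (𝓝 (∫ y in Iic X, (0 : ℂ))) := by
    refine tendsto_integral_filter_of_dominated_convergence g ?_ ?_ hgi ?_
    · filter_upwards [eventually_gt_atTop 0] with τ h2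
      have hs := I_mul_mem_upperH h2
      have ca := h.continuous_fst hs
      have ce := h.continuous_snd hs
      have c1 := Complex.continuous_conj.comp cw
      have c2 := Complex.continuous_conj.comp cw'
      simp only [Function.comp_def] at c1 c2
      exact Continuous.aestronglyMeasurable (by fun_prop)
    · filter_upwards [eventually_ge_atTop R, eventually_gt_atTop 0] with τ h1 h2
      filter_upwards [ae_restrict_mem measurableSet_Iic] with y hy
      have hs := I_mul_mem_upperH h2
      rw [norm_mul]
      exact (mul_le_of_le_one_left (norm_nonneg _) (norm_exp_omg_le hα hs hy)).trans
        (hFb _ hs (by rwa [norm_I_mul h2]) y hy)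
    -- At the end point `y = X` the kernel equals `1` and does not decay.
    · have hne : ∀ᵐ y ∂(volume.restrict (Iic X)), y ≠ X :=
        ae_restrict_of_ae (compl_mem_ae_iff.2 (measure_singleton X))
      filter_upwards [ae_restrict_mem measurableSet_Iic, hne] with y hy hyX
      have hlt : 0 < X - y := sub_pos.2 (lt_of_le_of_ne hy hyX)
      have hexp : Tendsto (fun τ : ℝ => Real.exp (-((X - y) / (2 * α) * τ)) * g y) atTop (𝓝 0) := by
        have : Tendsto (fun τ : ℝ => (X - y) / (2 * α) * τ) atTop atTop :=
          tendsto_id.const_mul_atTop (by positivity)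
        simpa using (Real.tendsto_exp_neg_atTop_nhds_zero.comp this).mul_const (g y)
      refine squeeze_zero_norm' ?_ hexp
      filter_upwards [eventually_ge_atTop R, eventually_gt_atTop 0] with τ h1 h2
      have hs := I_mul_mem_upperH h2
      rw [norm_mul]
      refine mul_le_mul ?_ (hFb _ hs (by rwa [norm_I_mul h2]) y hy) (norm_nonneg _)
        (Real.exp_pos _).le
      rw [Complex.norm_exp]
      apply Real.exp_le_exp.2
      have hτc : (τ : ℂ) ≠ 0 := by exact_mod_cast h2.ne'
      have hαc : (α : ℂ) ≠ 0 := by exact_mod_cast hα.ne'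
      have e1 : Complex.I * omg α u₀ (Complex.I * τ) * (X - y) =
          ((-((X - y) / (2 * α) * (τ + u₀ ^ 4 / τ)) : ℝ) : ℂ) := by
        rw [omg]
        push_cast
        field_simp
        rw [Complex.I_sq]
        ring
      rw [e1, Complex.ofReal_re, neg_le_neg_iff]
      have : 0 ≤ u₀ ^ 4 / τ := by positivity
      gcongr
      linarith
  simp only [integral_zero] at key
  have t := (h.tendsto_fst_I_mul hα hw X).const_mul (conj (w X))
  have := key.sub t
  rw [zero_sub] at this
  refine this.congr' ?_
  filter_upwards [eventually_gt_atTop 0] with τ h2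
  simp only [hF]
  rw [← h.add_eq_integral hα hw (I_mul_mem_upperH h2) X]
  ring

end Asymptotics

end MNLS
end

noncomputable section
namespace MNLS

open Set Filter Topology MeasureTheory

/-! ### Planar linear systems and Wronskians -/

section Planar

variable {A : ℝ → Matrix (Fin 2) (Fin 2) ℂ}

theorem wronskian_mulVec_add (M : Matrix (Fin 2) (Fin 2) ℂ) (a b : Fin 2 → ℂ) :
    wronskian (M.mulVec a) b + wronskian a (M.mulVec b) = M.trace * wronskian a b := by
  simp only [wronskian, Matrix.mulVec, dotProduct, Fin.sum_univ_two, Matrix.trace, Matrix.diag]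
  ring

theorem hasDerivAt_wronskian {y₁ y₂ : ℝ → Fin 2 → ℂ} {M : Matrix (Fin 2) (Fin 2) ℂ} {x : ℝ}
    (h₁ : HasDerivAt y₁ (M.mulVec (y₁ x)) x) (h₂ : HasDerivAt y₂ (M.mulVec (y₂ x)) x) :
    HasDerivAt (fun x => wronskian (y₁ x) (y₂ x)) (M.trace * wronskian (y₁ x) (y₂ x)) x := by
  rw [← wronskian_mulVec_add]
  have e₁ := hasDerivAt_pi.1 h₁
  have e₂ := hasDerivAt_pi.1 h₂
  refine (((e₁ 0).mul (e₂ 1)).sub ((e₁ 1).mul (e₂ 0))).congr_deriv ?_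
  simp only [wronskian]
  ring

theorem continuous_wronskian : Continuous fun p : (Fin 2 → ℂ) × (Fin 2 → ℂ) => wronskian p.1 p.2 := by
  unfold wronskian; fun_prop

theorem wronskian_smul_smul (r s : ℂ) (a b : Fin 2 → ℂ) :
    wronskian (r • a) (s • b) = r * s * wronskian a b := by
  simp only [wronskian, Pi.smul_apply, smul_eq_mul]; ring

theorem wronskian_self (a : Fin 2 → ℂ) : wronskian a a = 0 := by
  simp only [wronskian]; ring

theorem exists_eq_smul_of_wronskian_eq_zero {a b : Fin 2 → ℂ} (ha : a ≠ 0)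
    (h : wronskian a b = 0) : ∃ r : ℂ, b = r • a := by
  have h' : a 0 * b 1 = a 1 * b 0 := sub_eq_zero.1 h
  by_cases h0 : a 0 = 0
  · have h1 : a 1 ≠ 0 := fun h1 => ha (by ext i; fin_cases i <;> simp [h0, h1])
    refine ⟨b 1 / a 1, ?_⟩
    have hb : b 0 = 0 := by
      rw [h0, zero_mul] at h'
      exact (mul_eq_zero.1 h'.symm).resolve_left h1
    ext i
    fin_cases i
    · simp [h0, hb]
    · simp [h1]
  · refine ⟨b 0 / a 0, ?_⟩
    ext i
    fin_cases i
    · simp [h0]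
    · simp only [Fin.mk_one, Pi.smul_apply, smul_eq_mul]
      rw [div_mul_eq_mul_div, eq_div_iff h0]
      linear_combination h'

theorem continuous_mulVecCLM (hA : Continuous A) : Continuous fun x =>
    LinearMap.toContinuousLinearMap ((Matrix.mulVecLin (A x)).restrictScalars ℝ) := by
  refine continuous_clm_apply.2 fun y => ?_
  exact hA.matrix_mulVec continuous_const

theorem eq_zero_of_planar_ode (hA : Continuous A) {y : ℝ → Fin 2 → ℂ}
    (hy : ∀ x, HasDerivAt y ((A x).mulVec (y x)) x) {x₀ : ℝ} (h0 : y x₀ = 0) (x : ℝ) : y x = 0 :=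
  eq_zero_of_linear_ode (continuous_mulVecCLM hA) hy h0 x

theorem exists_planar_ode_solution (hA : Continuous A) (v : Fin 2 → ℂ) :
    ∃ y : ℝ → Fin 2 → ℂ, y 0 = v ∧ ∀ x, HasDerivAt y ((A x).mulVec (y x)) x :=
  exists_linear_ode_solution (continuous_mulVecCLM hA) v

/-- Two solutions with the same non-zero limit after normalization coincide, if the
normalization does not decay slower than the Wronskian. -/
theorem eq_of_planar_ode_of_tendsto {τ : ℂ} {l : Filter ℝ} [l.NeBot] (hA : Continuous A)
    (hτ : ∀ x, (A x).trace = τ) {y₁ y₂ : ℝ → Fin 2 → ℂ} {μ : ℝ → ℂ} {v : Fin 2 → ℂ} (hv : v ≠ 0)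
    (h₁ : ∀ x, HasDerivAt y₁ ((A x).mulVec (y₁ x)) x)
    (h₂ : ∀ x, HasDerivAt y₂ ((A x).mulVec (y₂ x)) x)
    (l₁ : Tendsto (fun x => μ x • y₁ x) l (𝓝 v)) (l₂ : Tendsto (fun x => μ x • y₂ x) l (𝓝 v))
    {K : ℝ} (hμ : ∀ᶠ x : ℝ in l, ‖Complex.exp (-(τ * x))‖ ≤ K * ‖μ x * μ x‖) : y₁ = y₂ := by
  -- Abel's formula: the Wronskian divided by `e^{τx}` is constant. The normalized solutions become
  -- parallel in the limit, so the constant is zero.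
  have dW : ∀ x, HasDerivAt (fun x : ℝ => Complex.exp (-(τ * x)) * wronskian (y₁ x) (y₂ x)) 0 x := by
    intro x
    have e : HasDerivAt (fun x : ℝ => Complex.exp (-(τ * x))) (Complex.exp (-(τ * x)) * (-τ)) x := by
      simpa using (((Complex.ofRealCLM.hasDerivAt (x := x)).const_mul τ).neg).cexp
    refine (e.mul (hasDerivAt_wronskian (h₁ x) (h₂ x))).congr_deriv ?_
    rw [hτ]
    ring
  have hconst : ∀ x : ℝ, Complex.exp (-(τ * x)) * wronskian (y₁ x) (y₂ x) = wronskian (y₁ 0) (y₂ 0) := by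
    intro x
    have := is_const_of_deriv_eq_zero (fun x => (dW x).differentiableAt) (fun x => (dW x).deriv) x 0
    simpa using this
  have hlim : Tendsto (fun x => K * ‖wronskian (μ x • y₁ x) (μ x • y₂ x)‖) l (𝓝 0) := by
    have := (continuous_wronskian.tendsto (v, v)).comp (l₁.prodMk_nhds l₂)
    simpa [wronskian_self, Function.comp_def] using (this.norm.const_mul K)
  have hW : wronskian (y₁ 0) (y₂ 0) = 0 := by
    refine norm_le_zero_iff.1 (ge_of_tendsto hlim ?_)
    filter_upwards [hμ] with x hx
    rw [← hconst x, norm_mul, wronskian_smul_smul, norm_mul, ← mul_assoc]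
    exact mul_le_mul_of_nonneg_right hx (norm_nonneg _)
  have hne : y₁ 0 ≠ 0 := by
    intro h0
    have h := eq_zero_of_planar_ode hA h₁ h0
    refine hv (tendsto_nhds_unique l₁ ?_)
    simp [h]
  obtain ⟨r, hr⟩ := exists_eq_smul_of_wronskian_eq_zero hne hW
  have hy : ∀ x, y₂ x = r • y₁ x := by
    intro x
    refine sub_eq_zero.1 (eq_zero_of_planar_ode hA (y := fun x => y₂ x - r • y₁ x) (fun x => ?_)
      (x₀ := 0) (by simp [hr]) x)
    refine ((h₂ x).sub ((h₁ x).const_smul r)).congr_deriv ?_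
    rw [Matrix.mulVec_sub, Matrix.mulVec_smul]
  have hrv : v = r • v := by
    refine tendsto_nhds_unique l₂ ((l₁.const_smul r).congr fun x => ?_)
    rw [hy x, smul_comm]
  have hr1 : r = 1 := by
    have : (1 - r) • v = 0 := by rw [sub_smul, one_smul, ← hrv, sub_self]
    exact (sub_eq_zero.1 ((smul_eq_zero.1 this).resolve_right hv)).symm
  funext x
  rw [hy x, hr1, one_smul]

end Planar

/-! ### Symmetries of the normalized solutions -/

/-- The coefficient matrix of the system for `IsJostPair`. -/
def pairMatrix (α u₀ : ℝ) (s w : ℂ) : Matrix (Fin 2) (Fin 2) ℂ :=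
  (Complex.I * kap α u₀ s) • !![(u₀ : ℂ) ^ 2, w; s * conj w, s]

theorem pairMatrix_trace (α u₀ : ℝ) {s : ℂ} (hs : s ≠ 0) (w : ℂ) :
    (pairMatrix α u₀ s w).trace = Complex.I * omg α u₀ s := by
  rw [← kap_mul_add α u₀ hs, pairMatrix, Matrix.trace_smul, Matrix.trace_fin_two_of, smul_eq_mul]
  ring

theorem continuous_pairMatrix (α u₀ : ℝ) (s : ℂ) {w : ℝ → ℂ} (hw : Continuous w) :
    Continuous fun x => pairMatrix α u₀ s (w x) := by
  have := Complex.continuous_conj.comp hw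
  refine continuous_matrix fun i j => ?_
  fin_cases i <;> fin_cases j <;> simp [pairMatrix] <;> fun_prop

theorem hasDerivAt_pairMatrix {α u₀ : ℝ} {s w : ℂ} {a e : ℝ → ℂ} {x : ℝ}
    (ha : HasDerivAt a (Complex.I * kap α u₀ s * ((u₀ : ℂ) ^ 2 * a x + w * e x)) x)
    (he : HasDerivAt e (Complex.I * kap α u₀ s * s * (e x + conj w * a x)) x) :
    HasDerivAt (fun x => ![a x, e x]) ((pairMatrix α u₀ s w).mulVec ![a x, e x]) x := by
  refine hasDerivAt_pi.2 fun i => ?_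
  fin_cases i
  · refine ha.congr_deriv ?_
    simp [pairMatrix, Matrix.mulVec, dotProduct, Fin.sum_univ_two]; ring
  · refine he.congr_deriv ?_
    simp [pairMatrix, Matrix.mulVec, dotProduct, Fin.sum_univ_two]; ring

theorem tendsto_pair {l : Filter ℝ} {a e : ℝ → ℂ} {p q : ℂ} (ha : Tendsto a l (𝓝 p))
    (he : Tendsto e l (𝓝 q)) : Tendsto (fun x => ![a x, e x]) l (𝓝 ![p, q]) :=
  tendsto_pi_nhds.2 fun i => by fin_cases i <;> simpa

theorem conj_kap (α u₀ : ℝ) (s : ℂ) : conj (kap α u₀ s) = kap α u₀ (conj s) := by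
  simp [kap, map_ofNat]

theorem conj_omg (α u₀ : ℝ) (s : ℂ) : conj (omg α u₀ s) = omg α u₀ (conj s) := by
  simp [omg, map_ofNat]

theorem norm_exp_neg_omg_le_atBot {α u₀ : ℝ} (hα : 0 < α) {s : ℂ} (hs : s ∈ upperH) :
    ∀ᶠ x : ℝ in atBot, ‖Complex.exp (-(Complex.I * omg α u₀ s * x))‖ ≤ 1 := by
  filter_upwards [eventually_le_atBot 0] with x hx
  have := omg_im_nonneg (u₀ := u₀) hα hs
  rw [Complex.norm_exp, Real.exp_le_one_iff]
  simp
  nlinarith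

theorem norm_exp_neg_omg_le_atTop {α u₀ : ℝ} (hα : 0 < α) {s : ℂ} (hs : s ∈ lowerH) :
    ∀ᶠ x : ℝ in atTop, ‖Complex.exp (-(Complex.I * omg α u₀ s * x))‖ ≤ 1 := by
  filter_upwards [eventually_ge_atTop 0] with x hx
  have hs' : conj s ∈ upperH := ⟨by simpa using hs.1, by simpa using hs.2⟩
  have := omg_im_nonneg (u₀ := u₀) hα hs'
  rw [← conj_omg, Complex.conj_im] at this
  rw [Complex.norm_exp, Real.exp_le_one_iff]
  simp
  nlinarith

section Inversion

variable {α u₀ : ℝ} {c : ℂ} {w : ℝ → ℂ} {l : Filter ℝ} {H : Set ℂ} {a e : ℂ → ℝ → ℂ}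

/-- The symmetry `s ↦ u₀⁴ / s*`. -/
theorem IsJostPair.inversion [l.NeBot] (h : IsJostPair α u₀ c w l H a e) (hu : 0 < u₀)
    (hc : ‖c‖ = u₀) (hw : Continuous w) {s : ℂ} (hs : s ∈ H) (hs0 : s ≠ 0)
    (hs' : (u₀ : ℂ) ^ 4 / conj s ∈ H)
    (hl : ∀ᶠ x : ℝ in l, ‖Complex.exp (-(Complex.I * omg α u₀ s * x))‖ ≤ 1) (x : ℝ) :
    a s x = -(conj c / (u₀ : ℂ) ^ 2 * conj (e ((u₀ : ℂ) ^ 4 / conj s) x)) ∧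
      e s x = -(conj c * conj (a ((u₀ : ℂ) ^ 4 / conj s) x)) := by
  have hu' : (u₀ : ℂ) ≠ 0 := by exact_mod_cast hu.ne'
  have hcc : c * conj c = (u₀ : ℂ) ^ 2 := by rw [Complex.mul_conj, Complex.normSq_eq_norm_sq, hc]; simp
  set r : ℂ := (u₀ : ℂ) ^ 4 / conj s with hr
  have hcs : conj s ≠ 0 := by simpa using hs0
  have hr0 : r ≠ 0 := div_ne_zero (pow_ne_zero _ hu') hcs
  have hcr : conj r = (u₀ : ℂ) ^ 4 / s := by simp [hr]
  -- This relation makes the reflected pair a solution of the system at `s`. Its limit is again `(1,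
  -- -conj c)` because `|c| = u₀`, so uniqueness applies.
  have hk : conj (kap α u₀ r) = -(kap α u₀ s * s / (u₀ : ℂ) ^ 2) := by
    rw [conj_kap, hcr, kap, kap]
    rcases eq_or_ne (α : ℂ) 0 with h | h
    · simp [h]
    · field_simp
      ring
  have key := eq_of_planar_ode_of_tendsto (l := l) (K := 1) (μ := fun _ => 1) (v := ![1, -conj c])
    (continuous_pairMatrix α u₀ s hw)
    (fun x => pairMatrix_trace α u₀ hs0 (w x))
    (y₁ := fun x => ![a s x, e s x])
    (y₂ := fun x => ![-(conj c / (u₀ : ℂ) ^ 2 * conj (e r x)), -(conj c * conj (a r x))])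
    (fun h0 => by simpa using congrFun h0 0)
    (fun x => hasDerivAt_pairMatrix (h.deriv_fst s hs x) (h.deriv_snd s hs x))
    (fun x => hasDerivAt_pairMatrix
      (((hasDerivAt_conj (h.deriv_snd r hs' x)).const_mul _).neg.congr_deriv (by
        simp only [map_mul, map_add, hk, Complex.conj_I, Complex.conj_conj, hcr]
        field_simp
        ring))
      (((hasDerivAt_conj (h.deriv_fst r hs' x)).const_mul _).neg.congr_deriv (by
        simp only [map_mul, map_add, hk, Complex.conj_I, map_pow, Complex.conj_ofReal]
        field_simp
        ring)))
    (by simpa using tendsto_pair (h.tendsto_fst s hs) (h.tendsto_snd s hs))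
    (by
      refine Tendsto.congr (fun x => (one_smul ℂ _).symm) (tendsto_pair ?_ ?_)
      · have := (((Complex.continuous_conj.tendsto _).comp (h.tendsto_snd r hs')).const_mul
          (conj c / (u₀ : ℂ) ^ 2)).neg
        have e1 : (1 : ℂ) = -(conj c / (u₀ : ℂ) ^ 2 * conj (-conj c)) := by
          rw [map_neg, Complex.conj_conj, mul_neg, neg_neg, div_mul_eq_mul_div, mul_comm (conj c),
            hcc, div_self (pow_ne_zero _ hu')]
        rw [e1]
        exact this
      · have := (((Complex.continuous_conj.tendsto _).comp (h.tendsto_fst r hs')).const_mul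
          (conj c)).neg
        simpa [Function.comp_def] using this)
    (by simpa using hl)
  have := congrFun key x
  exact ⟨by simpa using congrFun this 0, by simpa using congrFun this 1⟩

/-- The bilinear form of two solutions, at `s` and at `s*`, does not depend on `x`. -/
theorem IsJostPair.hasDerivAt_form {c' : ℂ} {l' : Filter ℝ} {H' : Set ℂ} {a' e' : ℂ → ℝ → ℂ}
    (h : IsJostPair α u₀ c w l H a e) (h' : IsJostPair α u₀ c' w l' H' a' e') {s : ℂ}
    (hs : s ∈ H) (hs' : conj s ∈ H') (x : ℝ) :
    HasDerivAt (fun x => s * a s x * conj (a' (conj s) x) + e s x * conj (e' (conj s) x)) 0 x := by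
  refine ((((h.deriv_fst s hs x).const_mul s).mul (hasDerivAt_conj (h'.deriv_fst _ hs' x))).add
    ((h.deriv_snd s hs x).mul (hasDerivAt_conj (h'.deriv_snd _ hs' x)))).congr_deriv ?_
  simp only [map_mul, map_add, conj_kap, Complex.conj_conj, Complex.conj_I, map_pow,
    Complex.conj_ofReal]
  ring

theorem IsJostPair.form_eq {c' : ℂ} {l' : Filter ℝ} {H' : Set ℂ} {a' e' : ℂ → ℝ → ℂ}
    (h : IsJostPair α u₀ c w l H a e) (h' : IsJostPair α u₀ c' w l' H' a' e') {s : ℂ}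
    (hs : s ∈ H) (hs' : conj s ∈ H') (x y : ℝ) :
    s * a s x * conj (a' (conj s) x) + e s x * conj (e' (conj s) x) =
      s * a s y * conj (a' (conj s) y) + e s y * conj (e' (conj s) y) :=
  is_const_of_deriv_eq_zero (fun x => (h.hasDerivAt_form h' hs hs' x).differentiableAt)
    (fun x => (h.hasDerivAt_form h' hs hs' x).deriv) x y

/-- The form is constant in `x`, and its value is read off at the normalizing end, where `|c|² =
u₀²`. -/
theorem IsJostPair.form_self [l.NeBot] (h : IsJostPair α u₀ c w l H a e) (hc : ‖c‖ = u₀) {s : ℂ}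
    (hs : s ∈ H) (hs' : conj s ∈ H) (x : ℝ) :
    s * a s x * conj (a (conj s) x) + e s x * conj (e (conj s) x) = s + (u₀ : ℂ) ^ 2 := by
  have hcc : conj c * c = (u₀ : ℂ) ^ 2 := by
    rw [mul_comm, Complex.mul_conj, Complex.normSq_eq_norm_sq, hc]; simp
  have h1 := (((h.tendsto_fst s hs).const_mul s).mul
    ((Complex.continuous_conj.tendsto _).comp (h.tendsto_fst _ hs'))).add
    ((h.tendsto_snd s hs).mul ((Complex.continuous_conj.tendsto _).comp (h.tendsto_snd _ hs')))
  have h2 : Tendsto (fun y => s * a s x * conj (a (conj s) x) + e s x * conj (e (conj s) x)) l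
      (𝓝 (s + (u₀ : ℂ) ^ 2)) := by
    convert h1 using 2
    · exact h.form_eq h hs hs' x _
    · simp [hcc]
  exact tendsto_nhds_unique tendsto_const_nhds h2

/-- The normalized solution never vanishes. -/
theorem IsJostPair.ne_zero [l.NeBot] (h : IsJostPair α u₀ c w l H a e) (hw : Continuous w) {s : ℂ}
    (hs : s ∈ H) (x : ℝ) : a s x ≠ 0 ∨ e s x ≠ 0 := by
  by_contra hcon
  push Not at hcon
  have := eq_zero_of_planar_ode (continuous_pairMatrix α u₀ s hw)
    (fun x => hasDerivAt_pairMatrix (h.deriv_fst s hs x) (h.deriv_snd s hs x))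
    (x₀ := x) (by simp [hcon.1, hcon.2])
  have h0 : ∀ y, a s y = 0 := fun y => by simpa using congrFun (this y) 0
  have h1 := h.tendsto_fst s hs
  rw [show a s = fun _ => 0 from funext h0] at h1
  exact zero_ne_one (tendsto_nhds_unique tendsto_const_nhds h1)

end Inversion

end MNLS
end

noncomputable section
namespace MNLS

open Set Filter Topology MeasureTheory

/-! ### Compatible linear systems -/

/-- The sum of the absolute values of the entries of a matrix. -/
def entrySum (M : Matrix (Fin 2) (Fin 2) ℂ) : ℝ := ∑ i, ∑ j, ‖M i j‖

theorem entrySum_nonneg (M : Matrix (Fin 2) (Fin 2) ℂ) : 0 ≤ entrySum M := by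
  unfold entrySum; positivity

theorem continuous_entrySum : Continuous entrySum := by
  unfold entrySum; fun_prop

theorem norm_mulVec_le_entrySum (M : Matrix (Fin 2) (Fin 2) ℂ) (v : Fin 2 → ℂ) :
    ‖M.mulVec v‖ ≤ entrySum M * ‖v‖ := by
  refine (pi_norm_le_iff_of_nonneg (mul_nonneg (entrySum_nonneg M) (norm_nonneg v))).2 fun i => ?_
  calc ‖M.mulVec v i‖ ≤ ∑ j, ‖M i j * v j‖ := by
        rw [Matrix.mulVec, dotProduct]; exact norm_sum_le _ _
    _ ≤ ∑ j, ‖M i j‖ * ‖v‖ := Finset.sum_le_sum fun j _ => by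
        rw [norm_mul]; exact mul_le_mul_of_nonneg_left (norm_le_pi_norm v j) (norm_nonneg _)
    _ = (∑ j, ‖M i j‖) * ‖v‖ := (Finset.sum_mul _ _ _).symm
    _ ≤ entrySum M * ‖v‖ := mul_le_mul_of_nonneg_right
        (Finset.single_le_sum (f := fun i => ∑ j, ‖M i j‖) (fun i _ => by positivity)
          (Finset.mem_univ i)) (norm_nonneg _)

theorem entrySum_le_of_forall {M : Matrix (Fin 2) (Fin 2) ℂ} {η : ℝ}
    (h : ∀ i j, ‖M i j‖ ≤ η / 4) : entrySum M ≤ η := by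
  simp only [entrySum, Fin.sum_univ_two]
  linarith [h 0 0, h 0 1, h 1 0, h 1 1]

theorem hasDerivAt_mulVec {M : ℝ → Matrix (Fin 2) (Fin 2) ℂ} {M' : Matrix (Fin 2) (Fin 2) ℂ}
    {v : ℝ → Fin 2 → ℂ} {v' : Fin 2 → ℂ} {x : ℝ}
    (hM : ∀ i j, HasDerivAt (fun y => M y i j) (M' i j) x) (hv : HasDerivAt v v' x) :
    HasDerivAt (fun y => (M y).mulVec (v y)) (M'.mulVec (v x) + (M x).mulVec v') x := by
  refine hasDerivAt_pi.2 fun i => ?_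
  have hv' := hasDerivAt_pi.1 hv
  simp only [Matrix.mulVec, dotProduct, Fin.sum_univ_two, Pi.add_apply]
  exact (((hM i 0).mul (hv' 0)).add ((hM i 1).mul (hv' 1))).congr_deriv (by ring)

/-- First-order expansion in the second variable, uniform on compact sets of the first one. -/
theorem eventually_norm_sub_sub_le {f : ℝ × ℝ → ℂ} (hf : ContDiff ℝ 1 f) {g : ℝ → ℂ} {t : ℝ}
    (hg : ∀ y, HasDerivAt (fun s => f (y, s)) (g y) t) {K : Set ℝ} (hK : IsCompact K) {ε : ℝ}
    (hε : 0 < ε) : ∀ᶠ h in 𝓝 (0 : ℝ), ∀ y ∈ K, ‖f (y, t + h) - f (y, t) - (h : ℂ) * g y‖ ≤ ε * |h| := by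
  refine hK.eventually_forall_of_forall_eventually fun y _ => ?_
  have hs : HasStrictFDerivAt f (fderiv ℝ f (y, t)) (y, t) :=
    hf.contDiffAt.hasStrictFDerivAt one_ne_zero
  have h1 := (hasStrictFDerivAt_iff_isLittleO.1 hs).def (half_pos hε)
  have c1 : Tendsto (fun z : ℝ × ℝ => ((z.2, t + z.1), (z.2, t))) (𝓝 (0, y))
      (𝓝 ((y, t), (y, t))) := by
    have : Continuous fun z : ℝ × ℝ => ((z.2, t + z.1), (z.2, t)) := by fun_prop
    simpa using this.tendsto (0, y)
  have hgL : ∀ y', g y' = fderiv ℝ f (y', t) (0, 1) := fun y' => by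
    have hd : HasDerivAt (fun s : ℝ => ((y', s) : ℝ × ℝ)) (0, 1) t :=
      (hasDerivAt_const t y').prodMk (hasDerivAt_id t)
    exact (hg y').unique
      (((hf.differentiable one_ne_zero) (y', t)).hasFDerivAt.comp_hasDerivAt t hd)
  have hgc : Continuous g := by
    rw [show g = fun y' => fderiv ℝ f (y', t) (0, 1) from funext hgL]
    have := hf.continuous_fderiv one_ne_zero
    fun_prop
  have h2 : ∀ᶠ z in 𝓝 ((0 : ℝ), y), ‖g y - g z.2‖ < ε / 2 := by
    have : Continuous fun z : ℝ × ℝ => ‖g y - g z.2‖ := by fun_prop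
    have := this.tendsto (0, y)
    simp only [sub_self, norm_zero] at this
    exact this.eventually_lt_const (half_pos hε)
  filter_upwards [c1.eventually h1, h2] with z hz1 hz2
  have e1 : ((z.2, t + z.1) : ℝ × ℝ) - (z.2, t) = z.1 • (0, 1) := by simp
  have e2 : ‖((z.2, t + z.1) : ℝ × ℝ) - (z.2, t)‖ = |z.1| := by
    rw [e1, norm_smul]; simp [Prod.norm_def]
  rw [e2, e1, map_smul, ← hgL, Complex.real_smul] at hz1
  calc ‖f (z.2, t + z.1) - f (z.2, t) - z.1 * g z.2‖
      = ‖(f (z.2, t + z.1) - f (z.2, t) - z.1 * g y) + z.1 * (g y - g z.2)‖ := by congr 1; ring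
    _ ≤ ε / 2 * |z.1| + |z.1| * (ε / 2) := by
        refine (norm_add_le _ _).trans (add_le_add hz1 ?_)
        rw [norm_mul, Complex.norm_real, Real.norm_eq_abs]
        exact mul_le_mul_of_nonneg_left hz2.le (abs_nonneg _)
    _ = ε * |z.1| := by ring

theorem eventually_norm_sub_le {f : ℝ × ℝ → ℂ} (hf : Continuous f) (t : ℝ) {K : Set ℝ}
    (hK : IsCompact K) {ε : ℝ} (hε : 0 < ε) :
    ∀ᶠ h in 𝓝 (0 : ℝ), ∀ y ∈ K, ‖f (y, t + h) - f (y, t)‖ ≤ ε := by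
  refine hK.eventually_forall_of_forall_eventually fun y _ => ?_
  have : Continuous fun z : ℝ × ℝ => ‖f (z.2, t + z.1) - f (z.2, t)‖ := by fun_prop
  have := this.tendsto (0, y)
  simp only [add_zero, sub_self, norm_zero] at this
  filter_upwards [this.eventually_lt_const hε] with z hz using hz.le

/-- Existence of common solutions of `φ_x = X φ`, `φ_t = T φ` under the zero-curvature
condition `X_t + X T = T_x + T X`. -/
theorem exists_flat_section {X T Xt Tx : ℝ → ℝ → Matrix (Fin 2) (Fin 2) ℂ}
    (hX : ∀ i j, ContDiff ℝ 1 fun p : ℝ × ℝ => X p.1 p.2 i j)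
    (hT : ∀ i j, Continuous fun p : ℝ × ℝ => T p.1 p.2 i j)
    (hXt : ∀ i j x t, HasDerivAt (fun s => X x s i j) (Xt x t i j) t)
    (hTx : ∀ i j x t, HasDerivAt (fun y => T y t i j) (Tx x t i j) x)
    (hzc : ∀ x t, Xt x t + X x t * T x t = Tx x t + T x t * X x t) (v : Fin 2 → ℂ) :
    ∃ φ : ℝ → ℝ → Fin 2 → ℂ, φ 0 0 = v ∧
      (∀ x t, HasDerivAt (fun y => φ y t) ((X x t).mulVec (φ x t)) x) ∧
      ∀ x t, HasDerivAt (fun s => φ x s) ((T x t).mulVec (φ x t)) t := by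
  have hXc : Continuous fun p : ℝ × ℝ => X p.1 p.2 :=
    continuous_matrix fun i j => (hX i j).continuous
  have hTc : Continuous fun p : ℝ × ℝ => T p.1 p.2 := continuous_matrix hT
  -- Integrate in `t` along `x = 0`, then in `x` for each `t`. For the `t`-equation away from `x =
  -- 0`, the error `ψ (t + h) - ψ t - h T ψ t` is `o(h)` at `x = 0` and, by zero curvature, solves
  -- the `x`-equation up to `o(h)`; Grönwall's inequality does the rest.
  obtain ⟨g, hg0, hg⟩ := exists_planar_ode_solution (A := fun s => T 0 s)
    (hTc.comp (by fun_prop : Continuous fun s : ℝ => ((0 : ℝ), s))) v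
  have hXs : ∀ t, Continuous fun x => X x t := fun t =>
    hXc.comp (by fun_prop : Continuous fun x : ℝ => (x, t))
  choose ψ hψ0 hψ using fun t => exists_planar_ode_solution (hXs t) (g t)
  refine ⟨fun x t => ψ t x, by simp [hψ0, hg0], fun x t => hψ t x, fun x t => ?_⟩
  show HasDerivAt (fun s => ψ s x) ((T x t).mulVec (ψ t x)) t
  rw [hasDerivAt_iff_isLittleO_nhds_zero, Asymptotics.isLittleO_iff]
  intro ε hε
  have hK : IsCompact (Icc (-|x|) |x|) := isCompact_Icc
  have hψc : Continuous (ψ t) := continuous_iff_continuousAt.2 fun y => (hψ t y).continuousAt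
  have hTψ : Continuous fun y => (T y t).mulVec (ψ t y) :=
    (hTc.comp (by fun_prop : Continuous fun y : ℝ => (y, t))).matrix_mulVec hψc
  obtain ⟨B₁, hB₁⟩ := hK.exists_bound_of_continuousOn hψc.continuousOn
  obtain ⟨B₂, hB₂⟩ := hK.exists_bound_of_continuousOn hTψ.continuousOn
  have hx0 : (0 : ℝ) ∈ Icc (-|x|) |x| := ⟨by simp, abs_nonneg x⟩
  have hB₁0 : 0 ≤ B₁ := (norm_nonneg _).trans (hB₁ 0 hx0)
  have hB₂0 : 0 ≤ B₂ := (norm_nonneg _).trans (hB₂ 0 hx0)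
  obtain ⟨K₀, hK₀⟩ := hK.exists_bound_of_continuousOn
    (continuous_entrySum.comp (hXs t)).continuousOn
  set K : ℝ := max K₀ 0 + 1 with hKdef
  -- The sum `1 + B₁ + B₂` collects the initial error and the two inhomogeneous terms; `η ≤ 1` keeps
  -- the entry sum of `X` at time `t + h` below `K`.
  set η : ℝ := min 1 (ε / ((1 + B₁ + B₂) * Real.exp (K * |x|))) with hη
  have hη0 : 0 < η := lt_min one_pos (by positivity)
  have hη1 : η ≤ 1 := min_le_left _ _
  have hηε : η * ((1 + B₁ + B₂) * Real.exp (K * |x|)) ≤ ε := by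
    rw [← le_div_iff₀ (by positivity)]; exact min_le_right _ _
  have ev1 : ∀ᶠ h in 𝓝 (0 : ℝ), ∀ i j, ∀ y ∈ Icc (-|x|) |x|,
      ‖X y (t + h) i j - X y t i j - (h : ℂ) * Xt y t i j‖ ≤ η / 4 * |h| :=
    eventually_all.2 fun i => eventually_all.2 fun j =>
      eventually_norm_sub_sub_le (hX i j) (fun y => hXt i j y t) hK (by positivity)
  have ev2 : ∀ᶠ h in 𝓝 (0 : ℝ), ∀ i j, ∀ y ∈ Icc (-|x|) |x|,
      ‖X y (t + h) i j - X y t i j‖ ≤ η / 4 :=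
    eventually_all.2 fun i => eventually_all.2 fun j =>
      eventually_norm_sub_le (hX i j).continuous t hK (by positivity)
  have ev3 := (hasDerivAt_iff_isLittleO_nhds_zero.1 (hg t)).def hη0
  filter_upwards [ev1, ev2, ev3] with h h1 h2 h3
  have key := norm_le_of_norm_deriv_le (E := Fin 2 → ℂ) (K := K) (ε := η * (B₁ + B₂) * |h|)
    (R := |x|) (f := fun y => ψ (t + h) y - ψ t y - h • (T y t).mulVec (ψ t y))
    (f' := fun y => (X y (t + h)).mulVec (ψ (t + h) y) - (X y t).mulVec (ψ t y) -
      h • ((Tx y t).mulVec (ψ t y) + (T y t).mulVec ((X y t).mulVec (ψ t y))))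
    (by rw [hKdef]; linarith [le_max_right K₀ 0]) (by positivity)
    (fun y => ((hψ _ y).sub (hψ t y)).sub
      ((hasDerivAt_mulVec (fun i j => hTx i j y t) (hψ t y)).const_smul h)) ?_ (x := x) le_rfl
  · have e0 : ψ (t + h) 0 - ψ t 0 - h • (T 0 t).mulVec (ψ t 0) =
        g (t + h) - g t - h • (T 0 t).mulVec (g t) := by rw [hψ0, hψ0]
    rw [e0] at key
    calc _ ≤ _ := key
      _ ≤ (η * ‖h‖ + η * (B₁ + B₂) * |h|) * Real.exp (K * |x|) := by gcongr
      _ = η * ((1 + B₁ + B₂) * Real.exp (K * |x|)) * ‖h‖ := by rw [Real.norm_eq_abs]; ring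
      _ ≤ ε * ‖h‖ := by gcongr
  · intro y hy
    have hyK : y ∈ Icc (-|x|) |x| := abs_le.1 hy
    have hid : (X y (t + h)).mulVec (ψ (t + h) y) - (X y t).mulVec (ψ t y) -
        h • ((Tx y t).mulVec (ψ t y) + (T y t).mulVec ((X y t).mulVec (ψ t y))) =
        (X y (t + h)).mulVec (ψ (t + h) y - ψ t y - h • (T y t).mulVec (ψ t y)) +
        ((X y (t + h) - X y t - (h : ℂ) • Xt y t).mulVec (ψ t y) +
          h • (X y (t + h) - X y t).mulVec ((T y t).mulVec (ψ t y))) := by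
      have hz : (Tx y t).mulVec (ψ t y) + (T y t).mulVec ((X y t).mulVec (ψ t y)) =
          (Xt y t).mulVec (ψ t y) + (X y t).mulVec ((T y t).mulVec (ψ t y)) := by
        rw [Matrix.mulVec_mulVec, Matrix.mulVec_mulVec, ← Matrix.add_mulVec, ← Matrix.add_mulVec,
          hzc]
      rw [hz]
      simp only [Matrix.sub_mulVec, Matrix.mulVec_sub, Matrix.smul_mulVec, Matrix.mulVec_smul,
        smul_add, smul_sub, Complex.coe_smul]
      abel
    rw [hid]
    have b1 : entrySum (X y (t + h)) ≤ K := by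
      have e : entrySum (X y (t + h)) ≤ entrySum (X y t) + entrySum (X y (t + h) - X y t) := by
        simp only [entrySum, ← Finset.sum_add_distrib]
        refine Finset.sum_le_sum fun i _ => Finset.sum_le_sum fun j _ => ?_
        refine (norm_add_le _ _).trans_eq' ?_
        rw [Matrix.sub_apply]; congr 1; ring
      have e1 := hK₀ y hyK
      have e2 : entrySum (X y (t + h) - X y t) ≤ η :=
        entrySum_le_of_forall fun i j => h2 i j y hyK
      have e3 := (le_abs_self _).trans e1
      simp only [Function.comp_apply] at e3
      linarith [le_max_left K₀ 0]
    have b2 : entrySum (X y (t + h) - X y t - (h : ℂ) • Xt y t) ≤ η * |h| :=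
      entrySum_le_of_forall fun i j => (h1 i j y hyK).trans_eq (by ring)
    have b3 : entrySum (X y (t + h) - X y t) ≤ η :=
      entrySum_le_of_forall fun i j => h2 i j y hyK
    refine (norm_add_le _ _).trans (add_le_add ?_ ((norm_add_le _ _).trans ?_))
    · exact (norm_mulVec_le_entrySum _ _).trans (mul_le_mul_of_nonneg_right b1 (norm_nonneg _))
    · rw [norm_smul, Real.norm_eq_abs]
      calc _ ≤ (η * |h|) * B₁ + |h| * (η * B₂) := by
            refine add_le_add ?_ (mul_le_mul_of_nonneg_left ?_ (abs_nonneg _))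
            · exact (norm_mulVec_le_entrySum _ _).trans
                (mul_le_mul b2 (hB₁ y hyK) (norm_nonneg _) (by positivity))
            · exact (norm_mulVec_le_entrySum _ _).trans
                (mul_le_mul b3 (hB₂ y hyK) (norm_nonneg _) (by positivity))
        _ = η * (B₁ + B₂) * |h| := by ring

end MNLS
end

noncomputable section
namespace MNLS

open Set Filter Topology MeasureTheory

/-! ### The Lax pair -/

/-- The diagonal entry of `T`, in terms of `k` and the value `a` of `u`. -/
def laxTdiag (α : ℝ) (k a : ℂ) : ℂ :=
  -(2 * Complex.I * (α : ℂ) ^ 2 * k ^ 4) + 4 * Complex.I * (α : ℂ) ^ 2 * k ^ 2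
    + Complex.I * k ^ 2 * (a * conj a)

/-- The matrix `T`, in terms of `k` and the values `a`, `b` of `u` and `u_x`. -/
def laxTof (α : ℝ) (k a b : ℂ) : Matrix (Fin 2) (Fin 2) ℂ :=
  !![laxTdiag α k a,
      2 * Complex.I * α * k * (k ^ 2 - 2) * a - Complex.I / α * k * (a * conj a * a) - k * b;
    2 * Complex.I * α * k * (k ^ 2 - 2) * conj a - Complex.I / α * k * (a * conj a * conj a)
      + k * conj b, -laxTdiag α k a]

/-- The matrix `X`, in terms of `k` and the value `a` of `u`. -/
def laxXof (α : ℝ) (k a : ℂ) : Matrix (Fin 2) (Fin 2) ℂ :=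
  !![-(Complex.I * α * k ^ 2), Complex.I * k * a;
    Complex.I * k * conj a, Complex.I * α * k ^ 2]

theorem ofReal_norm_sq (a : ℂ) : (‖a‖ : ℂ) ^ 2 = a * conj a := by
  rw [Complex.mul_conj, Complex.normSq_eq_norm_sq]; push_cast; rfl

variable {α u₀ : ℝ} {um up c : ℂ} {u : ℝ → ℝ → ℂ}

theorem laxX_eq (z : ℂ) (x t : ℝ) : laxX α u₀ u z x t = laxXof α (specK α u₀ z) (u x t) := by
  ext i j
  fin_cases i <;> fin_cases j <;> simp [laxX, laxXof, sigma3, offDiag]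

theorem laxT_eq (z : ℂ) (x t : ℝ) : laxT α u₀ u z x t =
    laxTof α (specK α u₀ z) (u x t) (deriv (fun y => u y t) x) := by
  rw [laxT, ofReal_norm_sq, pow_three]
  ext i j
  fin_cases i <;> fin_cases j <;>
    simp [laxTof, laxTdiag, sigma3, offDiag, -mul_eq_mul_left_iff, -mul_eq_mul_right_iff] <;> ring

theorem laxX_trace (z : ℂ) (x t : ℝ) : (laxX α u₀ u z x t).trace = 0 := by
  rw [laxX_eq, laxXof, Matrix.trace_fin_two_of]; ring

theorem laxT_trace (z : ℂ) (x t : ℝ) : (laxT α u₀ u z x t).trace = 0 := by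
  rw [laxT_eq, laxTof, Matrix.trace_fin_two_of]; ring

theorem continuous_laxXof (α : ℝ) (k : ℂ) : Continuous fun a => laxXof α k a := by
  refine continuous_matrix fun i j => ?_
  have := Complex.continuous_conj
  fin_cases i <;> fin_cases j <;> simp [laxXof] <;> fun_prop

theorem continuous_laxTof (α : ℝ) (k : ℂ) : Continuous fun p : ℂ × ℂ => laxTof α k p.1 p.2 := by
  refine continuous_matrix fun i j => ?_
  have := Complex.continuous_conj
  fin_cases i <;> fin_cases j <;> simp [laxTof, laxTdiag] <;> fun_prop

/-! Regularity of the potential -/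

theorem contDiff_conj_comp {E : Type*} [NormedAddCommGroup E] [NormedSpace ℝ E] {n : WithTop ℕ∞}
    {f : E → ℂ} (hf : ContDiff ℝ n f) : ContDiff ℝ n fun p => conj (f p) :=
  Complex.conjCLE.contDiff.comp hf

theorem hasDerivAt_fst_of_differentiable {f : ℝ × ℝ → ℂ} (hf : Differentiable ℝ f) (x t : ℝ) :
    HasDerivAt (fun y => f (y, t)) (fderiv ℝ f (x, t) (1, 0)) x :=
  (hf (x, t)).hasFDerivAt.comp_hasDerivAt x ((hasDerivAt_id x).prodMk (hasDerivAt_const x t))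

theorem hasDerivAt_snd_of_differentiable {f : ℝ × ℝ → ℂ} (hf : Differentiable ℝ f) (x t : ℝ) :
    HasDerivAt (fun s => f (x, s)) (fderiv ℝ f (x, t) (0, 1)) t :=
  (hf (x, t)).hasFDerivAt.comp_hasDerivAt t ((hasDerivAt_const t x).prodMk (hasDerivAt_id t))

section Regularity

variable (hu : IsNZBCSolution α um up u)
include hu

theorem IsNZBCSolution.hasDerivAt_space (x t : ℝ) :
    HasDerivAt (fun y => u y t) (deriv (fun y => u y t) x) x :=
  (hasDerivAt_fst_of_differentiable (hu.smooth.differentiable two_ne_zero) x t).differentiableAt.hasDerivAt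

theorem IsNZBCSolution.hasDerivAt_time (x t : ℝ) :
    HasDerivAt (fun s => u x s) (deriv (fun s => u x s) t) t :=
  (hasDerivAt_snd_of_differentiable (hu.smooth.differentiable two_ne_zero) x t).differentiableAt.hasDerivAt

theorem IsNZBCSolution.contDiff_deriv :
    ContDiff ℝ 1 fun p : ℝ × ℝ => deriv (fun y => u y p.2) p.1 := by
  have e : (fun p : ℝ × ℝ => deriv (fun y => u y p.2) p.1) =
      fun p => fderiv ℝ (fun p : ℝ × ℝ => u p.1 p.2) p (1, 0) := by
    funext p
    exact (hasDerivAt_fst_of_differentiable (hu.smooth.differentiable two_ne_zero) p.1 p.2).deriv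
  rw [e]
  have := hu.smooth.fderiv_right (m := 1) (by norm_num)
  exact this.clm_apply contDiff_const

theorem IsNZBCSolution.hasDerivAt_deriv (x t : ℝ) :
    HasDerivAt (fun y => deriv (fun y' => u y' t) y)
      (deriv (fun y => deriv (fun y' => u y' t) y) x) x :=
  (hasDerivAt_fst_of_differentiable
    (hu.contDiff_deriv.differentiable one_ne_zero) x t).differentiableAt.hasDerivAt

/-- Zero curvature for this Lax pair is the equation itself: the diagonal entries hold identically,
and the off-diagonal ones are `k` times the equation and `-k` times its conjugate. -/
theorem IsNZBCSolution.exists_lax_solution (hα : 0 < α) (z : ℂ) (v : Fin 2 → ℂ) :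
    ∃ φ : ℝ → ℝ → Fin 2 → ℂ, φ 0 0 = v ∧
      (∀ x t, HasDerivAt (fun y => φ y t) ((laxX α u₀ u z x t).mulVec (φ x t)) x) ∧
      ∀ x t, HasDerivAt (fun s => φ x s) ((laxT α u₀ u z x t).mulVec (φ x t)) t := by
  simp only [laxX_eq, laxT_eq]
  set k := specK α u₀ z
  have hα' : (α : ℂ) ≠ 0 := by exact_mod_cast hα.ne'
  have hu1 : ContDiff ℝ 1 fun p : ℝ × ℝ => u p.1 p.2 := hu.smooth.of_le one_le_two
  have hu1c := contDiff_conj_comp hu1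
  have hc0 := hu1.continuous
  have hc1 := hu.contDiff_deriv.continuous
  have hcubic : ∀ x t, HasDerivAt (fun y => u y t * conj (u y t) * u y t)
      (deriv (fun y => (‖u y t‖ : ℂ) ^ 2 * u y t) x) x := by
    intro x t
    have e : (fun y => (‖u y t‖ : ℂ) ^ 2 * u y t) = fun y => u y t * conj (u y t) * u y t := by
      funext y; rw [ofReal_norm_sq]
    rw [e]
    have h := hu.hasDerivAt_space x t
    exact ((h.mul (hasDerivAt_conj h)).mul h).differentiableAt.hasDerivAt
  have hcubic' : ∀ x t, deriv (fun y => (‖u y t‖ : ℂ) ^ 2 * u y t) x =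
      2 * u x t * conj (u x t) * deriv (fun y => u y t) x
        + u x t ^ 2 * conj (deriv (fun y => u y t) x) := by
    intro x t
    have h := hu.hasDerivAt_space x t
    refine (hcubic x t).unique (((h.mul (hasDerivAt_conj h)).mul h).congr_deriv ?_)
    simp only [Pi.mul_apply]
    ring
  refine exists_flat_section
    (Xt := fun x t => !![0, Complex.I * k * deriv (fun s => u x s) t;
      Complex.I * k * conj (deriv (fun s => u x s) t), 0])
    (Tx := fun x t =>
      let b := deriv (fun y => u y t) x
      let d := deriv (fun y => deriv (fun y' => u y' t) y) x
      let g := deriv (fun y => (‖u y t‖ : ℂ) ^ 2 * u y t) x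
      !![Complex.I * k ^ 2 * (b * conj (u x t) + u x t * conj b),
        2 * Complex.I * α * k * (k ^ 2 - 2) * b - Complex.I / α * k * g - k * d;
        2 * Complex.I * α * k * (k ^ 2 - 2) * conj b - Complex.I / α * k * conj g + k * conj d,
        -(Complex.I * k ^ 2 * (b * conj (u x t) + u x t * conj b))])
    ?_ ?_ ?_ ?_ ?_ v
  · intro i j
    fin_cases i <;> fin_cases j <;> simp [laxXof] <;> fun_prop
  · intro i j
    exact ((continuous_laxTof α k).comp (hc0.prodMk hc1)).matrix_elem i j
  · intro i j x t
    have h := hu.hasDerivAt_time x t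
    fin_cases i <;> fin_cases j <;> simp only [laxXof, Fin.zero_eta, Fin.mk_one, Matrix.of_apply,
      Matrix.cons_val', Matrix.cons_val_zero, Matrix.cons_val_one, Matrix.cons_val_fin_one]
    · exact hasDerivAt_const _ _
    · exact h.const_mul _
    · exact (hasDerivAt_conj h).const_mul _
    · exact hasDerivAt_const _ _
  · intro i j x t
    have h := hu.hasDerivAt_space x t
    have hd := hu.hasDerivAt_deriv x t
    have hdiag : HasDerivAt (fun y => laxTdiag α k (u y t))
        (Complex.I * k ^ 2 * (deriv (fun y => u y t) x * conj (u x t)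
          + u x t * conj (deriv (fun y => u y t) x))) x := by
      unfold laxTdiag
      exact (((h.mul (hasDerivAt_conj h)).const_mul _).const_add _)
    fin_cases i <;> fin_cases j <;> simp only [laxTof, Fin.zero_eta, Fin.mk_one, Matrix.of_apply,
      Matrix.cons_val', Matrix.cons_val_zero, Matrix.cons_val_one, Matrix.cons_val_fin_one]
    · exact hdiag
    · exact ((h.const_mul _).sub ((hcubic x t).const_mul _)).sub (hd.const_mul _)
    · refine (((hasDerivAt_conj h).const_mul _).sub ((?_ : HasDerivAt _ _ _).const_mul _)).add
        ((hasDerivAt_conj hd).const_mul _)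
      have := hasDerivAt_conj (hcubic x t)
      refine this.congr_of_eventuallyEq (Eventually.of_forall fun y => ?_)
      simp only [map_mul, Complex.conj_conj]; ring
    · exact hdiag.neg
  · intro x t
    have heq := hu.equation x t
    have heq' := congrArg conj heq
    simp only [map_add, map_mul, map_div₀, Complex.conj_I, Complex.conj_ofReal, map_zero,
      map_ofNat] at heq'
    rw [hcubic'] at heq heq'
    simp only [hcubic']
    simp only [map_add, map_mul, map_pow, map_ofNat, Complex.conj_conj] at heq' ⊢
    generalize deriv (fun s => u x s) t = p at *
    generalize deriv (fun y => deriv (fun y' => u y' t) y) x = d at *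
    generalize deriv (fun y => u y t) x = b at *
    generalize u x t = a at *
    ext i j
    have hβ : α * (Complex.I / α) = Complex.I := mul_div_cancel₀ _ hα'
    have hβ' : (-Complex.I) / α = -(Complex.I / α) := neg_div _ _
    rw [hβ'] at heq'
    fin_cases i <;> fin_cases j <;>
      simp [laxXof, laxTof, laxTdiag]
    · ring
    · linear_combination k * heq + 2 * Complex.I * k ^ 3 * a ^ 2 * conj a * hβ
    · linear_combination -k * heq' - 2 * Complex.I * k ^ 3 * a * conj a ^ 2 * hβ
    · ring

end Regularity

/-! ### Jost solutions at a fixed time -/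

/-- The restriction of a Jost column to a fixed time. -/
structure IsJostSlice (α u₀ : ℝ) (u : ℝ → ℝ → ℂ) (l : Filter ℝ) (c : ℂ) (j : Fin 2) (z : ℂ)
    (t : ℝ) (ψ : ℝ → Fin 2 → ℂ) : Prop where
  deriv : ∀ x, HasDerivAt ψ ((laxX α u₀ u z x t).mulVec (ψ x)) x
  lim : Tendsto (fun x => Complex.exp (-(Complex.I * theta α u₀ x t z * sigma3 j j)) • ψ x) l
    (𝓝 fun i => eigY c z i j)

theorem IsJostColumn.isJostSlice {l : Filter ℝ} {j : Fin 2} {z : ℂ} {φ : ℝ → ℝ → Fin 2 → ℂ}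
    (h : IsJostColumn α u₀ u l c j z φ) (t : ℝ) :
    IsJostSlice α u₀ u l c j z t (fun x => φ x t) :=
  ⟨fun x => h.1 x t, h.2.2 t⟩

theorem eigY_col_ne_zero (c z : ℂ) (j : Fin 2) : (fun i => eigY c z i j) ≠ 0 := by
  intro h
  have := congrFun h j
  fin_cases j <;> simp [eigY, sigma3, offDiag] at this

theorem two_mul_specK_mul_specLam (α u₀ : ℝ) {z : ℂ} (hz : z ≠ 0) :
    2 * (specK α u₀ z * specLam u₀ z) = omg α u₀ (z ^ 2) := by
  rw [specK, specLam, omg]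
  rcases eq_or_ne (α : ℂ) 0 with h | h
  · simp [h]
  · field_simp
    ring

theorem continuous_space (hu : IsNZBCSolution α um up u) (t : ℝ) : Continuous fun x => u x t :=
  hu.smooth.continuous.comp (by fun_prop : Continuous fun x : ℝ => (x, t))

/-- `X` is trace-free, so Wronskians of solutions are constant; it suffices that the square of the
normalizing exponential does not decay at the end `l`. -/
theorem IsJostSlice.unique {l : Filter ℝ} [l.NeBot] {j : Fin 2} {z : ℂ} {t : ℝ}
    {ψ₁ ψ₂ : ℝ → Fin 2 → ℂ} (hu : IsNZBCSolution α um up u) (hz : z ≠ 0)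
    (h₁ : IsJostSlice α u₀ u l c j z t ψ₁) (h₂ : IsJostSlice α u₀ u l c j z t ψ₂)
    (hl : ∀ᶠ x : ℝ in l, 1 ≤ ‖Complex.exp (Complex.I * omg α u₀ (z ^ 2) * x * sigma3 j j)‖) :
    ψ₁ = ψ₂ := by
  have hX : Continuous fun x => laxX α u₀ u z x t := by
    simp only [laxX_eq]
    exact (continuous_laxXof α _).comp (continuous_space hu t)
  -- The time-dependent factor of the squared normalization, constant in `x`.
  set p : ℂ := Complex.exp (2 * Complex.I * (specK α u₀ z * specLam u₀ z) *
    ((2 * α * specK α u₀ z ^ 2 - 4 * α - (u₀ : ℂ) ^ 2 / α) * t) * sigma3 j j) with hp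
  have hp0 : 0 < ‖p‖ := norm_pos_iff.2 (Complex.exp_ne_zero _)
  refine eq_of_planar_ode_of_tendsto (τ := 0) hX (fun x => laxX_trace z x t)
    (eigY_col_ne_zero c z j) h₁.deriv h₂.deriv h₁.lim h₂.lim (K := ‖p‖⁻¹) ?_
  filter_upwards [hl] with x hx
  have e : Complex.exp (-(Complex.I * theta α u₀ x t z * sigma3 j j)) *
      Complex.exp (-(Complex.I * theta α u₀ x t z * sigma3 j j)) =
      Complex.exp (Complex.I * omg α u₀ (z ^ 2) * x * sigma3 j j) * p := by
    rw [hp, ← Complex.exp_add, ← Complex.exp_add, ← two_mul_specK_mul_specLam α u₀ hz, theta]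
    congr 1
    ring
  rw [e, norm_mul, mul_comm ‖_‖ ‖p‖, inv_mul_cancel_left₀ hp0.ne']
  simpa using hx

/-- At the boundary value, where `u = c` and `u_x = 0`, the normalizing vector is an eigenvector of
`T`, with eigenvalue the `t`-derivative of `iθσ₃`. The normalization is therefore compatible with
the time evolution. -/
theorem laxTof_mulVec_eigY (hα : 0 < α) (hc : ‖c‖ = u₀) {z : ℂ} (hz : z ≠ 0) (j : Fin 2) :
    (laxTof α (specK α u₀ z) c 0).mulVec (fun i => eigY c z i j) =
      (-(Complex.I * (specK α u₀ z * specLam u₀ z *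
        (2 * α * specK α u₀ z ^ 2 - 4 * α - (u₀ : ℂ) ^ 2 / α)) * sigma3 j j)) •
        fun i => eigY c z i j := by
  have hα' : (α : ℂ) ≠ 0 := by exact_mod_cast hα.ne'
  have hcc : c * conj c = (u₀ : ℂ) ^ 2 := by rw [← ofReal_norm_sq, hc]
  have h1 : (specLam u₀ z + α * specK α u₀ z) * z⁻¹ = 1 := by
    rw [specK, specLam]; field_simp; ring
  have h2 : c * conj c * z⁻¹ = specLam u₀ z - α * specK α u₀ z := by
    rw [hcc, specK, specLam]; field_simp; ring
  have h3 : (α : ℂ) * (α : ℂ)⁻¹ = 1 := mul_inv_cancel₀ hα'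
  rw [← hcc]
  generalize specK α u₀ z = k at *
  generalize specLam u₀ z = m at *
  ext i
  fin_cases j <;> fin_cases i <;>
    simp [laxTof, laxTdiag, Matrix.mulVec, dotProduct, Fin.sum_univ_two, eigY, sigma3, offDiag,
      -mul_eq_mul_left_iff, -mul_eq_mul_right_iff, -neg_add_rev, div_eq_mul_inv]
  · linear_combination -(Complex.I * k * (2 * α * k ^ 2 - 4 * α - c * conj c * (α : ℂ)⁻¹)) * h2
      - Complex.I * k ^ 2 * c * conj c * h3
  · linear_combination -(Complex.I * k * (2 * α * k ^ 2 - 4 * α - c * conj c * (α : ℂ)⁻¹) * conj c)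
      * h1 - Complex.I * k ^ 2 * c * conj c * z⁻¹ * conj c * h3
  · linear_combination -(Complex.I * k * (2 * α * k ^ 2 - 4 * α - c * conj c * (α : ℂ)⁻¹) * c)
      * h1 - Complex.I * k ^ 2 * c * conj c * z⁻¹ * c * h3
  · linear_combination Complex.I * k * (2 * α * k ^ 2 - 4 * α - c * conj c * (α : ℂ)⁻¹) * h2
      + Complex.I * k ^ 2 * c * conj c * h3

/-- The slice at time `0` extends to a common solution by zero curvature. The deviation of the
normalized column from its limit satisfies a linear equation in `t` with inhomogeneity `B v`, which
is small uniformly for bounded times since `u` and `u_x` converge locally uniformly; Grönwall's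
inequality carries the limit from time `0` to time `t`. -/
theorem exists_isJostColumn (hα : 0 < α) (hu : IsNZBCSolution α um up u) (hc : ‖c‖ = u₀)
    {l : Filter ℝ} {j : Fin 2} {z : ℂ} (hz : z ≠ 0)
    (hl : TendstoLocallyUniformly (fun x t => u x t) (fun _ => c) l)
    (hl' : TendstoLocallyUniformly (fun x t => deriv (fun y => u y t) x) (fun _ => 0) l)
    {ψ : ℝ → Fin 2 → ℂ} (hψ : IsJostSlice α u₀ u l c j z 0 ψ) :
    ∃ φ, IsJostColumn α u₀ u l c j z φ := by
  obtain ⟨φ, h0, hx, ht⟩ := hu.exists_lax_solution (u₀ := u₀) hα z (ψ 0)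
  have hX : Continuous fun x => laxX α u₀ u z x 0 := by
    simp only [laxX_eq]
    exact (continuous_laxXof α _).comp (continuous_space hu 0)
  have hφ0 : ∀ x, φ x 0 = ψ x := by
    intro x
    refine sub_eq_zero.1 (eq_zero_of_planar_ode hX (y := fun x => φ x 0 - ψ x) (fun x => ?_)
      (x₀ := 0) (by simp [h0]) x)
    exact ((hx x 0).sub (hψ.deriv x)).congr_deriv (Matrix.mulVec_sub _ _ _).symm
  refine ⟨φ, hx, ht, fun t => ?_⟩
  set k := specK α u₀ z with hk
  set v : Fin 2 → ℂ := fun i => eigY c z i j with hv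
  set μ : ℂ := Complex.I * (specK α u₀ z * specLam u₀ z *
        (2 * α * specK α u₀ z ^ 2 - 4 * α - (u₀ : ℂ) ^ 2 / α)) * sigma3 j j with hμ
  set m : ℝ → ℝ → ℂ := fun x t => Complex.exp (-(Complex.I * theta α u₀ x t z * sigma3 j j)) with hm
  let B : ℂ × ℂ → Matrix (Fin 2) (Fin 2) ℂ := fun p => laxTof α k p.1 p.2 + μ • 1
  have hBc : Continuous B := (continuous_laxTof α k).add continuous_const
  have hB0 : (B (c, 0)).mulVec v = 0 := by
    simp only [B, Matrix.add_mulVec, Matrix.smul_mulVec, Matrix.one_mulVec]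
    rw [laxTof_mulVec_eigY hα hc hz j, neg_smul, neg_add_cancel]
  have hdm : ∀ x s, HasDerivAt (fun s => m x s) (m x s * μ) s := by
    intro x s
    have e : m x = fun s : ℝ => Complex.exp (Complex.I * (specK α u₀ z * specLam u₀ z) * x * sigma3 j j + μ * s) := by
      funext s
      simp only [hm, theta, hμ]
      congr 1
      ring
    rw [e]
    simpa using (((Complex.ofRealCLM.hasDerivAt (x := s)).const_mul μ).const_add
      (Complex.I * (specK α u₀ z * specLam u₀ z) * x * sigma3 j j)).cexp
  have hd : ∀ x s, HasDerivAt (fun s => m x s • φ x s - v)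
      ((B (u x s, deriv (fun y => u y s) x)).mulVec (m x s • φ x s - v) +
        (B (u x s, deriv (fun y => u y s) x)).mulVec v) s := by
    intro x s
    refine (((hdm x s).smul (ht x s)).sub_const v).congr_deriv ?_
    rw [← Matrix.mulVec_add, sub_add_cancel]
    simp only [B, Matrix.add_mulVec, Matrix.smul_mulVec, Matrix.one_mulVec, Matrix.mulVec_smul,
      laxT_eq]
    rw [mul_smul, smul_add, add_comm]
  set K := max (entrySum (B (c, 0))) 0 + 1 with hK
  have hd0 : Tendsto (fun x => ‖m x 0 • φ x 0 - v‖) l (𝓝 0) := by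
    have : Tendsto (fun x => ‖m x 0 • ψ x - v‖) l (𝓝 ‖v - v‖) := (hψ.lim.sub_const v).norm
    rw [sub_self, norm_zero] at this
    simpa only [hφ0] using this
  have hlim : Tendsto (fun x => m x t • φ x t - v) l (𝓝 0) := by
    rw [Metric.tendsto_nhds]
    intro ε hε
    set η := ε / (4 * Real.exp (K * |t|)) with hη
    have hη0 : 0 < η := by positivity
    have hev : ∀ᶠ p in 𝓝 (c, (0 : ℂ)), entrySum (B p) < K ∧ ‖(B p).mulVec v‖ < η := by
      refine ((continuous_entrySum.comp hBc).continuousAt.eventually_lt_const ?_).and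
        ((hBc.matrix_mulVec continuous_const).norm.continuousAt.eventually_lt_const ?_)
      · simp only [Function.comp_apply, hK]; linarith [le_max_left (entrySum (B (c, 0))) 0]
      · simpa [hB0] using hη0
    obtain ⟨δ, hδ, hball⟩ := Metric.eventually_nhds_iff.1 hev
    have hcpt : IsCompact (Icc (-|t|) |t|) := isCompact_Icc
    have u1 := Metric.tendstoUniformlyOn_iff.1
      ((tendstoLocallyUniformlyOn_iff_tendstoUniformlyOn_of_compact hcpt).1
        hl.tendstoLocallyUniformlyOn) δ hδ
    have u2 := Metric.tendstoUniformlyOn_iff.1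
      ((tendstoLocallyUniformlyOn_iff_tendstoUniformlyOn_of_compact hcpt).1
        hl'.tendstoLocallyUniformlyOn) δ hδ
    filter_upwards [u1, u2, hd0.eventually_lt_const hη0] with x hx1 hx2 hx3
    have key := norm_le_of_norm_deriv_le (K := K) (ε := η) (R := |t|)
      (by rw [hK]; linarith [le_max_right (entrySum (B (c, 0))) 0]) hη0.le (hd x)
      (fun s hs => by
        have hs' : s ∈ Icc (-|t|) |t| := abs_le.1 hs
        have hb := hball (y := (u x s, deriv (fun y => u y s) x)) (by
          rw [Prod.dist_eq]
          exact max_lt (by rw [dist_comm]; exact hx1 s hs') (by rw [dist_comm]; exact hx2 s hs'))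
        refine (norm_add_le _ _).trans (add_le_add ?_ hb.2.le)
        exact (norm_mulVec_le_entrySum _ _).trans
          (mul_le_mul_of_nonneg_right hb.1.le (norm_nonneg _))) (x := t) le_rfl
    rw [dist_zero_right]
    calc ‖m x t • φ x t - v‖ ≤ _ := key
      _ ≤ (η + η) * Real.exp (K * |t|) := by gcongr
      _ = ε / 2 := by rw [hη]; field_simp; ring
      _ < ε := half_lt_self hε
  have := hlim.add_const v
  simpa using this

/-! ### Jost columns at a fixed time from normalized pairs -/

section Slices

variable {l : Filter ℝ} {H : Set ℂ} {a e : ℂ → ℝ → ℂ} {z : ℂ} {t : ℝ}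

theorem hasDerivAt_theta (x : ℝ) :
    HasDerivAt (fun x : ℝ => theta α u₀ x t z) (-(specK α u₀ z * specLam u₀ z)) x := by
  unfold theta
  exact (((Complex.ofRealCLM.hasDerivAt (x := x)).add_const _).const_mul
    (specK α u₀ z * specLam u₀ z)).neg.congr_deriv (by simp)

/-- Here functions of `z` become functions of `s`: since `k = z κ(s)`, the only odd power of `z`
left is the denominator of the second component. -/
theorem IsJostPair.isJostSlice_zero (h : IsJostPair α u₀ c (fun x => u x t) l H a e) (hα : 0 < α)
    (hz : z ≠ 0) (hs : z ^ 2 ∈ H) : IsJostSlice α u₀ u l c 0 z t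
      (fun x => Complex.exp (Complex.I * theta α u₀ x t z) • ![a (z ^ 2) x, e (z ^ 2) x / z]) := by
  have hα' : (α : ℂ) ≠ 0 := by exact_mod_cast hα.ne'
  constructor
  · intro x
    have hE := ((hasDerivAt_theta (α := α) (u₀ := u₀) (t := t) (z := z) x).const_mul Complex.I).cexp
    refine hasDerivAt_pi.2 fun i => ?_
    fin_cases i
    · refine (hE.mul (h.deriv_fst _ hs x)).congr_deriv ?_
      simp [laxX_eq, laxXof, Matrix.mulVec, dotProduct, Fin.sum_univ_two, kap, specK, specLam]
      field_simp
      ring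
    · refine (hE.mul ((h.deriv_snd _ hs x).div_const z)).congr_deriv ?_
      simp [laxX_eq, laxXof, Matrix.mulVec, dotProduct, Fin.sum_univ_two, kap, specK, specLam]
      field_simp
      ring
  · have h1 := tendsto_pair (h.tendsto_fst _ hs) ((h.tendsto_snd _ hs).div_const z)
    convert h1 using 2 with x
    · rw [smul_smul, ← Complex.exp_add]
      simp [sigma3]
    · ext i
      fin_cases i <;> simp [eigY, sigma3, offDiag]
      ring

/-- Complex conjugation carries the system at `conj s` to the one at `s` with the components
exchanged, so the second column needs no separate construction. -/
theorem IsJostPair.isJostSlice_one (h : IsJostPair α u₀ c (fun x => u x t) l H a e) (hα : 0 < α)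
    (hz : z ≠ 0) (hs : conj (z ^ 2) ∈ H) : IsJostSlice α u₀ u l c 1 z t
      (fun x => Complex.exp (-(Complex.I * theta α u₀ x t z)) •
        ![-(conj (e (conj (z ^ 2)) x) / z), conj (a (conj (z ^ 2)) x)]) := by
  have hα' : (α : ℂ) ≠ 0 := by exact_mod_cast hα.ne'
  constructor
  · intro x
    have hE := ((hasDerivAt_theta (α := α) (u₀ := u₀) (t := t) (z := z) x).const_mul
      Complex.I).neg.cexp
    refine hasDerivAt_pi.2 fun i => ?_
    fin_cases i
    · refine (hE.mul ((hasDerivAt_conj (h.deriv_snd _ hs x)).div_const z).neg).congr_deriv ?_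
      simp only [map_mul, map_add, conj_kap, Complex.conj_conj, Complex.conj_I]
      simp [laxX_eq, laxXof, Matrix.mulVec, dotProduct, Fin.sum_univ_two, kap, specK, specLam]
      field_simp
      ring
    · refine (hE.mul (hasDerivAt_conj (h.deriv_fst _ hs x))).congr_deriv ?_
      simp only [map_mul, map_add, conj_kap, Complex.conj_conj, Complex.conj_I, map_pow,
        Complex.conj_ofReal]
      simp [laxX_eq, laxXof, Matrix.mulVec, dotProduct, Fin.sum_univ_two, kap, specK, specLam]
      field_simp
      ring
  · have h1 := tendsto_pair
      ((((Complex.continuous_conj.tendsto _).comp (h.tendsto_snd _ hs)).div_const z).neg)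
      ((Complex.continuous_conj.tendsto _).comp (h.tendsto_fst _ hs))
    convert h1 using 2 with x
    · rw [smul_smul, ← Complex.exp_add]
      simp [sigma3]
    · ext i
      fin_cases i <;> simp [eigY, sigma3, offDiag]
      ring

end Slices

end MNLS
end

noncomputable section
namespace MNLS

open Set Filter Topology MeasureTheory

/-! ### The Jost solutions in terms of the normalized pairs -/

section Jost

variable {α u₀ : ℝ} {um up c : ℂ} {u : ℝ → ℝ → ℂ} {z : ℂ}

theorem norm_exp_I_mul_omg_conj (α u₀ : ℝ) (s : ℂ) (x : ℝ) :
    ‖Complex.exp (Complex.I * omg α u₀ s * x * (-1))‖ =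
      ‖Complex.exp (Complex.I * omg α u₀ (conj s) * x * 1)‖ := by
  rw [← conj_omg, Complex.norm_exp, Complex.norm_exp]
  simp

theorem one_le_norm_exp_of_neg {w : ℂ} (h : ‖Complex.exp (-w)‖ ≤ 1) : 1 ≤ ‖Complex.exp w‖ := by
  rw [Complex.exp_neg, norm_inv] at h
  exact (inv_le_one₀ (norm_pos_iff.2 (Complex.exp_ne_zero _))).1 h

/-- If normalized pairs exist at each time, then the Jost column `0` exists, and is given by the
pairs. -/
theorem jost_zero_spec {l : Filter ℝ} [l.NeBot] {H : Set ℂ} (hα : 0 < α)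
    (hu : IsNZBCSolution α um up u) (hc : ‖c‖ = u₀)
    (hl : TendstoLocallyUniformly (fun x t => u x t) (fun _ => c) l)
    (hl' : TendstoLocallyUniformly (fun x t => deriv (fun y => u y t) x) (fun _ => 0) l)
    (hH : ∀ s ∈ H, ∀ᶠ x : ℝ in l, ‖Complex.exp (-(Complex.I * omg α u₀ s * x))‖ ≤ 1)
    (hp : ∃ a e, IsJostPair α u₀ c (fun x => u x 0) l H a e) (hz : z ≠ 0) (hs : z ^ 2 ∈ H) :
    IsJostColumn α u₀ u l c 0 z (Classical.epsilon (IsJostColumn α u₀ u l c 0 z)) ∧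
      ∀ t a e, IsJostPair α u₀ c (fun x => u x t) l H a e → ∀ x,
        Classical.epsilon (IsJostColumn α u₀ u l c 0 z) x t =
          Complex.exp (Complex.I * theta α u₀ x t z) • ![a (z ^ 2) x, e (z ^ 2) x / z] := by
  obtain ⟨a₀, e₀, h₀⟩ := hp
  have hex := Classical.epsilon_spec
    (exists_isJostColumn hα hu hc hz hl hl' (h₀.isJostSlice_zero hα hz hs))
  refine ⟨hex, fun t a e h x => ?_⟩
  refine congrFun ((hex.isJostSlice t).unique hu hz (h.isJostSlice_zero hα hz hs) ?_) x
  filter_upwards [hH _ hs] with y hy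
  simpa [sigma3] using one_le_norm_exp_of_neg hy

theorem jost_one_spec {l : Filter ℝ} [l.NeBot] {H : Set ℂ} (hα : 0 < α)
    (hu : IsNZBCSolution α um up u) (hc : ‖c‖ = u₀)
    (hl : TendstoLocallyUniformly (fun x t => u x t) (fun _ => c) l)
    (hl' : TendstoLocallyUniformly (fun x t => deriv (fun y => u y t) x) (fun _ => 0) l)
    (hH : ∀ s ∈ H, ∀ᶠ x : ℝ in l, ‖Complex.exp (-(Complex.I * omg α u₀ s * x))‖ ≤ 1)
    (hp : ∃ a e, IsJostPair α u₀ c (fun x => u x 0) l H a e) (hz : z ≠ 0)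
    (hs : conj (z ^ 2) ∈ H) :
    IsJostColumn α u₀ u l c 1 z (Classical.epsilon (IsJostColumn α u₀ u l c 1 z)) ∧
      ∀ t a e, IsJostPair α u₀ c (fun x => u x t) l H a e → ∀ x,
        Classical.epsilon (IsJostColumn α u₀ u l c 1 z) x t =
          Complex.exp (-(Complex.I * theta α u₀ x t z)) •
            ![-(conj (e (conj (z ^ 2)) x) / z), conj (a (conj (z ^ 2)) x)] := by
  obtain ⟨a₀, e₀, h₀⟩ := hp
  have hex := Classical.epsilon_spec
    (exists_isJostColumn hα hu hc hz hl hl' (h₀.isJostSlice_one hα hz hs))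
  refine ⟨hex, fun t a e h x => ?_⟩
  refine congrFun ((hex.isJostSlice t).unique hu hz (h.isJostSlice_one hα hz hs) ?_) x
  filter_upwards [hH _ hs] with y hy
  have e1 : sigma3 1 1 = -1 := by simp [sigma3]
  rw [e1, norm_exp_I_mul_omg_conj, mul_one]
  exact one_le_norm_exp_of_neg hy

section Spec

variable (hα : 0 < α) (hu : IsNZBCSolution α um up u)
include hα hu

theorem IsNZBCSolution.exists_left_pair (hum : ‖um‖ = u₀) (t : ℝ) :
    ∃ a e, IsJostPair α u₀ um (fun x => u x t) atBot upperH a e :=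
  exists_isJostPair_atBot hα hum (continuous_space hu t) (hu.integrable_left t)

theorem IsNZBCSolution.exists_right_pair (hup : ‖up‖ = u₀) (t : ℝ) :
    ∃ a e, IsJostPair α u₀ up (fun x => u x t) atTop lowerH a e :=
  exists_isJostPair_atTop hα hup (continuous_space hu t) (hu.integrable_right t)

theorem jostMinus_zero_spec (hum : ‖um‖ = u₀) (hz : z ≠ 0) (hs : z ^ 2 ∈ upperH) :
    IsJostColumn α u₀ u atBot um 0 z (jostMinus α u₀ um u 0 z) ∧
      ∀ t a e, IsJostPair α u₀ um (fun x => u x t) atBot upperH a e → ∀ x,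
        jostMinus α u₀ um u 0 z x t =
          Complex.exp (Complex.I * theta α u₀ x t z) • ![a (z ^ 2) x, e (z ^ 2) x / z] :=
  jost_zero_spec hα hu hum hu.tendsto_left hu.deriv_tendsto_left
    (fun _ hs => norm_exp_neg_omg_le_atBot hα hs) (hu.exists_left_pair hα hum 0) hz hs

theorem jostMinus_one_spec (hum : ‖um‖ = u₀) (hz : z ≠ 0) (hs : z ^ 2 ∈ lowerH) :
    IsJostColumn α u₀ u atBot um 1 z (jostMinus α u₀ um u 1 z) ∧
      ∀ t a e, IsJostPair α u₀ um (fun x => u x t) atBot upperH a e → ∀ x,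
        jostMinus α u₀ um u 1 z x t = Complex.exp (-(Complex.I * theta α u₀ x t z)) •
            ![-(conj (e (conj (z ^ 2)) x) / z), conj (a (conj (z ^ 2)) x)] :=
  jost_one_spec hα hu hum hu.tendsto_left hu.deriv_tendsto_left
    (fun _ hs => norm_exp_neg_omg_le_atBot hα hs) (hu.exists_left_pair hα hum 0) hz
    ⟨by rw [Complex.conj_im]; linarith [hs.1], by simpa using hz⟩

theorem jostPlus_zero_spec (hup : ‖up‖ = u₀) (hz : z ≠ 0) (hs : z ^ 2 ∈ lowerH) :
    IsJostColumn α u₀ u atTop up 0 z (jostPlus α u₀ up u 0 z) ∧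
      ∀ t a e, IsJostPair α u₀ up (fun x => u x t) atTop lowerH a e → ∀ x,
        jostPlus α u₀ up u 0 z x t =
          Complex.exp (Complex.I * theta α u₀ x t z) • ![a (z ^ 2) x, e (z ^ 2) x / z] :=
  jost_zero_spec hα hu hup hu.tendsto_right hu.deriv_tendsto_right
    (fun _ hs => norm_exp_neg_omg_le_atTop hα hs) (hu.exists_right_pair hα hup 0) hz hs

end Spec

/-- The Wronskian of two Jost columns does not depend on `x` and `t`. -/
theorem IsJostColumn.wronskian_eq {l₁ l₂ : Filter ℝ} {c₁ c₂ : ℂ} {j₁ j₂ : Fin 2}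
    {φ₁ φ₂ : ℝ → ℝ → Fin 2 → ℂ} (h₁ : IsJostColumn α u₀ u l₁ c₁ j₁ z φ₁)
    (h₂ : IsJostColumn α u₀ u l₂ c₂ j₂ z φ₂) (x t : ℝ) :
    wronskian (φ₁ x t) (φ₂ x t) = wronskian (φ₁ 0 0) (φ₂ 0 0) := by
  have dx : ∀ x t, HasDerivAt (fun y => wronskian (φ₁ y t) (φ₂ y t)) 0 x := fun x t =>
    (hasDerivAt_wronskian (h₁.1 x t) (h₂.1 x t)).congr_deriv (by rw [laxX_trace, zero_mul])
  have dt : ∀ x t, HasDerivAt (fun s => wronskian (φ₁ x s) (φ₂ x s)) 0 t := fun x t =>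
    (hasDerivAt_wronskian (h₁.2.1 x t) (h₂.2.1 x t)).congr_deriv (by rw [laxT_trace, zero_mul])
  have ex : wronskian (φ₁ x t) (φ₂ x t) = wronskian (φ₁ 0 t) (φ₂ 0 t) :=
    is_const_of_deriv_eq_zero (f := fun y => wronskian (φ₁ y t) (φ₂ y t))
      (fun x => (dx x t).differentiableAt) (fun x => (dx x t).deriv) x 0
  rw [ex]
  exact is_const_of_deriv_eq_zero (f := fun s => wronskian (φ₁ 0 s) (φ₂ 0 s))
    (fun s => (dt 0 s).differentiableAt) (fun s => (dt 0 s).deriv) t 0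

/-- Two Jost columns that are proportional at one point are proportional everywhere. -/
theorem IsJostColumn.eq_smul (hu : IsNZBCSolution α um up u) {l₁ l₂ : Filter ℝ} {c₁ c₂ : ℂ}
    {j₁ j₂ : Fin 2} {φ₁ φ₂ : ℝ → ℝ → Fin 2 → ℂ} (h₁ : IsJostColumn α u₀ u l₁ c₁ j₁ z φ₁)
    (h₂ : IsJostColumn α u₀ u l₂ c₂ j₂ z φ₂) {b : ℂ} (hb : φ₁ 0 0 = b • φ₂ 0 0) (x t : ℝ) :
    φ₁ x t = b • φ₂ x t := by
  have hX : Continuous fun x => laxX α u₀ u z x t := by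
    simp only [laxX_eq]
    exact (continuous_laxXof α _).comp (continuous_space hu t)
  have hT : Continuous fun s => laxT α u₀ u z 0 s := by
    have hp : Continuous fun s : ℝ => ((0 : ℝ), s) := by fun_prop
    have c1 : Continuous fun s => u 0 s := hu.smooth.continuous.comp hp
    have c2 : Continuous fun s => deriv (fun y => u y s) 0 := hu.contDiff_deriv.continuous.comp hp
    have c3 : Continuous fun s => (u 0 s, deriv (fun y => u y s) 0) := c1.prodMk c2
    have c4 := (continuous_laxTof α (specK α u₀ z)).comp c3
    simp only [laxT_eq]
    exact c4
  have h0 : ∀ s, φ₁ 0 s - b • φ₂ 0 s = 0 :=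
    eq_zero_of_planar_ode hT (y := fun s => φ₁ 0 s - b • φ₂ 0 s) (fun s => (((h₁.2.1 0 s).sub ((h₂.2.1 0 s).const_smul b))).congr_deriv
      (by rw [Matrix.mulVec_sub, Matrix.mulVec_smul])) (x₀ := 0) (sub_eq_zero.2 hb)
  exact sub_eq_zero.1 (eq_zero_of_planar_ode hX (y := fun x => φ₁ x t - b • φ₂ x t)
    (fun x => (((h₁.1 x t).sub ((h₂.1 x t).const_smul b))).congr_deriv
      (by rw [Matrix.mulVec_sub, Matrix.mulVec_smul])) (x₀ := 0) (h0 t) x)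

theorem detY_eq {u₀ : ℝ} (hz : z ≠ 0) : detY u₀ z = (z ^ 2 + (u₀ : ℂ) ^ 2) / z ^ 2 := by
  rw [detY]; field_simp

theorem exp_mul_exp_neg (w : ℂ) : Complex.exp w * Complex.exp (-w) = 1 := by
  rw [← Complex.exp_add, add_neg_cancel, Complex.exp_zero]

/-- `s₁₁` as a function of `s = z²`. -/
theorem s11_eq (hα : 0 < α) (hu : IsNZBCSolution α um up u) (hum : ‖um‖ = u₀) (hup : ‖up‖ = u₀)
    (hz : z ≠ 0) (hs : z ^ 2 ∈ lowerH) (x : ℝ) {t : ℝ} {a e a' e' : ℂ → ℝ → ℂ}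
    (h : IsJostPair α u₀ um (fun x => u x t) atBot upperH a e)
    (h' : IsJostPair α u₀ up (fun x => u x t) atTop lowerH a' e') :
    s11 α u₀ um up u z = (z ^ 2 * a' (z ^ 2) x * conj (a (conj (z ^ 2)) x) +
      e' (z ^ 2) x * conj (e (conj (z ^ 2)) x)) / (z ^ 2 + (u₀ : ℂ) ^ 2) := by
  obtain ⟨h1, f1⟩ := jostMinus_one_spec hα hu hum hz hs
  obtain ⟨h2, f2⟩ := jostPlus_zero_spec hα hu hup hz hs
  rw [s11, ← h2.wronskian_eq h1 x t, f1 t a e h, f2 t a' e' h', wronskian_smul_smul,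
    exp_mul_exp_neg, detY_eq hz, one_mul]
  rcases eq_or_ne (z ^ 2 + (u₀ : ℂ) ^ 2) 0 with h0 | h0
  · simp [h0]
  · simp only [wronskian, Matrix.cons_val_zero, Matrix.cons_val_one]
    field_simp
    ring

theorem s21_eq_zero_iff (hα : 0 < α) (hu : IsNZBCSolution α um up u) (hum : ‖um‖ = u₀)
    (hup : ‖up‖ = u₀) (hz : z ≠ 0) (hz' : z ^ 2 + (u₀ : ℂ) ^ 2 ≠ 0) (hs : (z ^ 2).im = 0) (x : ℝ)
    {t : ℝ} {a e a' e' : ℂ → ℝ → ℂ}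
    (h : IsJostPair α u₀ um (fun x => u x t) atBot upperH a e)
    (h' : IsJostPair α u₀ up (fun x => u x t) atTop lowerH a' e') :
    s21 α u₀ um up u z = 0 ↔ a (z ^ 2) x * e' (z ^ 2) x = e (z ^ 2) x * a' (z ^ 2) x := by
  have hz2 : z ^ 2 ≠ 0 := pow_ne_zero _ hz
  obtain ⟨h1, f1⟩ := jostMinus_zero_spec hα hu hum hz ⟨hs.ge, hz2⟩
  obtain ⟨h2, f2⟩ := jostPlus_zero_spec hα hu hup hz ⟨hs.le, hz2⟩
  rw [s21, ← h1.wronskian_eq h2 x t, f1 t a e h, f2 t a' e' h', wronskian_smul_smul,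
    detY_eq hz, div_eq_zero_iff, or_iff_left (div_ne_zero hz' hz2), mul_eq_zero,
    or_iff_right (mul_ne_zero (Complex.exp_ne_zero _) (Complex.exp_ne_zero _))]
  simp only [wronskian, Matrix.cons_val_zero, Matrix.cons_val_one]
  rw [sub_eq_zero, mul_div_assoc', div_mul_eq_mul_div, div_left_inj' hz]

/-- At a zero of `s₁₁` the Jost columns are proportional, with the factor `propConst`. -/
theorem propConst_spec (hα : 0 < α) (hu : IsNZBCSolution α um up u) (hum : ‖um‖ = u₀)
    (hup : ‖up‖ = u₀) (hz : z ≠ 0) (hz' : z ^ 2 + (u₀ : ℂ) ^ 2 ≠ 0) (hs : z ^ 2 ∈ lowerH)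
    (h0 : s11 α u₀ um up u z = 0) (x t : ℝ) :
    jostPlus α u₀ up u 0 z x t =
      propConst α u₀ um up u z • jostMinus α u₀ um u 1 z x t := by
  obtain ⟨h1, -⟩ := jostMinus_one_spec hα hu hum hz hs
  obtain ⟨h2, -⟩ := jostPlus_zero_spec hα hu hup hz hs
  have hex : ∃ b : ℂ, ∀ x t : ℝ,
      jostPlus α u₀ up u 0 z x t = b • jostMinus α u₀ um u 1 z x t := by
    -- A column vanishing at one point would vanish for all `x`, against its nonzero normalization.
    have hne : jostMinus α u₀ um u 1 z 0 0 ≠ 0 := by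
      intro h
      have hX : Continuous fun x => laxX α u₀ u z x 0 := by
        simp only [laxX_eq]
        exact (continuous_laxXof α _).comp (continuous_space hu 0)
      have hall := eq_zero_of_planar_ode hX (fun x => h1.1 x 0) h
      refine eigY_col_ne_zero um z 1 (tendsto_nhds_unique (h1.2.2 0) ?_)
      simp [hall]
    have hW : wronskian (jostMinus α u₀ um u 1 z 0 0) (jostPlus α u₀ up u 0 z 0 0) = 0 := by
      rw [s11, detY_eq hz, div_eq_zero_iff,
        or_iff_left (div_ne_zero hz' (pow_ne_zero _ hz))] at h0
      rw [← neg_eq_zero, ← h0]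
      simp only [wronskian]
      ring
    obtain ⟨b, hb⟩ := exists_eq_smul_of_wronskian_eq_zero hne hW
    exact ⟨b, fun x t => h2.eq_smul hu h1 hb x t⟩
  exact Classical.epsilon_spec hex x t

end Jost

end MNLS
end

noncomputable section
namespace MNLS

open Set Filter Topology MeasureTheory

/-!  Gluing holomorphic functions across the real axis -/

section Glue

/-- The function equal to `A` on the closed upper and to `B` on the open lower half-plane. -/
def glue (A B : ℂ → ℂ) (s : ℂ) : ℂ := if 0 ≤ s.im then A s else B s

theorem glue_of_nonneg {A B : ℂ → ℂ} {s : ℂ} (h : 0 ≤ s.im) : glue A B s = A s := if_pos h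

theorem glue_of_neg {A B : ℂ → ℂ} {s : ℂ} (h : s.im < 0) : glue A B s = B s :=
  if_neg (not_le.2 h)

/-- The two pieces agree on the real axis, so the glued function is continuous there, and continuity
across the axis implies holomorphy. -/
theorem differentiableOn_glue {A B : ℂ → ℂ} {U : Set ℂ} (hU : IsOpen U)
    (cA : ContinuousOn A (U ∩ {s | 0 ≤ s.im})) (cB : ContinuousOn B (U ∩ {s | s.im ≤ 0}))
    (heq : ∀ s ∈ U, s.im = 0 → A s = B s) (hA : ∀ s ∈ U, 0 < s.im → DifferentiableAt ℂ A s)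
    (hB : ∀ s ∈ U, s.im < 0 → DifferentiableAt ℂ B s) : DifferentiableOn ℂ (glue A B) U := by
  have c1 : ContinuousOn (glue A B) (U ∩ {s | 0 ≤ s.im}) :=
    cA.congr fun s hs => glue_of_nonneg hs.2
  have c2 : ContinuousOn (glue A B) (U ∩ {s | s.im ≤ 0}) := cB.congr fun s hs => by
    rcases lt_or_eq_of_le (show s.im ≤ 0 from hs.2) with h | h
    · exact glue_of_neg h
    · rw [glue_of_nonneg h.ge, heq s hs.1 h]
  have k1 : IsClosed {s : ℂ | 0 ≤ s.im} := isClosed_le continuous_const Complex.continuous_im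
  have k2 : IsClosed {s : ℂ | s.im ≤ 0} := isClosed_le Complex.continuous_im continuous_const
  have aux : ∀ K : Set ℂ, IsClosed K → ContinuousOn (glue A B) (U ∩ K) → ∀ s ∈ U,
      ContinuousWithinAt (glue A B) (U ∩ K) s := by
    intro K hK hc s hs
    by_cases h : s ∈ K
    · exact hc s ⟨hs, h⟩
    · refine continuousWithinAt_of_notMem_closure fun h' => h ?_
      exact (closure_minimal inter_subset_right hK) h'
  refine differentiableOn_of_continuousOn_of_off_real hU (fun s hs => ?_) fun s hs h => ?_
  · have := (aux _ k1 c1 s hs).union (aux _ k2 c2 s hs)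
    rwa [← inter_union_distrib_left, show {s : ℂ | 0 ≤ s.im} ∪ {s : ℂ | s.im ≤ 0} = univ from
      eq_univ_of_forall fun s => le_total 0 s.im, inter_univ] at this
  · rcases lt_or_gt_of_ne h with h | h
    · refine (hB s hs h).congr_of_eventuallyEq ?_
      filter_upwards [Complex.continuous_im.continuousAt.eventually_lt_const h] with w hw
      exact glue_of_neg hw
    · refine (hA s hs h).congr_of_eventuallyEq ?_
      filter_upwards [Complex.continuous_im.continuousAt.eventually_const_lt h] with w hw
      exact glue_of_nonneg (le_of_lt hw)

/-- If `(w - p) / f` is bounded near an isolated singularity `p` of `f`, and `f` has a finite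
non-zero limit along some approach to `p`, then `f` is bounded near `p`. -/
theorem exists_bound_of_div_bounded {f : ℂ → ℂ} {p v : ℂ}
    (hd : ∀ᶠ w in 𝓝[≠] p, DifferentiableAt ℂ f w) (hne : ∀ᶠ w in 𝓝[≠] p, f w ≠ 0)
    (hb : ∃ C : ℝ, ∀ᶠ w in 𝓝[≠] p, ‖(w - p) / f w‖ ≤ C) {l : Filter ℂ} [l.NeBot]
    (hl : l ≤ 𝓝[≠] p) (hv : v ≠ 0) (hlim : Tendsto f l (𝓝 v)) :
    ∃ C : ℝ, ∀ᶠ w in 𝓝[≠] p, ‖f w‖ ≤ C := by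
  obtain ⟨C, hC⟩ := hb
  obtain ⟨V, hV, hVsub⟩ := mem_nhdsWithin_iff_exists_mem_nhds_inter.1 (hd.and (hne.and hC))
  obtain ⟨r, hr, hrV⟩ := Metric.mem_nhds_iff.1 hV
  have hball : ∀ w ∈ Metric.ball p r, w ≠ p →
      DifferentiableAt ℂ f w ∧ f w ≠ 0 ∧ ‖(w - p) / f w‖ ≤ C := fun w hw hwp =>
    hVsub ⟨hrV hw, hwp⟩
  have hBp : Metric.ball p r ∈ 𝓝 p := Metric.ball_mem_nhds p hr
  set g : ℂ → ℂ := fun w => (w - p) / f w with hg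
  have gd : DifferentiableOn ℂ g (Metric.ball p r \ {p}) := fun w hw => by
    obtain ⟨h1, h2, -⟩ := hball w hw.1 hw.2
    exact (((differentiableAt_id.sub_const p).div h1 h2)).differentiableWithinAt
  have gb : BddAbove (norm ∘ g '' (Metric.ball p r \ {p})) := by
    refine ⟨C, ?_⟩
    rintro _ ⟨w, hw, rfl⟩
    exact (hball w hw.1 hw.2).2.2
  have hext := Complex.differentiableOn_update_limUnder_of_bddAbove hBp gd gb
  set L := limUnder (𝓝[≠] p) g with hL
  have glim : Tendsto g (𝓝[≠] p) (𝓝 L) := by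
    have hc := (hext.differentiableAt hBp).continuousAt
    exact continuousAt_update_same.1 hc
  have hidl : Tendsto (fun w => w - p) l (𝓝 0) := by
    have : Tendsto (fun w => w - p) (𝓝 p) (𝓝 (p - p)) := (continuous_id.sub continuous_const).tendsto p
    rw [sub_self] at this
    exact this.mono_left (hl.trans nhdsWithin_le_nhds)
  -- `g = (w - p) / f` extends holomorphically, and the approach `l` shows that its value at `p` is
  -- `0`. Hence `1 / f` extends too, with value `1 / v ≠ 0` at `p`, and `f` is bounded.
  have hL0 : L = 0 := by
    refine tendsto_nhds_unique (glim.mono_left hl) ?_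
    have := hidl.div hlim hv
    rwa [zero_div] at this
  rw [hL0] at hext
  set G := Function.update g p 0 with hG
  have hk : ContinuousAt (dslope G p) p := by
    have := (Complex.differentiableOn_dslope hBp).2 hext
    exact (this.differentiableAt hBp).continuousAt
  have hkeq : ∀ w ∈ Metric.ball p r, w ≠ p → dslope G p w = (f w)⁻¹ := by
    intro w hw hwp
    have h2 := (hball w hw hwp).2.1
    have h3 : w - p ≠ 0 := sub_ne_zero.2 hwp
    rw [dslope_of_ne _ hwp, slope_def_field, hG, Function.update_self, Function.update_of_ne hwp,
      sub_zero, hg]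
    field_simp
  have hev : ∀ᶠ w in 𝓝[≠] p, dslope G p w = (f w)⁻¹ := by
    filter_upwards [nhdsWithin_le_nhds hBp, self_mem_nhdsWithin] with w hw hwp
    exact hkeq w hw hwp
  have hkp : dslope G p p = v⁻¹ := by
    refine tendsto_nhds_unique ((hk.tendsto.mono_left nhdsWithin_le_nhds).mono_left hl) ?_
    exact (hlim.inv₀ hv).congr' ((hev.filter_mono hl).mono fun w hw => hw.symm)
  have hne' : dslope G p p ≠ 0 := by rw [hkp]; exact inv_ne_zero hv
  have hinv : Tendsto (fun w => ‖(dslope G p w)⁻¹‖) (𝓝 p) (𝓝 ‖(dslope G p p)⁻¹‖) :=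
    (hk.tendsto.inv₀ hne').norm
  refine ⟨‖(dslope G p p)⁻¹‖ + 1, ?_⟩
  filter_upwards [hev, nhdsWithin_le_nhds (hinv.eventually_le_const (lt_add_one _))] with w hw hw'
  rwa [hw, inv_inv] at hw'

theorem tendsto_add_mul_I {p : ℂ} (hp : p.im = 0) :
    Tendsto (fun τ : ℝ => p + τ * Complex.I) (𝓝[>] 0) (𝓝[upperH \ {p}] p) := by
  refine tendsto_nhdsWithin_iff.2 ⟨?_, ?_⟩
  · have : Continuous fun τ : ℝ => p + τ * Complex.I := by fun_prop
    simpa using (this.tendsto 0).mono_left nhdsWithin_le_nhds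
  · filter_upwards [self_mem_nhdsWithin] with τ hτ
    have h0 : (p + τ * Complex.I).im = τ := by simp [hp]
    have hτ' : 0 < τ := hτ
    refine ⟨⟨by rw [h0]; exact hτ'.le, fun h => ?_⟩, fun h => ?_⟩
    · rw [h, Complex.zero_im] at h0; exact hτ'.ne h0
    · rw [mem_singleton_iff.1 h, hp] at h0; exact hτ'.ne h0

theorem eventually_of_continuousOn {f : ℂ → ℂ} {H : Set ℂ} (hf : ContinuousOn f H) {p : ℂ}
    (hp : p ∈ H) {Q : ℂ → Prop} (hQ : ∀ᶠ v in 𝓝 (f p), Q v) : ∀ᶠ w in 𝓝 p, w ∈ H → Q (f w) :=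
  eventually_nhdsWithin_iff.1 ((hf p hp).eventually hQ)

theorem eventually_norm_le_of_continuousOn {f : ℂ → ℂ} {H : Set ℂ} (hf : ContinuousOn f H) {p : ℂ}
    (hp : p ∈ H) : ∀ᶠ w in 𝓝 p, w ∈ H → ‖f w‖ ≤ ‖f p‖ + 1 :=
  eventually_of_continuousOn hf hp (continuous_norm.continuousAt.eventually_le_const (lt_add_one _))

theorem eventually_le_norm_of_continuousOn {f : ℂ → ℂ} {H : Set ℂ} (hf : ContinuousOn f H) {p : ℂ}
    (hp : p ∈ H) (h0 : f p ≠ 0) : ∀ᶠ w in 𝓝 p, w ∈ H → ‖f p‖ / 2 ≤ ‖f w‖ :=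
  eventually_of_continuousOn hf hp
    (continuous_norm.continuousAt.eventually_const_le (half_lt_self (norm_pos_iff.2 h0)))

variable {A P S : ℂ → ℂ} {p : ℂ}

/-- Near a branch point on the real axis, the quotient function `S` stays away from zero. -/
theorem exists_bound_inv_near (hp : p.im = 0) (hp0 : p ≠ 0)
    (cA : ContinuousOn A upperH) (hA : ∀ s ∈ upperH, s.im ≠ 0 → DifferentiableAt ℂ A s)
    (cP : ContinuousOn P lowerH) (hP : ∀ s ∈ lowerH, s.im ≠ 0 → DifferentiableAt ℂ P s)
    (cS : ContinuousOn S (lowerH \ {p})) (hS : ∀ s, s.im < 0 → DifferentiableAt ℂ S s)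
    (jump : ∀ s, s.im = 0 → s ≠ 0 → s ≠ p → P s = S s * A s ∧ S s ≠ 0)
    (hAp : A p ≠ 0) (hPp : P p ≠ 0) (hz : ∀ᶠ s in 𝓝[≠] p, s.im < 0 → S s ≠ 0)
    (hnum : ∃ C : ℝ, ∀ᶠ s in 𝓝[≠] p, s.im < 0 → ‖(s - p) * S s‖ ≤ C) :
    ∃ C : ℝ, ∀ᶠ s in 𝓝[≠] p, s.im < 0 → ‖(S s)⁻¹‖ ≤ C := by
  obtain ⟨C, hC⟩ := hnum
  have hpU : p ∈ upperH := ⟨hp.ge, hp0⟩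
  have hpL : p ∈ lowerH := ⟨hp.le, hp0⟩
  have eA := eventually_le_norm_of_continuousOn cA hpU hAp
  have eP := eventually_le_norm_of_continuousOn cP hpL hPp
  have hA0 : 0 < ‖A p‖ := norm_pos_iff.2 hAp
  have hP0 : 0 < ‖P p‖ := norm_pos_iff.2 hPp
  have eall : ∀ᶠ s in 𝓝[≠] p, (s ∈ upperH → ‖A p‖ / 2 ≤ ‖A s‖) ∧ (s ∈ lowerH → ‖P p‖ / 2 ≤ ‖P s‖) ∧
      (s.im < 0 → S s ≠ 0) ∧ (s.im < 0 → ‖(s - p) * S s‖ ≤ C) ∧ s ≠ 0 ∧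
      ‖s - p‖ ≤ 1 := by
    have e1 : ∀ᶠ s in 𝓝 p, ‖s - p‖ ≤ 1 := by
      filter_upwards [Metric.ball_mem_nhds p one_pos] with s hs
      rw [← dist_eq_norm]; exact (Metric.mem_ball.1 hs).le
    filter_upwards [nhdsWithin_le_nhds eA, nhdsWithin_le_nhds eP, hz, hC,
      nhdsWithin_le_nhds (isOpen_ne.mem_nhds hp0), nhdsWithin_le_nhds e1] with s h1 h2 h3 h4 h5 h6
    exact ⟨h1, h2, h3, h4, h5, h6⟩
  obtain ⟨V, hV, hVsub⟩ := mem_nhdsWithin_iff_exists_mem_nhds_inter.1 eall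
  obtain ⟨W, hWV, hWo, hpW⟩ := mem_nhds_iff.1 hV
  set U := W \ {p} with hU
  have hUo : IsOpen U := hWo.sdiff isClosed_singleton
  have hUmem : U ∈ 𝓝[≠] p := by
    rw [hU, sdiff_eq]
    exact inter_mem (nhdsWithin_le_nhds (hWo.mem_nhds hpW)) self_mem_nhdsWithin
  have hprop := fun s (hs : s ∈ U) => hVsub ⟨hWV hs.1, hs.2⟩
  -- For the glued quotient, `(s - p) / f` is `(s - p) / A` above and `(s - p) S / P` below, both
  -- bounded. From above `f` tends to `A p ≠ 0`, so `exists_bound_of_div_bounded` bounds `P / S`,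
  -- and with it `1 / S`.
  set f := glue A (fun s => P s / S s) with hf
  have hSne : ∀ s ∈ U, s.im ≤ 0 → S s ≠ 0 := by
    intro s hs h
    rcases lt_or_eq_of_le h with h | h
    · exact (hprop s hs).2.2.1 h
    · exact (jump s h (hprop s hs).2.2.2.2.1 hs.2).2
  have hfd : DifferentiableOn ℂ f U := by
    refine differentiableOn_glue hUo ?_ ?_ ?_ ?_ ?_
    · exact cA.mono fun s hs => ⟨hs.2, (hprop s hs.1).2.2.2.2.1⟩
    · refine (cP.mono fun s hs => ?_).div (cS.mono fun s hs => ?_) fun s hs => hSne s hs.1 hs.2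
      · exact ⟨hs.2, (hprop s hs.1).2.2.2.2.1⟩
      · exact ⟨⟨hs.2, (hprop s hs.1).2.2.2.2.1⟩, hs.1.2⟩
    · intro s hs h
      obtain ⟨h1, h2⟩ := jump s h (hprop s hs).2.2.2.2.1 hs.2
      rw [h1, mul_div_cancel_left₀ _ h2]
    · exact fun s hs h => hA s ⟨h.le, (hprop s hs).2.2.2.2.1⟩ h.ne'
    · exact fun s hs h => (hP s ⟨h.le, (hprop s hs).2.2.2.2.1⟩ h.ne).div (hS s h)
        (hSne s hs h.le)
  have hfb : ∃ C : ℝ, ∀ᶠ w in 𝓝[≠] p, ‖f w‖ ≤ C := by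
    refine exists_bound_of_div_bounded (v := A p)
      (l := map (fun τ : ℝ => p + τ * Complex.I) (𝓝[>] 0)) ?_ ?_ ?_ ?_ hAp ?_
    · filter_upwards [hUmem] with w hw using hfd.differentiableAt (hUo.mem_nhds hw)
    · filter_upwards [hUmem] with w hw
      rcases le_or_gt 0 w.im with h | h
      · rw [hf, glue_of_nonneg h]
        have := (hprop w hw).1 ⟨h, (hprop w hw).2.2.2.2.1⟩
        exact norm_pos_iff.1 (by linarith)
      · rw [hf, glue_of_neg h]
        have := (hprop w hw).2.1 ⟨h.le, (hprop w hw).2.2.2.2.1⟩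
        exact div_ne_zero (norm_pos_iff.1 (by linarith)) (hSne w hw h.le)
    · refine ⟨max (1 / (‖A p‖ / 2)) (C / (‖P p‖ / 2)), ?_⟩
      filter_upwards [hUmem] with w hw
      rcases le_or_gt 0 w.im with h | h
      · rw [hf, glue_of_nonneg h, norm_div]
        have := (hprop w hw).1 ⟨h, (hprop w hw).2.2.2.2.1⟩
        exact le_max_of_le_left (div_le_div₀ zero_le_one (hprop w hw).2.2.2.2.2 (by positivity) this)
      · rw [hf, glue_of_neg h, div_div_eq_mul_div, norm_div]
        have h1 := (hprop w hw).2.1 ⟨h.le, (hprop w hw).2.2.2.2.1⟩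
        have h2 := (hprop w hw).2.2.2.1 h
        exact le_max_of_le_right (div_le_div₀ ((norm_nonneg _).trans h2) h2 (by positivity) h1)
    · exact (tendsto_add_mul_I hp).mono_right (nhdsWithin_mono _ fun s hs => hs.2)
    · rw [tendsto_map'_iff]
      refine ((cA p hpU).tendsto.comp
        ((tendsto_add_mul_I hp).mono_right (nhdsWithin_mono _ sdiff_subset))).congr' ?_
      filter_upwards [self_mem_nhdsWithin] with τ hτ
      have h0 : (p + τ * Complex.I).im = τ := by simp [hp]
      simp only [Function.comp_apply, hf]
      rw [glue_of_nonneg (by rw [h0]; exact le_of_lt hτ)]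
  obtain ⟨K, hK⟩ := hfb
  refine ⟨K / (‖P p‖ / 2), ?_⟩
  filter_upwards [hK, hUmem] with s hs hsU h
  rw [hf, glue_of_neg h, norm_div] at hs
  have h1 := (hprop s hsU).2.1 ⟨h.le, (hprop s hsU).2.2.2.2.1⟩
  have h2 : 0 < ‖S s‖ := norm_pos_iff.2 (hSne s hsU h.le)
  rw [norm_inv, le_div_iff₀ (by positivity)]
  refine le_trans ?_ hs
  rw [div_eq_inv_mul ‖P s‖]
  exact mul_le_mul_of_nonneg_left h1 (by positivity)

/-- Partial fraction expansion of a function that continues to the lower half-plane as a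
quotient with simple poles. -/
theorem exists_partial_fractions {ι : Type*} [Fintype ι] {σ : ι → ℂ} (hσ : Function.Injective σ)
    (hσim : ∀ j, (σ j).im < 0) (hp : p.im = 0)
    (cA : ContinuousOn A upperH) (hA : ∀ s ∈ upperH, s.im ≠ 0 → DifferentiableAt ℂ A s)
    (cP : ContinuousOn P lowerH) (hP : ∀ s ∈ lowerH, s.im ≠ 0 → DifferentiableAt ℂ P s)
    (cS : ContinuousOn S (lowerH \ {p})) (hS : ∀ s, s.im < 0 → DifferentiableAt ℂ S s)
    (jump : ∀ s, s.im = 0 → s ≠ 0 → s ≠ p → P s = S s * A s ∧ S s ≠ 0)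
    (hzero : ∀ s, s.im < 0 → S s = 0 → ∃ j, s = σ j) (hσ0 : ∀ j, S (σ j) = 0)
    (hsimple : ∀ j, deriv S (σ j) ≠ 0)
    (b0 : ∃ C : ℝ, ∀ᶠ s in 𝓝[≠] 0, ‖glue A (fun s => P s / S s) s‖ ≤ C)
    (bp : ∃ C : ℝ, ∀ᶠ s in 𝓝[≠] p, ‖glue A (fun s => P s / S s) s‖ ≤ C)
    (binf : ∃ C R : ℝ, ∀ s, R ≤ ‖s‖ → ‖glue A (fun s => P s / S s) s‖ ≤ C) :
    ∃ c, ∀ s, 0 < s.im → A s = c + ∑ j, P (σ j) / deriv S (σ j) / (s - σ j) := by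
  classical
  set f := glue A (fun s => P s / S s) with hf
  set Z : Set ℂ := {0, p} ∪ range σ with hZ
  have hZfin : Z.Finite := (toFinite {0, p}).union (finite_range σ)
  have hZo : IsOpen Zᶜ := hZfin.isClosed.isOpen_compl
  have hmem : ∀ s ∈ Zᶜ, s ≠ 0 ∧ s ≠ p ∧ ∀ j, s ≠ σ j := fun s hs => by
    simp only [hZ, mem_compl_iff, mem_union, mem_insert_iff, mem_singleton_iff, mem_range,
      not_or, not_exists] at hs
    exact ⟨hs.1.1, hs.1.2, fun j h => hs.2 j h.symm⟩
  have hSne : ∀ s ∈ Zᶜ, s.im ≤ 0 → S s ≠ 0 := by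
    intro s hs h h0
    rcases lt_or_eq_of_le h with h | h
    · obtain ⟨j, hj⟩ := hzero s h h0
      exact (hmem s hs).2.2 j hj
    · exact (jump s h (hmem s hs).1 (hmem s hs).2.1).2 h0
  have hfd : DifferentiableOn ℂ f Zᶜ := by
    refine differentiableOn_glue hZo ?_ ?_ ?_ ?_ ?_
    · exact cA.mono fun s hs => ⟨hs.2, (hmem s hs.1).1⟩
    · refine (cP.mono fun s hs => ?_).div (cS.mono fun s hs => ?_) fun s hs => hSne s hs.1 hs.2
      · exact ⟨hs.2, (hmem s hs.1).1⟩
      · exact ⟨⟨hs.2, (hmem s hs.1).1⟩, (hmem s hs.1).2.1⟩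
    · intro s hs h
      obtain ⟨h1, h2⟩ := jump s h (hmem s hs).1 (hmem s hs).2.1
      rw [h1, mul_div_cancel_left₀ _ h2]
    · exact fun s hs h => hA s ⟨h.le, (hmem s hs).1⟩ h.ne'
    · exact fun s hs h => (hP s ⟨h.le, (hmem s hs).1⟩ h.ne).div (hS s h) (hSne s hs h.le)
  set r : ι → ℂ := fun j => P (σ j) / deriv S (σ j) with hr
  -- boundedness of partial sums of the principal parts
  have hsum : ∀ (T : Finset ι) (q : ℂ), (∀ j ∈ T, q ≠ σ j) →
      ∃ C : ℝ, ∀ᶠ s in 𝓝[≠] q, ‖∑ j ∈ T, r j / (s - σ j)‖ ≤ C := by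
    intro T q hq
    have hc : ContinuousAt (fun s => ∑ j ∈ T, r j / (s - σ j)) q := by
      refine tendsto_finsetSum _ fun j hj => ?_
      exact (continuousAt_const.div (continuousAt_id.sub continuousAt_const)
        (sub_ne_zero.2 (hq j hj)))
    exact ⟨_, nhdsWithin_le_nhds (hc.norm.eventually_le_const (lt_add_one _))⟩
  have hadd : ∀ {f g : ℂ → ℂ} {l : Filter ℂ}, (∃ C : ℝ, ∀ᶠ s in l, ‖f s‖ ≤ C) →
      (∃ C : ℝ, ∀ᶠ s in l, ‖g s‖ ≤ C) → ∃ C : ℝ, ∀ᶠ s in l, ‖f s - g s‖ ≤ C := by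
    rintro f g l ⟨C₁, h₁⟩ ⟨C₂, h₂⟩
    refine ⟨C₁ + C₂, ?_⟩
    filter_upwards [h₁, h₂] with s a b
    exact (norm_sub_le _ _).trans (add_le_add a b)
  -- Once all principal parts are subtracted, every point of `Z` is a removable singularity, and
  -- Liouville's theorem applies.
  suffices h : ∃ c, ∀ s ∉ Z, f s - ∑ j, r j / (s - σ j) = c by
    obtain ⟨c, hc⟩ := h
    refine ⟨c, fun s hs => ?_⟩
    have hsZ : s ∉ Z := by
      simp only [hZ, mem_union, mem_insert_iff, mem_singleton_iff, mem_range, not_or, not_exists]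
      refine ⟨⟨?_, ?_⟩, fun j => ?_⟩
      · rintro rfl; simp at hs
      · rintro rfl; exact hs.ne' hp
      · rintro rfl; exact lt_asymm hs (hσim j)
    have := hc s hsZ
    rw [sub_eq_iff_eq_add, hf, glue_of_nonneg hs.le] at this
    exact this
  refine exists_eq_const_of_differentiableAt_off_finite hZfin ?_ ?_ ?_
  · intro s hs
    have hs' : s ∈ Zᶜ := hs
    refine (hfd.differentiableAt (hZo.mem_nhds hs')).sub (DifferentiableAt.fun_sum fun j _ => ?_)
    exact (differentiableAt_const _).div (differentiableAt_id.sub_const _)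
      (sub_ne_zero.2 ((hmem s hs').2.2 j))
  · intro q hq
    simp only [hZ, mem_union, mem_insert_iff, mem_singleton_iff, mem_range] at hq
    rcases hq with (rfl | rfl) | ⟨j, rfl⟩
    · exact hadd b0 (hsum _ _ fun j _ h => by have := hσim j; rw [← h] at this; simp at this)
    · exact hadd bp (hsum _ _ fun j _ h => by have := hσim j; rw [← h] at this; exact this.ne hp)
    · have hlow : {s : ℂ | s.im < 0} ∈ 𝓝 (σ j) :=
        (isOpen_lt Complex.continuous_im continuous_const).mem_nhds (hσim j)
      have hne0 : ∀ s : ℂ, s.im < 0 → s ∈ lowerH := fun s hs =>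
        ⟨hs.le, by rintro rfl; simp at hs⟩
      have aP : AnalyticAt ℂ P (σ j) := by
        rw [Complex.analyticAt_iff_eventually_differentiableAt]
        filter_upwards [hlow] with s hs using hP s (hne0 s hs) (ne_of_lt hs)
      have aS : AnalyticAt ℂ S (σ j) := by
        rw [Complex.analyticAt_iff_eventually_differentiableAt]
        filter_upwards [hlow] with s hs using hS s hs
      obtain ⟨C, hC⟩ := div_sub_principal_part_bounded aP aS (hσ0 j) (hsimple j)
      have h1 : ∃ C : ℝ, ∀ᶠ s in 𝓝[≠] (σ j), ‖f s - r j / (s - σ j)‖ ≤ C := by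
        refine ⟨C, ?_⟩
        filter_upwards [hC, nhdsWithin_le_nhds hlow] with s hs hs'
        rw [hf, glue_of_neg hs']
        exact hs
      obtain ⟨C', hC'⟩ := hadd h1 (hsum (Finset.univ.erase j) (σ j) fun i hi h =>
        (Finset.ne_of_mem_erase hi) (hσ h).symm)
      refine ⟨C', hC'.mono fun s hs => ?_⟩
      rw [← Finset.add_sum_erase _ _ (Finset.mem_univ j)]
      rwa [sub_sub] at hs
  · obtain ⟨C, R, hCR⟩ := binf
    have hR : ∀ j, ∃ K : ℝ, 0 ≤ K ∧ ∀ s, ‖σ j‖ + 1 ≤ ‖s‖ → ‖r j / (s - σ j)‖ ≤ K := by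
      intro j
      refine ⟨‖r j‖, norm_nonneg _, fun s hs => ?_⟩
      rw [norm_div]
      refine div_le_self (norm_nonneg _) ?_
      have := norm_sub_norm_le s (σ j)
      linarith
    choose K hK0 hK using hR
    refine ⟨C + ∑ j, K j, max R (∑ j, (‖σ j‖ + 1)), fun s hs => ?_⟩
    refine (norm_sub_le _ _).trans (add_le_add (hCR s ((le_max_left _ _).trans hs)) ?_)
    refine (norm_sum_le _ _).trans (Finset.sum_le_sum fun j _ => hK j s ?_)
    refine le_trans ?_ ((le_max_right _ _).trans hs)
    exact Finset.single_le_sum (f := fun j => ‖σ j‖ + 1) (fun i _ => by positivity)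
      (Finset.mem_univ j)

end Glue

end MNLS
end

noncomputable section
namespace MNLS

open Set Filter Topology MeasureTheory

/-! ### The reflectionless Riemann–Hilbert problem in the variable `s` -/

section JumpProblem

theorem conj_mem_lowerH {s : ℂ} (hs : s ∈ upperH) : conj s ∈ lowerH :=
  ⟨by rw [Complex.conj_im]; linarith [hs.1], by simpa using hs.2⟩

theorem conj_mem_upperH {s : ℂ} (hs : s ∈ lowerH) : conj s ∈ upperH :=
  ⟨by rw [Complex.conj_im]; linarith [hs.1], by simpa using hs.2⟩

theorem inversion_im (u₀ : ℝ) (s : ℂ) :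
    ((u₀ : ℂ) ^ 4 / conj s).im = u₀ ^ 4 / Complex.normSq s * s.im := by
  have e : (u₀ : ℂ) ^ 4 / conj s = ((u₀ ^ 4 : ℝ) : ℂ) * (conj s)⁻¹ := by push_cast; rfl
  rw [e, Complex.im_ofReal_mul, Complex.inv_im]
  simp
  ring

theorem inversion_ne_zero {u₀ : ℝ} (hu : 0 < u₀) {s : ℂ} (hs : s ≠ 0) :
    (u₀ : ℂ) ^ 4 / conj s ≠ 0 :=
  div_ne_zero (pow_ne_zero _ (by exact_mod_cast hu.ne')) (by simpa using hs)

theorem inversion_mem_upperH {u₀ : ℝ} (hu : 0 < u₀) {s : ℂ} (hs : s ∈ upperH) :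
    (u₀ : ℂ) ^ 4 / conj s ∈ upperH := by
  refine ⟨?_, inversion_ne_zero hu hs.2⟩
  rw [inversion_im]
  exact mul_nonneg (div_nonneg (by positivity) (Complex.normSq_nonneg s)) hs.1

theorem inversion_mem_lowerH {u₀ : ℝ} (hu : 0 < u₀) {s : ℂ} (hs : s ∈ lowerH) :
    (u₀ : ℂ) ^ 4 / conj s ∈ lowerH := by
  refine ⟨?_, inversion_ne_zero hu hs.2⟩
  rw [inversion_im]
  exact mul_nonpos_of_nonneg_of_nonpos (div_nonneg (by positivity) (Complex.normSq_nonneg s)) hs.1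

theorem norm_inversion {u₀ : ℝ} (s : ℂ) : ‖(u₀ : ℂ) ^ 4 / conj s‖ = u₀ ^ 4 / ‖s‖ := by
  rw [norm_div, norm_pow, Complex.norm_real, Real.norm_eq_abs, RCLike.norm_conj,
    Even.pow_abs ⟨2, rfl⟩]

/-- The properties, as functions of `s = z²`, of the components of a normalized solution at a
fixed point: `A` and `E` live on the closed half-plane `H`. -/
structure HalfPlaneData (u₀ : ℝ) (c μ : ℂ) (H : Set ℂ) (A E : ℂ → ℂ) : Prop where
  cont_fst : ContinuousOn A H
  cont_snd : ContinuousOn E H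
  hol_fst : ∀ s ∈ H, s.im ≠ 0 → DifferentiableAt ℂ A s
  hol_snd : ∀ s ∈ H, s.im ≠ 0 → DifferentiableAt ℂ E s
  inv_fst : ∀ s ∈ H, A s = -(conj c / (u₀ : ℂ) ^ 2 * conj (E ((u₀ : ℂ) ^ 4 / conj s)))
  inv_snd : ∀ s ∈ H, E s = -(conj c * conj (A ((u₀ : ℂ) ^ 4 / conj s)))
  ne_zero : ∀ s ∈ H, A s ≠ 0 ∨ E s ≠ 0
  norm_lim : ‖c‖ = u₀
  norm_phase : ‖μ‖ = 1
  asymp : ∃ M R : ℝ, 0 ≤ M ∧ 0 < R ∧ ∀ s ∈ H, R ≤ ‖s‖ → ‖A s - μ‖ ≤ M / ‖s‖ ∧ ‖E s‖ ≤ M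

variable {u₀ : ℝ} {c μ : ℂ} {H : Set ℂ} {A E : ℂ → ℂ}

theorem HalfPlaneData.exists_bound_large (h : HalfPlaneData u₀ c μ H A E) :
    ∃ C R : ℝ, 0 ≤ C ∧ 0 < R ∧ ∀ s ∈ H, R ≤ ‖s‖ → ‖A s‖ ≤ C ∧ ‖E s‖ ≤ C := by
  obtain ⟨M, R, hM, hR, hb⟩ := h.asymp
  refine ⟨M / R + 1 + M, R, by positivity, hR, fun s hs hsR => ?_⟩
  obtain ⟨h1, h2⟩ := hb s hs hsR
  have h3 : M / ‖s‖ ≤ M / R := div_le_div_of_nonneg_left hM hR hsR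
  have h4 : ‖A s‖ ≤ ‖A s - μ‖ + ‖μ‖ := by simpa using norm_add_le (A s - μ) μ
  rw [h.norm_phase] at h4
  exact ⟨by linarith, by linarith [div_nonneg hM hR.le]⟩

/-- The inversion `s ↦ u₀⁴ / conj s` exchanges neighbourhoods of `0` and `∞`, so the bounds for
large `s` transfer. -/
theorem HalfPlaneData.exists_bound_small (h : HalfPlaneData u₀ c μ H A E) (hu : 0 < u₀)
    (hH : ∀ s ∈ H, (u₀ : ℂ) ^ 4 / conj s ∈ H) (hH0 : (0 : ℂ) ∉ H) :
    ∃ C δ : ℝ, 0 ≤ C ∧ 0 < δ ∧ ∀ s ∈ H, ‖s‖ ≤ δ → ‖A s‖ ≤ C ∧ ‖E s‖ ≤ C := by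
  obtain ⟨C, R, hC, hR, hb⟩ := h.exists_bound_large
  refine ⟨C / u₀ + u₀ * C, u₀ ^ 4 / R, by positivity, by positivity, fun s hs hsR => ?_⟩
  have hs0 : 0 < ‖s‖ := norm_pos_iff.2 fun h0 => hH0 (h0 ▸ hs)
  obtain ⟨h1, h2⟩ := hb _ (hH s hs) (by
    rw [norm_inversion, le_div_iff₀ hs0]
    rw [le_div_iff₀ hR] at hsR
    linarith)
  rw [h.inv_fst s hs, h.inv_snd s hs, norm_neg, norm_neg, norm_mul, norm_mul, norm_div,
    RCLike.norm_conj, RCLike.norm_conj, RCLike.norm_conj, h.norm_lim, norm_pow, Complex.norm_real,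
    Real.norm_of_nonneg hu.le]
  have e1 : u₀ / u₀ ^ 2 = 1 / u₀ := by field_simp
  rw [e1]
  constructor
  · calc 1 / u₀ * ‖E _‖ ≤ 1 / u₀ * C := by gcongr
      _ ≤ C / u₀ + u₀ * C := by
        rw [one_div_mul_eq_div]; exact le_add_of_nonneg_right (by positivity)
  · calc u₀ * ‖A _‖ ≤ u₀ * C := by gcongr
      _ ≤ C / u₀ + u₀ * C := le_add_of_nonneg_left (by positivity)

/-- The coefficient `s₁₁` in terms of the two normalized solutions. -/
def scat (u₀ : ℝ) (A E P R : ℂ → ℂ) (s : ℂ) : ℂ :=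
  (s * P s * conj (A (conj s)) + R s * conj (E (conj s))) / (s + (u₀ : ℂ) ^ 2)

/-- Two normalized solutions related by a jump condition without reflection. -/
structure JumpProblem (u₀ : ℝ) (cm cp μ μ' : ℂ) (A E P R : ℂ → ℂ) : Prop where
  pos : 0 < u₀
  left : HalfPlaneData u₀ cm μ upperH A E
  right : HalfPlaneData u₀ cp μ' lowerH P R
  form : ∀ s : ℂ, s.im = 0 → s ≠ 0 → s * A s * conj (A s) + E s * conj (E s) = s + (u₀ : ℂ) ^ 2
  jump : ∀ s : ℂ, s.im = 0 → s ≠ 0 → s ≠ -(u₀ : ℂ) ^ 2 →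
    A s * R s = E s * P s ∧ scat u₀ A E P R s ≠ 0

variable {cm cp μ' : ℂ} {P R : ℂ → ℂ}

/-- The jump condition makes `(P, R)` proportional to `(A, E)` on the axis; pairing with `(A, E)`,
whose form value is `s + u₀²`, identifies the factor as `scat`. -/
theorem JumpProblem.eq_scat_mul (h : JumpProblem u₀ cm cp μ μ' A E P R) {s : ℂ} (hs : s.im = 0)
    (hs0 : s ≠ 0) (hsp : s ≠ -(u₀ : ℂ) ^ 2) :
    P s = scat u₀ A E P R s * A s ∧ R s = scat u₀ A E P R s * E s := by
  have hd : s + (u₀ : ℂ) ^ 2 ≠ 0 := fun h0 => hsp (eq_neg_of_add_eq_zero_left h0)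
  have hc : conj s = s := Complex.conj_eq_iff_im.2 hs
  have hf := h.form s hs hs0
  have hj := (h.jump s hs hs0 hsp).1
  rw [scat, hc, div_mul_eq_mul_div, div_mul_eq_mul_div, eq_div_iff hd, eq_div_iff hd]
  constructor
  · linear_combination (-P s) * hf - conj (E s) * hj
  · linear_combination (-R s) * hf + s * conj (A s) * hj

/-- Applying the inversion to both pairs changes `scat` only by conjugation and the unimodular
factor `conj cp * cm / u₀²`. This moves the lower bound at `∞` to `0`. -/
theorem JumpProblem.norm_scat_inversion (h : JumpProblem u₀ cm cp μ μ' A E P R) {s : ℂ}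
    (hs : s ∈ lowerH) : ‖scat u₀ A E P R ((u₀ : ℂ) ^ 4 / conj s)‖ = ‖scat u₀ A E P R s‖ := by
  have hu : (u₀ : ℂ) ≠ 0 := by exact_mod_cast h.pos.ne'
  have hs0 : s ≠ 0 := hs.2
  have hcs : conj s ≠ 0 := by simpa using hs0
  set r : ℂ := (u₀ : ℂ) ^ 4 / conj s with hr
  have hcr : (u₀ : ℂ) ^ 4 / s = conj r := by simp [hr]
  have key : scat u₀ A E P R s = conj cp * cm / (u₀ : ℂ) ^ 2 * conj (scat u₀ A E P R r) := by
    have h1 := h.right.inv_fst s hs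
    have h2 := h.right.inv_snd s hs
    have h3 := h.left.inv_fst (conj s) (conj_mem_upperH hs)
    have h4 := h.left.inv_snd (conj s) (conj_mem_upperH hs)
    rw [Complex.conj_conj, hcr] at h3 h4
    rw [← hr] at h1 h2
    rw [scat, scat, h1, h2, h3, h4]
    simp only [map_neg, map_mul, map_div₀, map_add, map_pow, Complex.conj_conj,
      Complex.conj_ofReal]
    have hcr' : conj r = (u₀ : ℂ) ^ 4 / s := hcr.symm
    rw [hcr']
    rcases eq_or_ne (s + (u₀ : ℂ) ^ 2) 0 with h0 | h0
    · have h0' : (u₀ : ℂ) ^ 4 / s + (u₀ : ℂ) ^ 2 = 0 := by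
        field_simp
        linear_combination (u₀ : ℂ) ^ 2 * h0
      rw [h0, h0', div_zero, div_zero, mul_zero]
    · have h0' : (u₀ : ℂ) ^ 4 / s + (u₀ : ℂ) ^ 2 ≠ 0 := by
        intro h1
        refine h0 ?_
        rw [div_add' _ _ _ hs0, div_eq_zero_iff, or_iff_left hs0] at h1
        exact (mul_eq_zero.1 (show (u₀ : ℂ) ^ 2 * (s + (u₀ : ℂ) ^ 2) = 0 by linear_combination h1)).resolve_left
          (pow_ne_zero _ hu)
      have h0'' : (u₀ : ℂ) ^ 2 + s ≠ 0 := by rwa [add_comm]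
      rw [div_add' _ _ _ hs0, show (u₀ : ℂ) ^ 4 + (u₀ : ℂ) ^ 2 * s = (u₀ : ℂ) ^ 2 * (s + (u₀ : ℂ) ^ 2) by ring]
      field_simp
      ring
  have hn : ‖conj cp * cm / (u₀ : ℂ) ^ 2‖ = 1 := by
    rw [norm_div, norm_mul, RCLike.norm_conj, h.right.norm_lim, h.left.norm_lim, norm_pow,
      Complex.norm_real, Real.norm_of_nonneg h.pos.le, ← sq, div_self (pow_ne_zero _ h.pos.ne')]
  rw [key, norm_mul, hn, one_mul, RCLike.norm_conj]

/-- `scat` tends to `μ' conj μ`, which has modulus `1`. -/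
theorem JumpProblem.exists_scat_large (h : JumpProblem u₀ cm cp μ μ' A E P R) :
    ∃ r : ℝ, 0 < r ∧ ∀ s ∈ lowerH, r ≤ ‖s‖ → ‖(scat u₀ A E P R s)⁻¹‖ ≤ 2 := by
  obtain ⟨M, r, hM, hr, hb⟩ := h.left.asymp
  obtain ⟨M', r', hM', hr', hb'⟩ := h.right.asymp
  set K := M' * (1 + M) + M + M' * M + u₀ ^ 2 with hK
  have hK0 : 0 ≤ K := by positivity
  -- Beyond `2 * K + u₀ ^ 2 + 1` one has `K ≤ (‖s‖ - u₀²) / 2`, which puts `scat` within `1/2` of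
  -- its limit.
  refine ⟨max (max r r') (2 * K + u₀ ^ 2 + 1), by positivity, fun s hs hsr => ?_⟩
  have hsr1 : r ≤ ‖s‖ := (le_max_left _ _).trans ((le_max_left _ _).trans hsr)
  have hsr2 : r' ≤ ‖s‖ := (le_max_right _ _).trans ((le_max_left _ _).trans hsr)
  have hsr3 : 2 * K + u₀ ^ 2 + 1 ≤ ‖s‖ := (le_max_right _ _).trans hsr
  have hs1 : 1 ≤ ‖s‖ := by nlinarith [sq_nonneg u₀]
  have hs0 : 0 < ‖s‖ := by linarith
  obtain ⟨a1, a2⟩ := hb (conj s) (conj_mem_upperH hs) (by rwa [RCLike.norm_conj])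
  obtain ⟨b1, b2⟩ := hb' s hs hsr2
  rw [RCLike.norm_conj] at a1
  set a := A (conj s)
  set e := E (conj s)
  have hden : ‖s‖ - u₀ ^ 2 ≤ ‖s + (u₀ : ℂ) ^ 2‖ := by
    have := norm_sub_norm_le s (-(u₀ : ℂ) ^ 2)
    rw [norm_neg, norm_pow, Complex.norm_real, Real.norm_of_nonneg h.pos.le, sub_neg_eq_add] at this
    exact this
  have hden0 : 0 < ‖s + (u₀ : ℂ) ^ 2‖ := by nlinarith
  have hden1 : s + (u₀ : ℂ) ^ 2 ≠ 0 := norm_pos_iff.1 hden0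
  have hdiff : scat u₀ A E P R s - μ' * conj μ =
      (s * (P s - μ') * conj a + s * μ' * conj (a - μ) + R s * conj e
        - (u₀ : ℂ) ^ 2 * (μ' * conj μ)) / (s + (u₀ : ℂ) ^ 2) := by
    rw [scat, eq_div_iff hden1, sub_mul, div_mul_cancel₀ _ hden1, map_sub]
    ring
  have ha : ‖a‖ ≤ 1 + M := by
    have h4 : ‖a‖ ≤ ‖a - μ‖ + ‖μ‖ := by simpa using norm_add_le (a - μ) μ
    rw [h.left.norm_phase] at h4
    have : M / ‖s‖ ≤ M := div_le_self hM hs1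
    linarith
  have hnum : ‖s * (P s - μ') * conj a + s * μ' * conj (a - μ) + R s * conj e
        - (u₀ : ℂ) ^ 2 * (μ' * conj μ)‖ ≤ K := by
    refine (norm_sub_le _ _).trans (add_le_add ((norm_add_le _ _).trans (add_le_add
      ((norm_add_le _ _).trans (add_le_add ?_ ?_)) ?_)) ?_)
    · rw [norm_mul, norm_mul, RCLike.norm_conj]
      refine mul_le_mul ?_ ha (norm_nonneg _) hM'
      rwa [le_div_iff₀ hs0, mul_comm] at b1
    · rw [norm_mul, norm_mul, RCLike.norm_conj, h.right.norm_phase, mul_one]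
      rwa [le_div_iff₀ hs0, mul_comm] at a1
    · rw [norm_mul, RCLike.norm_conj]
      exact mul_le_mul b2 a2 (norm_nonneg _) hM'
    · rw [norm_mul, norm_mul, RCLike.norm_conj, h.right.norm_phase, h.left.norm_phase, norm_pow,
        Complex.norm_real, Real.norm_of_nonneg h.pos.le, mul_one, mul_one]
  have hdiff' : ‖scat u₀ A E P R s - μ' * conj μ‖ ≤ 1 / 2 := by
    rw [hdiff, norm_div, div_le_iff₀ hden0]
    linarith
  have hone : ‖μ' * conj μ‖ = 1 := by
    rw [norm_mul, RCLike.norm_conj, h.right.norm_phase, h.left.norm_phase, one_mul]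
  have hlow : 1 / 2 ≤ ‖scat u₀ A E P R s‖ := by
    have := norm_sub_norm_le (μ' * conj μ) (μ' * conj μ - scat u₀ A E P R s)
    rw [sub_sub_cancel, hone, norm_sub_rev] at this
    linarith
  rw [norm_inv]
  exact inv_le_of_inv_le₀ two_pos (by linarith)

theorem JumpProblem.exists_scat_small (h : JumpProblem u₀ cm cp μ μ' A E P R) :
    ∃ δ : ℝ, 0 < δ ∧ ∀ s ∈ lowerH, ‖s‖ ≤ δ → ‖(scat u₀ A E P R s)⁻¹‖ ≤ 2 := by
  obtain ⟨r, hr, hb⟩ := h.exists_scat_large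
  have hu := h.pos
  refine ⟨u₀ ^ 4 / r, by positivity, fun s hs hsr => ?_⟩
  have := hb _ (inversion_mem_lowerH hu hs) (by
    rw [norm_inversion, le_div_iff₀ (norm_pos_iff.2 hs.2)]
    rw [le_div_iff₀ hr] at hsr
    linarith)
  rwa [norm_inv, h.norm_scat_inversion hs, ← norm_inv] at this

theorem continuousOn_conj_comp_conj {A : ℂ → ℂ} (h : ContinuousOn A upperH) :
    ContinuousOn (fun s => conj (A (conj s))) lowerH :=
  Complex.continuous_conj.comp_continuousOn
    (h.comp Complex.continuous_conj.continuousOn fun _ hs => conj_mem_upperH hs)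

theorem HalfPlaneData.differentiableAt_fst (h : HalfPlaneData u₀ c μ upperH A E) {s : ℂ}
    (hs : s.im < 0) : DifferentiableAt ℂ (fun s => conj (A (conj s))) s := by
  have h0 : s ∈ lowerH := ⟨hs.le, by rintro rfl; simp at hs⟩
  have h1 := (h.hol_fst _ (conj_mem_upperH h0) (by rw [Complex.conj_im]; linarith)).conj_conj
  rw [Complex.conj_conj] at h1
  exact h1

theorem HalfPlaneData.differentiableAt_snd (h : HalfPlaneData u₀ c μ upperH A E) {s : ℂ}
    (hs : s.im < 0) : DifferentiableAt ℂ (fun s => conj (E (conj s))) s := by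
  have h0 : s ∈ lowerH := ⟨hs.le, by rintro rfl; simp at hs⟩
  have h1 := (h.hol_snd _ (conj_mem_upperH h0) (by rw [Complex.conj_im]; linarith)).conj_conj
  rw [Complex.conj_conj] at h1
  exact h1

end JumpProblem

end MNLS
end

/-! ### Behaviour at the branch point and partial fractions for the jump problem -/

noncomputable section
namespace MNLS

open Set Filter Topology MeasureTheory

section JumpProblem

variable {u₀ : ℝ} {μ μ' cm cp : ℂ} {A E P R : ℂ → ℂ}

theorem JumpProblem.continuousOn_numerator (h : JumpProblem u₀ cm cp μ μ' A E P R) :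
    ContinuousOn (fun s => s * P s * conj (A (conj s)) + R s * conj (E (conj s))) lowerH :=
  ((continuousOn_id.mul h.right.cont_fst).mul (continuousOn_conj_comp_conj h.left.cont_fst)).add
    (h.right.cont_snd.mul (continuousOn_conj_comp_conj h.left.cont_snd))

theorem JumpProblem.continuousOn_scat (h : JumpProblem u₀ cm cp μ μ' A E P R) :
    ContinuousOn (scat u₀ A E P R) (lowerH \ {-(u₀ : ℂ) ^ 2}) :=
  (h.continuousOn_numerator.mono sdiff_subset).div (by fun_prop) fun s hs h0 =>
    hs.2 (eq_neg_of_add_eq_zero_left h0)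

theorem JumpProblem.differentiableAt_scat (h : JumpProblem u₀ cm cp μ μ' A E P R) {s : ℂ}
    (hs : s.im < 0) : DifferentiableAt ℂ (scat u₀ A E P R) s := by
  have h0 : s ∈ lowerH := ⟨hs.le, by rintro rfl; simp at hs⟩
  have hP := h.right.hol_fst s h0 hs.ne
  have hR := h.right.hol_snd s h0 hs.ne
  refine (((differentiableAt_id.mul hP).mul (h.left.differentiableAt_fst hs)).add
    (hR.mul (h.left.differentiableAt_snd hs))).div (by fun_prop) fun h1 => ?_
  have := congrArg Complex.im h1
  rw [← Complex.ofReal_pow, Complex.add_im, Complex.ofReal_im, add_zero, Complex.zero_im] at this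
  exact hs.ne this

theorem branch_im (u₀ : ℝ) : (-(u₀ : ℂ) ^ 2).im = 0 := by
  rw [← Complex.ofReal_pow, Complex.neg_im, Complex.ofReal_im, neg_zero]

theorem branch_ne_zero {u₀ : ℝ} (hu : 0 < u₀) : -(u₀ : ℂ) ^ 2 ≠ 0 :=
  neg_ne_zero.2 (pow_ne_zero _ (by exact_mod_cast hu.ne'))

/-- At the branch point the two solutions are proportional. -/
theorem JumpProblem.jump_branch (h : JumpProblem u₀ cm cp μ μ' A E P R) :
    A (-(u₀ : ℂ) ^ 2) * R (-(u₀ : ℂ) ^ 2) = E (-(u₀ : ℂ) ^ 2) * P (-(u₀ : ℂ) ^ 2) := by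
  have hp := branch_im u₀
  have hp0 := branch_ne_zero h.pos
  set p : ℂ := -(u₀ : ℂ) ^ 2
  have hpU : p ∈ upperH := ⟨hp.ge, hp0⟩
  have hpL : p ∈ lowerH := ⟨hp.le, hp0⟩
  have ht : Tendsto (fun τ : ℝ => p + τ) (𝓝[≠] 0) (𝓝 p) := by
    have : Continuous fun τ : ℝ => p + τ := by fun_prop
    simpa using (this.tendsto 0).mono_left nhdsWithin_le_nhds
  have him : ∀ τ : ℝ, (p + τ).im = 0 := fun τ => by simp [hp]
  have hne := ht.eventually (isOpen_ne.mem_nhds hp0)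
  have tU : Tendsto (fun τ : ℝ => p + τ) (𝓝[≠] 0) (𝓝[upperH] p) :=
    tendsto_nhdsWithin_iff.2 ⟨ht, hne.mono fun τ h => ⟨(him τ).ge, h⟩⟩
  have tL : Tendsto (fun τ : ℝ => p + τ) (𝓝[≠] 0) (𝓝[lowerH] p) :=
    tendsto_nhdsWithin_iff.2 ⟨ht, hne.mono fun τ h => ⟨(him τ).le, h⟩⟩
  have l1 := ((h.left.cont_fst p hpU).tendsto.comp tU).mul ((h.right.cont_snd p hpL).tendsto.comp tL)
  have l2 := ((h.left.cont_snd p hpU).tendsto.comp tU).mul ((h.right.cont_fst p hpL).tendsto.comp tL)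
  refine tendsto_nhds_unique l1 (l2.congr' ?_)
  filter_upwards [hne, self_mem_nhdsWithin] with τ h1 h2
  refine (h.jump _ (him τ) h1 fun h3 => h2 ?_).1.symm
  have h4 : p + τ = p := h3
  simpa using h4

/-- At the branch point the two pairs are proportional and neither is zero, so some component is
nonzero for both of them. The argument of `exists_bound_inv_near` is run with that component. -/
theorem JumpProblem.exists_scat_near (h : JumpProblem u₀ cm cp μ μ' A E P R)
    (hz : ∀ᶠ s in 𝓝[≠] (-(u₀ : ℂ) ^ 2), s.im < 0 → scat u₀ A E P R s ≠ 0) :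
    ∃ C : ℝ, ∀ᶠ s in 𝓝[≠] (-(u₀ : ℂ) ^ 2), s.im < 0 → ‖(scat u₀ A E P R s)⁻¹‖ ≤ C := by
  have hj := h.jump_branch
  have hp := branch_im u₀
  have hp0 := branch_ne_zero h.pos
  have hpL : -(u₀ : ℂ) ^ 2 ∈ lowerH := ⟨hp.le, hp0⟩
  have hnum : ∃ C : ℝ, ∀ᶠ s in 𝓝[≠] (-(u₀ : ℂ) ^ 2), s.im < 0 →
      ‖(s - -(u₀ : ℂ) ^ 2) * scat u₀ A E P R s‖ ≤ C := by
    obtain ⟨C, ev⟩ : ∃ C : ℝ, ∀ᶠ s in 𝓝[≠] (-(u₀ : ℂ) ^ 2), s ∈ lowerH →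
        ‖s * P s * conj (A (conj s)) + R s * conj (E (conj s))‖ ≤ C :=
      ⟨_, (eventually_norm_le_of_continuousOn h.continuousOn_numerator hpL).filter_mono
      nhdsWithin_le_nhds⟩
    refine ⟨C, ev.mono fun s hs hs' => ?_⟩
    have hs0 : s ∈ lowerH := ⟨hs'.le, by rintro rfl; simp at hs'⟩
    rw [sub_neg_eq_add, scat, mul_div_cancel₀]
    · exact hs hs0
    · intro h1
      rw [eq_neg_of_add_eq_zero_left h1, hp] at hs'
      exact lt_irrefl _ hs'
  have hR := h.right.ne_zero _ hpL
  rcases h.left.ne_zero _ ⟨hp.ge, hp0⟩ with hA | hE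
  · have hP : P (-(u₀ : ℂ) ^ 2) ≠ 0 := fun h0 => by
      rw [h0, mul_zero, mul_eq_zero, or_iff_right hA] at hj
      exact hR.elim (fun h => h h0) fun h => h hj
    exact exists_bound_inv_near hp hp0 h.left.cont_fst h.left.hol_fst h.right.cont_fst
      h.right.hol_fst h.continuousOn_scat (fun s => h.differentiableAt_scat)
      (fun s h1 h2 h3 => ⟨(h.eq_scat_mul h1 h2 h3).1, (h.jump s h1 h2 h3).2⟩) hA hP hz hnum
  · have hP : R (-(u₀ : ℂ) ^ 2) ≠ 0 := fun h0 => by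
      rw [h0, mul_zero, eq_comm, mul_eq_zero, or_iff_right hE] at hj
      exact hR.elim (fun h => h hj) fun h => h h0
    exact exists_bound_inv_near hp hp0 h.left.cont_snd h.left.hol_snd h.right.cont_snd
      h.right.hol_snd h.continuousOn_scat (fun s => h.differentiableAt_scat)
      (fun s h1 h2 h3 => ⟨(h.eq_scat_mul h1 h2 h3).2, (h.jump s h1 h2 h3).2⟩) hE hP hz hnum

/-- Partial fraction expansion of the solution of the jump problem. -/
theorem JumpProblem.partial_fractions (h : JumpProblem u₀ cm cp μ μ' A E P R) {ι : Type*}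
    [Fintype ι] {σ : ι → ℂ} (hσ : Function.Injective σ) (hσim : ∀ j, (σ j).im < 0)
    (hzero : ∀ s : ℂ, s.im < 0 → scat u₀ A E P R s = 0 → ∃ j, s = σ j)
    (hσ0 : ∀ j, scat u₀ A E P R (σ j) = 0) (hsimple : ∀ j, deriv (scat u₀ A E P R) (σ j) ≠ 0) :
    (∃ c, ∀ s : ℂ, 0 < s.im →
      A s = c + ∑ j, P (σ j) / deriv (scat u₀ A E P R) (σ j) / (s - σ j)) ∧
    (∃ c, ∀ s : ℂ, 0 < s.im →
      E s = c + ∑ j, R (σ j) / deriv (scat u₀ A E P R) (σ j) / (s - σ j)) := by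
  have hp := branch_im u₀
  have hp0 := branch_ne_zero h.pos
  have hpL : -(u₀ : ℂ) ^ 2 ∈ lowerH := ⟨hp.le, hp0⟩
  have hpU : -(u₀ : ℂ) ^ 2 ∈ upperH := ⟨hp.ge, hp0⟩
  have hz : ∀ᶠ s in 𝓝[≠] (-(u₀ : ℂ) ^ 2), s.im < 0 → scat u₀ A E P R s ≠ 0 := by
    have : (range σ)ᶜ ∈ 𝓝 (-(u₀ : ℂ) ^ 2) := by
      refine (finite_range σ).isClosed.isOpen_compl.mem_nhds ?_
      rintro ⟨j, hj⟩
      have := hσim j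
      rw [hj, hp] at this
      exact lt_irrefl _ this
    filter_upwards [nhdsWithin_le_nhds this] with s hs h1 h2
    obtain ⟨j, hj⟩ := hzero s h1 h2
    exact hs ⟨j, hj.symm⟩
  obtain ⟨K, hK⟩ := h.exists_scat_near hz
  obtain ⟨δ, hδ, hS0⟩ := h.exists_scat_small
  obtain ⟨r, hr, hSi⟩ := h.exists_scat_large
  obtain ⟨C₁, δ₁, hC₁, hδ₁, hb₁⟩ := h.left.exists_bound_small h.pos
    (fun s hs => inversion_mem_upperH h.pos hs) fun h => h.2 rfl
  obtain ⟨C₂, δ₂, hC₂, hδ₂, hb₂⟩ := h.right.exists_bound_small h.pos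
    (fun s hs => inversion_mem_lowerH h.pos hs) fun h => h.2 rfl
  obtain ⟨C₃, r₃, hC₃, hr₃, hb₃⟩ := h.left.exists_bound_large
  obtain ⟨C₄, r₄, hC₄, hr₄, hb₄⟩ := h.right.exists_bound_large
  have low : ∀ s : ℂ, s.im < 0 → s ∈ lowerH := fun s hs => ⟨hs.le, by rintro rfl; simp at hs⟩
  -- Both components satisfy the same jump relation with the same `scat`, so one argument serves for
  -- `(A, P)` and `(E, R)`.
  have key : ∀ {A' P' : ℂ → ℂ}, ContinuousOn A' upperH →
      (∀ s ∈ upperH, s.im ≠ 0 → DifferentiableAt ℂ A' s) → ContinuousOn P' lowerH →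
      (∀ s ∈ lowerH, s.im ≠ 0 → DifferentiableAt ℂ P' s) →
      (∀ s : ℂ, s.im = 0 → s ≠ 0 → s ≠ -(u₀ : ℂ) ^ 2 → P' s = scat u₀ A E P R s * A' s) →
      (∀ s ∈ upperH, ‖s‖ ≤ δ₁ → ‖A' s‖ ≤ C₁) → (∀ s ∈ lowerH, ‖s‖ ≤ δ₂ → ‖P' s‖ ≤ C₂) →
      (∀ s ∈ upperH, r₃ ≤ ‖s‖ → ‖A' s‖ ≤ C₃) → (∀ s ∈ lowerH, r₄ ≤ ‖s‖ → ‖P' s‖ ≤ C₄) →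
      ∃ c, ∀ s : ℂ, 0 < s.im →
        A' s = c + ∑ j, P' (σ j) / deriv (scat u₀ A E P R) (σ j) / (s - σ j) := by
    intro A' P' cA hA cP hP jump b₁ b₂ b₃ b₄
    refine exists_partial_fractions hσ hσim hp cA hA cP hP h.continuousOn_scat
      (fun s => h.differentiableAt_scat)
      (fun s h1 h2 h3 => ⟨jump s h1 h2 h3, (h.jump s h1 h2 h3).2⟩) hzero hσ0 hsimple ?_ ?_ ?_
    · refine ⟨max C₁ (C₂ * 2), ?_⟩
      have hm : 0 < min δ (min δ₁ δ₂) := lt_min hδ (lt_min hδ₁ hδ₂)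
      filter_upwards [nhdsWithin_le_nhds (Metric.ball_mem_nhds 0 hm), self_mem_nhdsWithin]
        with s hs hs0
      rw [Metric.mem_ball, dist_zero_right, lt_min_iff, lt_min_iff] at hs
      rcases le_or_gt 0 s.im with h0 | h0
      · rw [glue_of_nonneg h0]
        exact (b₁ s ⟨h0, hs0⟩ hs.2.1.le).trans (le_max_left _ _)
      · rw [glue_of_neg h0, div_eq_mul_inv, norm_mul]
        exact (mul_le_mul (b₂ s (low s h0) hs.2.2.le) (hS0 s (low s h0) hs.1.le) (norm_nonneg _)
          hC₂).trans (le_max_right _ _)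
    · refine ⟨max (‖A' (-(u₀ : ℂ) ^ 2)‖ + 1) ((‖P' (-(u₀ : ℂ) ^ 2)‖ + 1) * K), ?_⟩
      filter_upwards [hK, nhdsWithin_le_nhds (eventually_norm_le_of_continuousOn cA hpU),
        nhdsWithin_le_nhds (eventually_norm_le_of_continuousOn cP hpL),
        nhdsWithin_le_nhds (isOpen_ne.mem_nhds hp0)] with s h1 h2 h3 hs0
      rcases le_or_gt 0 s.im with h0 | h0
      · rw [glue_of_nonneg h0]
        exact (h2 ⟨h0, hs0⟩).trans (le_max_left _ _)
      · rw [glue_of_neg h0, div_eq_mul_inv, norm_mul]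
        exact (mul_le_mul (h3 (low s h0)) (h1 h0) (norm_nonneg _)
          (by positivity)).trans (le_max_right _ _)
    · refine ⟨max C₃ (C₄ * 2), max r (max r₃ r₄), fun s hs => ?_⟩
      rw [max_le_iff, max_le_iff] at hs
      rcases le_or_gt 0 s.im with h0 | h0
      · rw [glue_of_nonneg h0]
        have hs0 : s ≠ 0 := norm_pos_iff.1 (hr.trans_le hs.1)
        exact (b₃ s ⟨h0, hs0⟩ hs.2.1).trans (le_max_left _ _)
      · rw [glue_of_neg h0, div_eq_mul_inv, norm_mul]
        exact (mul_le_mul (b₄ s (low s h0) hs.2.2) (hSi s (low s h0) hs.1) (norm_nonneg _)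
          hC₄).trans (le_max_right _ _)
  exact ⟨key h.left.cont_fst h.left.hol_fst h.right.cont_fst h.right.hol_fst
      (fun s h1 h2 h3 => (h.eq_scat_mul h1 h2 h3).1) (fun s hs h1 => (hb₁ s hs h1).1)
      (fun s hs h1 => (hb₂ s hs h1).1) (fun s hs h1 => (hb₃ s hs h1).1)
      (fun s hs h1 => (hb₄ s hs h1).1),
    key h.left.cont_snd h.left.hol_snd h.right.cont_snd h.right.hol_snd
      (fun s h1 h2 h3 => (h.eq_scat_mul h1 h2 h3).2) (fun s hs h1 => (hb₁ s hs h1).2)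
      (fun s hs h1 => (hb₂ s hs h1).2) (fun s hs h1 => (hb₃ s hs h1).2)
      (fun s hs h1 => (hb₄ s hs h1).2)⟩

end JumpProblem

end MNLS
end

noncomputable section
namespace MNLS

open Set Filter Topology MeasureTheory

/-! ### The jump problem of a reflectionless solution -/

section Assembly

variable {α u₀ : ℝ} {um up : ℂ} {u : ℝ → ℝ → ℂ}

theorem norm_exp_I_mul_real (ν : ℝ) : ‖Complex.exp (Complex.I * ν)‖ = 1 := by
  rw [mul_comm]; exact Complex.norm_exp_ofReal_mul_I ν

theorem IsNZBCSolution.isLeftPotential (hu : IsNZBCSolution α um up u) (hum : ‖um‖ = u₀) (t : ℝ) :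
    IsLeftPotential u₀ um (fun x => u x t) (fun x => deriv (fun y => u y t) x) where
  norm_lim := hum
  deriv x := hu.hasDerivAt_space x t
  cont_deriv := hu.contDiff_deriv.continuous.comp (by fun_prop : Continuous fun x : ℝ => (x, t))
  lim := hu.tendsto_left.tendstoLocallyUniformlyOn.tendsto_at (mem_univ t)
  integrable := hu.integrable_left t
  integrable_deriv := (hu.deriv_integrable t).integrableOn

theorem IsNZBCSolution.isLeftPotential_reflect (hu : IsNZBCSolution α um up u) (hup : ‖up‖ = u₀)
    (t : ℝ) : IsLeftPotential u₀ (conj up) (fun x => conj (u (-x) t))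
      (fun x => -conj (deriv (fun y => u y t) (-x))) where
  norm_lim := by rw [RCLike.norm_conj, hup]
  deriv x := by
    have h := (hu.hasDerivAt_space (-x) t).scomp x (hasDerivAt_neg x)
    exact (hasDerivAt_conj h).congr_deriv (by simp)
  cont_deriv := by
    have h1 : Continuous fun x => deriv (fun y => u y t) (-x) :=
      hu.contDiff_deriv.continuous.comp (by fun_prop : Continuous fun x : ℝ => (-x, t))
    exact (Complex.continuous_conj.comp h1).neg
  lim := (Complex.continuous_conj.tendsto _).comp
    ((hu.tendsto_right.tendstoLocallyUniformlyOn.tendsto_at (mem_univ t)).comp tendsto_neg_atBot_atTop)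
  integrable := by
    have h := (hu.integrable_right t).comp_neg
    simpa [← map_sub] using h
  integrable_deriv := by
    have h := (hu.deriv_integrable t).comp_neg
    refine Integrable.integrableOn ?_
    refine Integrable.neg ?_
    exact (Complex.conjLIE.toContinuousLinearEquiv.toContinuousLinearMap.integrable_comp h)

theorem IsJostPair.halfPlaneData_left {a e : ℂ → ℝ → ℂ} (hα : 0 < α) (hu₀ : 0 < u₀)
    (hu : IsNZBCSolution α um up u) (hum : ‖um‖ = u₀) {t : ℝ}
    (h : IsJostPair α u₀ um (fun x => u x t) atBot upperH a e) (x : ℝ) :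
    HalfPlaneData u₀ um (Complex.exp (Complex.I * phase α u₀ (fun x => u x t) x)) upperH
      (fun s => a s x) (fun s => e s x) where
  cont_fst := h.cont_fst x
  cont_snd := h.cont_snd x
  hol_fst := h.hol_fst x
  hol_snd := h.hol_snd x
  inv_fst _ hs := (h.inversion hu₀ hum (continuous_space hu t) hs hs.2
    (inversion_mem_upperH hu₀ hs) (norm_exp_neg_omg_le_atBot hα hs) x).1
  inv_snd _ hs := (h.inversion hu₀ hum (continuous_space hu t) hs hs.2
    (inversion_mem_upperH hu₀ hs) (norm_exp_neg_omg_le_atBot hα hs) x).2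
  ne_zero _ hs := h.ne_zero (continuous_space hu t) hs x
  norm_lim := hum
  norm_phase := norm_exp_I_mul_real _
  asymp := h.exists_asymptotics hα (hu.isLeftPotential hum t) x

/-- The asymptotics come from the left end: reflection and conjugation turn the right pair into a
left pair for `conj (u (-x) t)`, which explains the form of the phase. -/
theorem IsJostPair.halfPlaneData_right {a e : ℂ → ℝ → ℂ} (hα : 0 < α) (hu₀ : 0 < u₀)
    (hu : IsNZBCSolution α um up u) (hup : ‖up‖ = u₀) {t : ℝ}
    (h : IsJostPair α u₀ up (fun x => u x t) atTop lowerH a e) (x : ℝ) :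
    HalfPlaneData u₀ up
      (conj (Complex.exp (Complex.I * phase α u₀ (fun x => conj (u (-x) t)) (-x)))) lowerH
      (fun s => a s x) (fun s => e s x) where
  cont_fst := h.cont_fst x
  cont_snd := h.cont_snd x
  hol_fst := h.hol_fst x
  hol_snd := h.hol_snd x
  inv_fst _ hs := (h.inversion hu₀ hup (continuous_space hu t) hs hs.2
    (inversion_mem_lowerH hu₀ hs) (norm_exp_neg_omg_le_atTop hα hs) x).1
  inv_snd _ hs := (h.inversion hu₀ hup (continuous_space hu t) hs hs.2
    (inversion_mem_lowerH hu₀ hs) (norm_exp_neg_omg_le_atTop hα hs) x).2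
  ne_zero _ hs := h.ne_zero (continuous_space hu t) hs x
  norm_lim := hup
  norm_phase := by rw [RCLike.norm_conj]; exact norm_exp_I_mul_real _
  asymp := by
    have h' : IsJostPair α u₀ (conj (conj up)) (fun x => conj (conj (u (- -x) t))) atTop lowerH a e := by
      simpa using h
    have h2 := h'.reflect (c := conj up) (w := fun x => conj (u (-x) t)) (l' := atBot)
      (H' := upperH) tendsto_neg_atBot_atTop fun s hs => conj_mem_lowerH hs
    obtain ⟨M, R, hM, hR, hb⟩ := h2.exists_asymptotics hα (hu.isLeftPotential_reflect hup t) (-x)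
    refine ⟨M, R, hM, hR, fun s hs hsR => ?_⟩
    have := hb (conj s) (conj_mem_upperH hs) (by rwa [RCLike.norm_conj])
    simp only [Complex.conj_conj, neg_neg, RCLike.norm_conj] at this
    refine ⟨?_, this.2⟩
    rw [← RCLike.norm_conj, map_sub, Complex.conj_conj]
    exact this.1

theorem exists_sq_eq (s : ℂ) : ∃ z : ℂ, z ^ 2 = s :=
  IsAlgClosed.exists_pow_nat_eq s two_pos

theorem sq_im (z : ℂ) : (z ^ 2).im = 2 * (z.re * z.im) := by
  rw [sq, Complex.mul_im]; ring

/-- The real `s` other than `0` and `-u₀²` are the squares of points of the contour, so the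
hypotheses there become the jump condition on the real axis. -/
theorem jumpProblem_of_reflectionless {a e a' e' : ℂ → ℝ → ℂ} (hα : 0 < α) (hu₀ : 0 < u₀)
    (hu : IsNZBCSolution α um up u) (hum : ‖um‖ = u₀) (hup : ‖up‖ = u₀)
    (hρ : IsReflectionless α u₀ um up u) {t : ℝ}
    (h : IsJostPair α u₀ um (fun x => u x t) atBot upperH a e)
    (h' : IsJostPair α u₀ up (fun x => u x t) atTop lowerH a' e') (x : ℝ) :
    JumpProblem u₀ um up (Complex.exp (Complex.I * phase α u₀ (fun x => u x t) x))
      (conj (Complex.exp (Complex.I * phase α u₀ (fun x => conj (u (-x) t)) (-x))))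
      (fun s => a s x) (fun s => e s x) (fun s => a' s x) (fun s => e' s x) where
  pos := hu₀
  left := h.halfPlaneData_left hα hu₀ hu hum x
  right := h'.halfPlaneData_right hα hu₀ hu hup x
  form s hs hs0 := by
    have hc : conj s = s := Complex.conj_eq_iff_im.2 hs
    have hsU : s ∈ upperH := ⟨hs.ge, hs0⟩
    have := h.form_self hum hsU (by rwa [hc]) x
    rwa [hc] at this
  jump s hs hs0 hsp := by
    obtain ⟨z, rfl⟩ := exists_sq_eq s
    have hz : z ≠ 0 := by rintro rfl; simp at hs0
    have hz' : z ^ 2 + (u₀ : ℂ) ^ 2 ≠ 0 := fun h0 => hsp (eq_neg_of_add_eq_zero_left h0)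
    have him : z.re * z.im = 0 := by rw [sq_im] at hs; linarith
    obtain ⟨h1, h2⟩ := hρ z ⟨him, hz, hz'⟩
    have h3 : s21 α u₀ um up u z = 0 := (div_eq_zero_iff.1 h2).resolve_right h1
    refine ⟨(s21_eq_zero_iff hα hu hum hup hz hz' hs x h h').1 h3, ?_⟩
    rw [s11_eq hα hu hum hup hz ⟨hs.le, hs0⟩ x h h'] at h1
    exact h1

/-! ### The discrete spectrum -/

section Spectrum

variable {N₁ N₂ : ℕ} {zs : Fin N₁ → ℂ} {ws : Fin N₂ → ℂ}

/-- Written as a negative real multiple of `z_n`, the reflected point is seen to lie in `D⁺`. -/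
theorem zeta_inl_inr (u₀ : ℝ) (zs : Fin N₁ → ℂ) (ws : Fin N₂ → ℂ) (n : Fin N₁) :
    zeta u₀ zs ws (Sum.inl (Sum.inr n)) = -((u₀ ^ 2 / ‖zs n‖ ^ 2 : ℝ) : ℂ) * zs n := by
  rcases eq_or_ne (zs n) 0 with h | h
  · simp [zeta, h]
  · have h1 : conj (zs n) ≠ 0 := by simpa using h
    simp only [zeta, Sum.elim_inl, Sum.elim_inr]
    push_cast
    rw [ofReal_norm_sq, neg_mul, div_mul_eq_mul_div, mul_comm (zs n), mul_div_mul_right _ _ h]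

theorem HasSimpleDiscreteSpectrum.ws_prop (hspec : HasSimpleDiscreteSpectrum α u₀ um up u zs ws)
    (hu₀ : 0 < u₀) (m : Fin N₂) : (ws m).re < 0 ∧ 0 < (ws m).im ∧ ‖ws m‖ = u₀ := by
  obtain ⟨φ, h1, h2, h3⟩ := hspec.ws_mem m
  have hr : (ws m).re = u₀ * Real.cos φ := by
    rw [h3, mul_comm Complex.I, Complex.re_ofReal_mul, Complex.exp_ofReal_mul_I_re]
  have hi : (ws m).im = u₀ * Real.sin φ := by
    rw [h3, mul_comm Complex.I, Complex.im_ofReal_mul, Complex.exp_ofReal_mul_I_im]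
  refine ⟨?_, ?_, ?_⟩
  · rw [hr]
    exact mul_neg_of_pos_of_neg hu₀ (Real.cos_neg_of_pi_div_two_lt_of_lt h1 (by linarith [Real.pi_pos]))
  · rw [hi]
    exact mul_pos hu₀ (Real.sin_pos_of_pos_of_lt_pi (by linarith [Real.pi_pos]) h2)
  · rw [h3, norm_mul, norm_exp_I_mul_real, mul_one, Complex.norm_real, Real.norm_of_nonneg hu₀.le]

theorem HasSimpleDiscreteSpectrum.zeta_mem (hspec : HasSimpleDiscreteSpectrum α u₀ um up u zs ws)
    (hu₀ : 0 < u₀) (j : SpecIdx N₁ N₂) : zeta u₀ zs ws j ∈ Dplus := by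
  rcases j with (n | n) | m
  · exact (hspec.zs_mem n).1
  · rw [zeta_inl_inr]
    obtain ⟨h1, -, h3⟩ := hspec.zs_mem n
    have hq : 0 < u₀ ^ 2 / ‖zs n‖ ^ 2 := by
      have : 0 < ‖zs n‖ := hu₀.trans h3
      positivity
    show (_ : ℝ) < 0
    rw [← Complex.ofReal_neg, Complex.re_ofReal_mul, Complex.im_ofReal_mul]
    have h1' : (zs n).re * (zs n).im < 0 := h1
    have : 0 < (u₀ ^ 2 / ‖zs n‖ ^ 2) ^ 2 := by positivity
    nlinarith
  · obtain ⟨h1, h2, -⟩ := hspec.ws_prop hu₀ m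
    exact mul_neg_of_neg_of_pos h1 h2

theorem HasSimpleDiscreteSpectrum.norm_zeta (hspec : HasSimpleDiscreteSpectrum α u₀ um up u zs ws)
    (hu₀ : 0 < u₀) (n : Fin N₁) :
    ‖zeta u₀ zs ws (Sum.inl (Sum.inr n))‖ < u₀ := by
  obtain ⟨-, -, h3⟩ := hspec.zs_mem n
  have h0 : 0 < ‖zs n‖ := hu₀.trans h3
  rw [zeta, Sum.elim_inl, Sum.elim_inr, norm_neg, norm_div, RCLike.norm_conj, norm_pow,
    Complex.norm_real, Real.norm_of_nonneg hu₀.le, div_lt_iff₀ h0]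
  nlinarith

/-- The three families are separated by their modulus: larger than, smaller than and equal to `u₀`.
Within a family, equal squares mean equality up to sign, and the positive imaginary parts of the
`z_n` and `w_m` exclude the minus sign. -/
theorem HasSimpleDiscreteSpectrum.zeta_sq_injective
    (hspec : HasSimpleDiscreteSpectrum α u₀ um up u zs ws) (hu₀ : 0 < u₀) :
    Function.Injective fun j => zeta u₀ zs ws j ^ 2 := by
  intro i j hij
  have hsq : zeta u₀ zs ws i = zeta u₀ zs ws j ∨ zeta u₀ zs ws i = -zeta u₀ zs ws j :=
    sq_eq_sq_iff_eq_or_eq_neg.1 hij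
  have hn : ‖zeta u₀ zs ws i‖ = ‖zeta u₀ zs ws j‖ := by
    rcases hsq with h | h
    · rw [h]
    · rw [h, norm_neg]
  have n1 : ∀ n, u₀ < ‖zeta u₀ zs ws (Sum.inl (Sum.inl n))‖ := fun n => (hspec.zs_mem n).2.2
  have n2 := hspec.norm_zeta hu₀
  have n3 : ∀ m, ‖zeta u₀ zs ws (Sum.inr m)‖ = u₀ := fun m => (hspec.ws_prop hu₀ m).2.2
  have hz : ∀ n m, zs n = zs m ∨ zs n = -zs m → n = m := by
    rintro n m (h | h)
    · exact hspec.zs_injective h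
    · have h1 := (hspec.zs_mem n).2.1
      have h2 := (hspec.zs_mem m).2.1
      rw [h, Complex.neg_im] at h1
      linarith
  rcases i with (n | n) | n <;> rcases j with (m | m) | m
  · rw [hz n m hsq]
  · linarith [n1 n, n2 m]
  · linarith [n1 n, n3 m]
  · linarith [n2 n, n1 m]
  · have hq : -(u₀ : ℂ) ^ 2 ≠ 0 := branch_ne_zero hu₀
    have hinv : ∀ z : ℂ, -((u₀ : ℂ) ^ 2 / conj z) = -(u₀ : ℂ) ^ 2 * conj z⁻¹ := fun z => by
      rw [map_inv₀, ← div_eq_mul_inv, neg_div]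
    have : zs n = zs m ∨ zs n = -zs m := by
      simp only [zeta, Sum.elim_inl, Sum.elim_inr, hinv] at hsq
      rcases hsq with h | h
      · left
        have := mul_left_cancel₀ hq h
        exact inv_injective ((starRingEnd ℂ).injective this)
      · right
        rw [← mul_neg, ← map_neg, ← inv_neg] at h
        have := mul_left_cancel₀ hq h
        exact inv_injective ((starRingEnd ℂ).injective this)
    rw [hz n m this]
  · linarith [n2 n, n3 m]
  · linarith [n3 n, n1 m]
  · linarith [n3 n, n2 m]
  · rcases hsq with h | h
    · rw [hspec.ws_injective h]
    · have h1 := (hspec.ws_prop hu₀ n).2.1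
      have h2 := (hspec.ws_prop hu₀ m).2.1
      have h' : ws n = -ws m := h
      rw [h', Complex.neg_im] at h1
      linarith

end Spectrum

end Assembly

end MNLS
end

noncomputable section
namespace MNLS

open Set Filter Topology MeasureTheory

/-! ### The linear system for the values of the Jost solution -/

theorem conj_theta (α u₀ x t : ℝ) (z : ℂ) :
    conj (theta α u₀ x t z) = theta α u₀ x t (conj z) := by
  simp [theta, specK, specLam, map_ofNat]

/-- Substituting the equations for `conj (E j)` into those for `A n` produces the double sum
`A_{nk}`; multiplication by `conj μ` removes the phase. -/
theorem solM_mulVec_eq_solB {ι : Type} [Fintype ι] [DecidableEq ι] (α u₀ : ℝ) (um : ℂ)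
    (ζ C : ι → ℂ) (x t : ℝ) {μ : ℂ} (hμ : conj μ * μ = 1) {A E : ι → ℂ}
    (h₁ : ∀ n, A n = μ - ∑ j, 2 * solC α u₀ ζ C x t j (conj (ζ n)) * conj (E j))
    (h₂ : ∀ j, conj (E j) = -(um * μ) +
      ∑ k, 2 * ζ j ^ 2 * conj (solC α u₀ ζ C x t k (conj (ζ j))) * A k) :
    (solM α u₀ ζ C x t).mulVec (fun n => conj μ * A n) = solB α u₀ um ζ C x t := by
  funext n
  have e1 : ∑ j, 2 * solC α u₀ ζ C x t j (conj (ζ n)) * conj (E j) =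
      -(2 * um * μ * ∑ j, solC α u₀ ζ C x t j (conj (ζ n))) +
        ∑ k, solA α u₀ ζ C x t n k * A k := by
    have e2 : ∀ j, 2 * solC α u₀ ζ C x t j (conj (ζ n)) * conj (E j) =
        -(2 * um * μ * solC α u₀ ζ C x t j (conj (ζ n))) + ∑ k, 4 * ζ j ^ 2 *
          solC α u₀ ζ C x t j (conj (ζ n)) * conj (solC α u₀ ζ C x t k (conj (ζ j))) * A k := by
      intro j
      rw [h₂ j, mul_add, Finset.mul_sum]
      congr 1
      · ring
      · exact Finset.sum_congr rfl fun k _ => by ring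
    rw [Finset.sum_congr rfl fun j _ => e2 j, Finset.sum_add_distrib, Finset.sum_neg_distrib,
      ← Finset.mul_sum, Finset.sum_comm]
    congr 1
    refine Finset.sum_congr rfl fun k _ => ?_
    rw [solA, Matrix.of_apply, Finset.sum_mul]
  rw [solM, Matrix.add_mulVec, Matrix.one_mulVec, Pi.add_apply, solB]
  have e3 : (solA α u₀ ζ C x t).mulVec (fun n => conj μ * A n) n =
      conj μ * ∑ k, solA α u₀ ζ C x t n k * A k := by
    rw [Matrix.mulVec, dotProduct, Finset.mul_sum]
    exact Finset.sum_congr rfl fun k _ => by ring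
  rw [e3, h₁ n, e1]
  linear_combination (1 + 2 * um * ∑ j, solC α u₀ ζ C x t j (conj (ζ n))) * hμ

/-! ### Residues at the zeros of `s₁₁` -/

section Residue

variable {α u₀ : ℝ} {um up : ℂ} {u : ℝ → ℝ → ℂ} {a e a' e' : ℂ → ℝ → ℂ} {t : ℝ}

theorem sq_mem_lowerH {z : ℂ} (hz : z ∈ Dplus) : (z ^ 2).im < 0 := by
  rw [sq_im]
  have : z.re * z.im < 0 := hz
  linarith

theorem mem_lowerH_of_im_neg {s : ℂ} (hs : s.im < 0) : s ∈ lowerH :=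
  ⟨hs.le, by rintro rfl; simp at hs⟩

theorem s11_eq_scat (hα : 0 < α) (hu : IsNZBCSolution α um up u) (hum : ‖um‖ = u₀)
    (hup : ‖up‖ = u₀) (h : IsJostPair α u₀ um (fun x => u x t) atBot upperH a e)
    (h' : IsJostPair α u₀ up (fun x => u x t) atTop lowerH a' e') (x : ℝ) {z : ℂ}
    (hz : z ∈ Dplus) : s11 α u₀ um up u z =
      scat u₀ (fun s => a s x) (fun s => e s x) (fun s => a' s x) (fun s => e' s x) (z ^ 2) := by
  have h1 := sq_mem_lowerH hz
  have hz0 : z ≠ 0 := by rintro rfl; simp at h1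
  exact s11_eq hα hu hum hup hz0 (mem_lowerH_of_im_neg h1) x h h'

/-- The residue conditions at a simple zero of `s₁₁`. -/
theorem residue_conditions (hα : 0 < α) (hu₀ : 0 < u₀) (hu : IsNZBCSolution α um up u)
    (hum : ‖um‖ = u₀) (hup : ‖up‖ = u₀) (hρ : IsReflectionless α u₀ um up u)
    (h : IsJostPair α u₀ um (fun x => u x t) atBot upperH a e)
    (h' : IsJostPair α u₀ up (fun x => u x t) atTop lowerH a' e') (x : ℝ) {z : ℂ}
    (hz : z ∈ Dplus) (h0 : s11 α u₀ um up u z = 0) (hd : deriv (s11 α u₀ um up u) z ≠ 0) :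
    let S := scat u₀ (fun s => a s x) (fun s => e s x) (fun s => a' s x) (fun s => e' s x)
    let d := normingConst α u₀ um up u z * Complex.exp (-(2 * Complex.I * theta α u₀ x t z))
    deriv S (z ^ 2) ≠ 0 ∧
      a' (z ^ 2) x / deriv S (z ^ 2) = -(2 * d * conj (e (conj (z ^ 2)) x)) ∧
      e' (z ^ 2) x / deriv S (z ^ 2) = 2 * z ^ 2 * d * conj (a (conj (z ^ 2)) x) := by
  intro S d
  have him := sq_mem_lowerH hz
  have hlow := mem_lowerH_of_im_neg him
  have hz0 : z ≠ 0 := by rintro rfl; simp at him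
  have hz' : z ^ 2 + (u₀ : ℂ) ^ 2 ≠ 0 := fun h1 => by
    rw [eq_neg_of_add_eq_zero_left h1, branch_im] at him
    exact lt_irrefl _ him
  have hJ := jumpProblem_of_reflectionless hα hu₀ hu hum hup hρ h h' x
  have hSd : HasDerivAt S (deriv S (z ^ 2)) (z ^ 2) := (hJ.differentiableAt_scat him).hasDerivAt
  have hopen : Dplus ∈ 𝓝 z :=
    (isOpen_lt (Complex.continuous_re.mul Complex.continuous_im) continuous_const).mem_nhds hz
  -- The chain rule for `s = z²`: the factor `2z` relating the two derivatives is the origin of the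
  -- factors `2` in the residues.
  have hds : deriv (s11 α u₀ um up u) z = deriv S (z ^ 2) * (2 * z) := by
    have h1 : HasDerivAt (fun w => S (w ^ 2)) (deriv S (z ^ 2) * (2 * z)) z := by
      have h2 : HasDerivAt (fun w : ℂ => w ^ 2) (2 * z) z := by simpa using hasDerivAt_pow 2 z
      exact hSd.comp z h2
    refine (h1.congr_of_eventuallyEq ?_).deriv
    filter_upwards [hopen] with w hw
    exact s11_eq_scat hα hu hum hup h h' x hw
  have hS0 : deriv S (z ^ 2) ≠ 0 := fun h1 => hd (by rw [hds, h1, zero_mul])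
  refine ⟨hS0, ?_⟩
  have hb := propConst_spec hα hu hum hup hz0 hz' hlow h0 x t
  rw [(jostMinus_one_spec hα hu hum hz0 hlow).2 t a e h x,
    (jostPlus_zero_spec hα hu hup hz0 hlow).2 t a' e' h' x] at hb
  have hb0 := congrFun hb 0
  have hb1 := congrFun hb 1
  simp only [Pi.smul_apply, smul_eq_mul, Matrix.cons_val_zero, Matrix.cons_val_one] at hb0 hb1
  have hexp : Complex.exp (-(2 * Complex.I * theta α u₀ x t z)) =
      Complex.exp (-(Complex.I * theta α u₀ x t z)) * Complex.exp (-(Complex.I * theta α u₀ x t z)) := by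
    rw [← Complex.exp_add]; congr 1; ring
  have hinv := exp_mul_exp_neg (Complex.I * theta α u₀ x t z)
  simp only [d, normingConst, hds, hexp]
  generalize Complex.exp (-(Complex.I * theta α u₀ x t z)) = m at *
  generalize Complex.exp (Complex.I * theta α u₀ x t z) = m' at *
  generalize propConst α u₀ um up u z = b at *
  generalize deriv S (z ^ 2) = D at *
  have k0 : a' (z ^ 2) x = -(b * m * m * conj (e (conj (z ^ 2)) x) / z) := by
    linear_combination m * hb0 - a' (z ^ 2) x * hinv
  have k1 : e' (z ^ 2) x = z * b * m * m * conj (a (conj (z ^ 2)) x) := by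
    have : e' (z ^ 2) x = z * (e' (z ^ 2) x / z) := by field_simp
    rw [this]
    linear_combination z * m * hb1 - z * (e' (z ^ 2) x / z) * hinv
  rw [k0, k1]
  constructor
  · field_simp
  · field_simp

end Residue

end MNLS
end

noncomputable section
namespace MNLS

open Set Filter Topology MeasureTheory

/-! ### Limits of partial fractions along the imaginary axis -/

theorem tendsto_partial_fractions_atTop {ι : Type*} [Fintype ι] (r σ : ι → ℂ) :
    Tendsto (fun τ : ℝ => ∑ j, r j / (Complex.I * τ - σ j)) atTop (𝓝 0) := by
  have h : ∀ j, Tendsto (fun τ : ℝ => r j / (Complex.I * τ - σ j)) atTop (𝓝 0) := by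
    intro j
    have h1 : Tendsto (fun τ : ℝ => Complex.I * τ - σ j) atTop (Bornology.cobounded ℂ) := by
      rw [← tendsto_norm_atTop_iff_cobounded]
      refine tendsto_atTop_mono' _ ?_ (tendsto_atTop_add_const_right atTop (-‖σ j‖) tendsto_id)
      filter_upwards [eventually_gt_atTop 0] with τ hτ
      have := norm_sub_norm_le (Complex.I * (τ : ℂ)) (σ j)
      rw [norm_I_mul hτ] at this
      simpa [sub_eq_add_neg] using this
    simpa [div_eq_mul_inv] using (tendsto_inv₀_cobounded.comp h1).const_mul (r j)
  simpa using tendsto_finsetSum Finset.univ fun j _ => h j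

theorem tendsto_partial_fractions_zero {ι : Type*} [Fintype ι] (r σ : ι → ℂ)
    (hσ : ∀ j, σ j ≠ 0) (q : ℝ) :
    Tendsto (fun τ : ℝ => ∑ j, r j / (Complex.I * (q / τ : ℝ) - σ j)) atTop
      (𝓝 (∑ j, r j / -σ j)) := by
  refine tendsto_finsetSum _ fun j _ => ?_
  have h1 : Tendsto (fun τ : ℝ => q / τ) atTop (𝓝 0) := tendsto_const_nhds.div_atTop tendsto_id
  have h2 : Tendsto (fun τ : ℝ => Complex.I * (q / τ : ℝ) - σ j) atTop (𝓝 (-σ j)) := by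
    have := (((Complex.continuous_ofReal.tendsto 0).comp h1).const_mul Complex.I).sub_const (σ j)
    simpa using this
  exact tendsto_const_nhds.div h2 (neg_ne_zero.2 (hσ j))

/-! ### Reconstruction -/

/-- The special shape of the discrete spectrum matters only through two properties: the points lie
in `D⁺`, and their squares are distinct. Any finite family with these properties is therefore
allowed here. -/
theorem soliton_formula {α u₀ : ℝ} (hα : 0 < α) (hu₀ : 0 < u₀) {um up : ℂ} (hum : ‖um‖ = u₀)
    (hup : ‖up‖ = u₀) {u : ℝ → ℝ → ℂ} (hu : IsNZBCSolution α um up u)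
    (hρ : IsReflectionless α u₀ um up u) {ι : Type} [Fintype ι] [DecidableEq ι] {ζ C : ι → ℂ}
    (hζ : ∀ j, ζ j ∈ Dplus) (hinj : Function.Injective fun j => ζ j ^ 2)
    (hzeros : ∀ z ∈ Dplus, s11 α u₀ um up u z = 0 ↔ ∃ n, z = ζ n ∨ z = -ζ n)
    (hsimple : ∀ n, deriv (s11 α u₀ um up u) (ζ n) ≠ 0)
    (hC : ∀ n, C n = normingConst α u₀ um up u (ζ n)) (x t : ℝ) :
    (solM α u₀ ζ C x t).det ≠ 0 ∧
    u x t = Complex.exp (2 * Complex.I * nuMinus α u₀ u x t) * um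
        + 2 * Complex.exp (2 * Complex.I * nuMinus α u₀ u x t)
          * ((solMaug α u₀ um ζ C x t).det / (solM α u₀ ζ C x t).det) := by
  have him : ∀ j, (ζ j ^ 2).im < 0 := fun j => sq_mem_lowerH (hζ j)
  have hne : ∀ j, ζ j ^ 2 ≠ 0 := fun j => (mem_lowerH_of_im_neg (him j)).2
  have hdet := det_solM_ne_zero α u₀ ζ C x t hinj him
  refine ⟨hdet, ?_⟩
  obtain ⟨a, e, h⟩ := hu.exists_left_pair hα hum t
  obtain ⟨a', e', h'⟩ := hu.exists_right_pair hα hup t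
  have hJ := jumpProblem_of_reflectionless hα hu₀ hu hum hup hρ h h' x
  have hs11 : ∀ z ∈ Dplus, _ := fun z hz => s11_eq_scat hα hu hum hup h h' x hz
  have hs0 : ∀ n, s11 α u₀ um up u (ζ n) = 0 := fun n => (hzeros _ (hζ n)).2 ⟨n, Or.inl rfl⟩
  have hres := fun n => residue_conditions hα hu₀ hu hum hup hρ h h' x (hζ n) (hs0 n) (hsimple n)
  have hw := hu.isLeftPotential hum t
  have hlimA := h.tendsto_fst_I_mul hα hw x
  have hlimE := h.tendsto_snd_I_mul hα hw x
  have hnu : Complex.exp (2 * Complex.I * nuMinus α u₀ u x t) =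
      Complex.exp (Complex.I * phase α u₀ (fun x => u x t) x) *
        Complex.exp (Complex.I * phase α u₀ (fun x => u x t) x) := by
    rw [← Complex.exp_add, show nuMinus α u₀ u x t = phase α u₀ (fun x => u x t) x from rfl]
    congr 1; ring
  rw [hnu]
  have hμn : ‖Complex.exp (Complex.I * phase α u₀ (fun x => u x t) x)‖ = 1 := norm_exp_I_mul_real _
  set μ := Complex.exp (Complex.I * phase α u₀ (fun x => u x t) x) with hμdef
  have hμ : conj μ * μ = 1 := by rw [mul_comm, ← ofReal_norm_sq, hμn]; simp
  set S := scat u₀ (fun s => a s x) (fun s => e s x) (fun s => a' s x) (fun s => e' s x) with hS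
  set d : ι → ℂ := fun n => C n * Complex.exp (-(2 * Complex.I * theta α u₀ x t (ζ n))) with hd
  set A : ι → ℂ := fun n => a (conj (ζ n ^ 2)) x with hA
  set E : ι → ℂ := fun n => e (conj (ζ n ^ 2)) x with hE
  obtain ⟨⟨cA, pA⟩, ⟨cE, pE⟩⟩ := hJ.partial_fractions (σ := fun j => ζ j ^ 2) hinj him
    -- A point of the lower half-plane is `z²` with `z ∈ D⁺`, and `± ζ n` have the same square.
    (fun s hs h0 => by
      obtain ⟨z, rfl⟩ := exists_sq_eq s
      have hz : z ∈ Dplus := by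
        rw [sq_im] at hs
        show z.re * z.im < 0
        linarith
      obtain ⟨n, hn | hn⟩ := (hzeros z hz).1 ((hs11 z hz).trans h0)
      · exact ⟨n, by rw [hn]⟩
      · exact ⟨n, by rw [hn, neg_sq]⟩)
    (fun n => (hs11 _ (hζ n)).symm.trans (hs0 n)) (fun n => (hres n).1)
  have hdn : ∀ n, normingConst α u₀ um up u (ζ n) *
      Complex.exp (-(2 * Complex.I * theta α u₀ x t (ζ n))) = d n := fun n => by rw [← hC]
  rw [← hS] at pA pE
  have rA : ∀ n, a' (ζ n ^ 2) x / deriv S (ζ n ^ 2) = -(2 * d n * conj (E n)) := fun n => by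
    rw [(hres n).2.1, hdn]
  have rE : ∀ n, e' (ζ n ^ 2) x / deriv S (ζ n ^ 2) = 2 * ζ n ^ 2 * d n * conj (A n) := fun n => by
    rw [(hres n).2.2, hdn]
  simp only [rA] at pA
  simp only [rE] at pE
  have hI : ∀ τ : ℝ, 0 < τ → 0 < (Complex.I * (τ : ℂ)).im := fun τ hτ => by simpa using hτ
  -- The simple fractions vanish as `s → i∞`, so both constants are the limits of the left pair
  -- along the imaginary axis.
  have hcA : cA = μ := by
    refine tendsto_nhds_unique ?_ hlimA
    have := (tendsto_partial_fractions_atTop (fun n => -(2 * d n * conj (E n)))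
      (fun n => ζ n ^ 2)).const_add cA
    rw [add_zero] at this
    refine this.congr' ?_
    filter_upwards [eventually_gt_atTop 0] with τ hτ using (pA _ (hI τ hτ)).symm
  have hcE : cE = -(conj (u x t) * μ) := by
    refine tendsto_nhds_unique ?_ hlimE
    have := (tendsto_partial_fractions_atTop (fun n => 2 * ζ n ^ 2 * d n * conj (A n))
      (fun n => ζ n ^ 2)).const_add cE
    rw [add_zero] at this
    refine this.congr' ?_
    filter_upwards [eventually_gt_atTop 0] with τ hτ using (pE _ (hI τ hτ)).symm
  -- A second expression for the same constant, from `s → 0`: by the inversion symmetry `e` at `i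
  -- u₀⁴ / τ` equals `-conj um` times the conjugate of `a` at `iτ`, which tends to `μ`.
  have hcE' : cE = -(conj um * conj μ) + ∑ n, 2 * d n * conj (A n) := by
    have l1 := (tendsto_partial_fractions_zero (fun n => 2 * ζ n ^ 2 * d n * conj (A n))
      (fun n => ζ n ^ 2) hne (u₀ ^ 4)).const_add cE
    have l2 := (((Complex.continuous_conj.tendsto _).comp hlimA).const_mul (conj um)).neg
    have l3 := tendsto_nhds_unique (l1.congr' (f₂ := fun τ : ℝ => -(conj um * conj (a (Complex.I * τ) x))) ?_) l2
    · have e1 : ∑ n, 2 * ζ n ^ 2 * d n * conj (A n) / -ζ n ^ 2 = -∑ n, 2 * d n * conj (A n) := by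
        rw [← Finset.sum_neg_distrib]
        refine Finset.sum_congr rfl fun n _ => ?_
        have hz : ζ n ≠ 0 := fun h0 => hne n (by rw [h0]; simp)
        field_simp
      rw [e1] at l3
      linear_combination l3
    · filter_upwards [eventually_gt_atTop 0] with τ hτ
      have hτ' : (τ : ℂ) ≠ 0 := by exact_mod_cast hτ.ne'
      have hu' : (u₀ : ℂ) ≠ 0 := by exact_mod_cast hu₀.ne'
      have hpos : 0 < u₀ ^ 4 / τ := by positivity
      rw [← pE _ (hI _ hpos)]
      refine (hJ.left.inv_snd _ (I_mul_mem_upperH hpos)).trans ?_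
      have e2 : (u₀ : ℂ) ^ 4 / conj (Complex.I * ((u₀ ^ 4 / τ : ℝ) : ℂ)) = Complex.I * τ := by
        rw [map_mul, Complex.conj_I, Complex.conj_ofReal]
        push_cast
        field_simp
        rw [Complex.I_sq]
      simp only [e2]
  have hc : ∀ n, 0 < (conj (ζ n ^ 2)).im := fun n => by
    rw [Complex.conj_im]; linarith [him n]
  have hsub : ∀ j k, ζ j ^ 2 - conj (ζ k ^ 2) ≠ 0 := fun j k h0 => by
    have := congrArg Complex.im h0
    rw [Complex.sub_im, Complex.zero_im] at this
    linarith [him j, hc k]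
  have h₁ : ∀ n, A n = μ - ∑ j, 2 * solC α u₀ ζ C x t j (conj (ζ n)) * conj (E j) := by
    intro n
    have e0 : A n = cA + ∑ j, -(2 * d j * conj (E j)) / (conj (ζ n ^ 2) - ζ j ^ 2) := pA _ (hc n)
    rw [e0, hcA, sub_eq_add_neg, ← Finset.sum_neg_distrib]
    congr 1
    refine Finset.sum_congr rfl fun j _ => ?_
    rw [solC_eq, ← map_pow]
    ring
  -- The constant and the fraction merge because `1 + s_k / (conj s_j - s_k) = conj s_j / (conj s_j
  -- - s_k)`, with `s_k = ζ_k²`.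
  have h₂ : ∀ j, conj (E j) = -(um * μ) +
      ∑ k, 2 * ζ j ^ 2 * conj (solC α u₀ ζ C x t k (conj (ζ j))) * A k := by
    intro j
    have e1 : E j = -(conj um * conj μ) + ∑ k, 2 * conj (ζ j ^ 2) *
        solC α u₀ ζ C x t k (conj (ζ j)) * conj (A k) := by
      have e0 : E j = cE + ∑ k, 2 * ζ k ^ 2 * d k * conj (A k) / (conj (ζ j ^ 2) - ζ k ^ 2) :=
        pE _ (hc j)
      rw [e0, hcE', add_assoc, ← Finset.sum_add_distrib]
      congr 1
      refine Finset.sum_congr rfl fun k _ => ?_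
      have h0 : conj (ζ j ^ 2) - ζ k ^ 2 ≠ 0 := fun h0 => hsub k j (by
        rw [← neg_sub, h0, neg_zero])
      rw [solC_eq, ← map_pow, hd]
      field_simp
      ring
    rw [e1]
    simp only [map_add, map_neg, map_mul, map_sum, Complex.conj_conj, map_ofNat]
  have hX := solM_mulVec_eq_solB α u₀ um ζ C x t hμ h₁ h₂
  rw [det_solMaug_div α u₀ um ζ C x t hdet _ hX]
  have hY : ∀ n, solY α u₀ ζ C x t n = conj (d n) := fun n => by
    rw [solY, hd, map_mul, ← Complex.exp_conj, ← conj_theta]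
    simp [map_ofNat]
  -- The potential is obtained by equating the two expressions for `cE` and conjugating.
  have hfin : u x t * conj μ = um * μ - ∑ n, 2 * conj (d n) * A n := by
    have := congrArg conj (hcE.symm.trans hcE')
    simp only [map_add, map_neg, map_mul, map_sum, Complex.conj_conj, map_ofNat] at this
    linear_combination -this
  have hsum : ∑ n, solY α u₀ ζ C x t n * (conj μ * A n) = conj μ * ∑ n, conj (d n) * A n := by
    rw [Finset.mul_sum]
    exact Finset.sum_congr rfl fun n _ => by rw [hY]; ring
  have hsum' : ∑ n, 2 * conj (d n) * A n = 2 * ∑ n, conj (d n) * A n := by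
    rw [Finset.mul_sum]
    exact Finset.sum_congr rfl fun n _ => by ring
  rw [hsum]
  rw [hsum'] at hfin
  linear_combination μ * hfin - (u x t - 2 * μ * (∑ n, conj (d n) * A n)) * hμ

end MNLS
end

theorem mainTheorem1 (α u₀ : ℝ) (hα : 0 < α) (hu₀ : 0 < u₀)
    (um up : ℂ) (hum : ‖um‖ = u₀) (hup : ‖up‖ = u₀)
    (u : ℝ → ℝ → ℂ) (hu : MNLS.IsNZBCSolution α um up u)
    (hρ : MNLS.IsReflectionless α u₀ um up u)
    (N₁ N₂ : ℕ) (zs : Fin N₁ → ℂ) (ws : Fin N₂ → ℂ)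
    (hspec : MNLS.HasSimpleDiscreteSpectrum α u₀ um up u zs ws)
    (ζ C : MNLS.SpecIdx N₁ N₂ → ℂ)
    (hζ : ζ = MNLS.zeta u₀ zs ws)
    (hC : ∀ n, C n = MNLS.normingConst α u₀ um up u (ζ n))
    (x t : ℝ) :
    (MNLS.solM α u₀ ζ C x t).det ≠ 0 ∧
    u x t =
      Complex.exp (2 * Complex.I * MNLS.nuMinus α u₀ u x t) * um
        + 2 * Complex.exp (2 * Complex.I * MNLS.nuMinus α u₀ u x t)
          * ((MNLS.solMaug α u₀ um ζ C x t).det / (MNLS.solM α u₀ ζ C x t).det) := by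
  subst hζ
  exact MNLS.soliton_formula hα hu₀ hum hup hu hρ (fun j => hspec.zeta_mem hu₀ j)
    (hspec.zeta_sq_injective hu₀) hspec.zeros hspec.simple hC x t
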